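/- Let $d\in\mathbb N_0$, $p,q\in[1,\infty]$, and let $\phi\in\mathcal S(\mathbb R^d)$ be a mollifier with $\int\phi=1$ and $\int x^\alpha\phi(x)\,dx=0$ for all multi-indices $\alpha\ne0$; put $\phi_\varepsilon=\varepsilon^{-d}\phi(\cdot/\varepsilon)$. All functions and distributions are complex valued, $\omega\Subset\Omega$ means that $\omega$ is open with compact closure contained in $\Omega$, and integrals $\int_0^1(\cdot)^q\,\frac{d\varepsilon}{\varepsilon}$ are replaced by suprema over $(0,1)$ when $q=\infty$. For $\Omega\subseteq\mathbb R^d$ open, let $\mathcal E_q(\Omega)$ (respectively $\mathcal N_q(\Omega)$) be the space of nets $(f_\varepsilon)_{\varepsilon\in(0,1)}$ in $C^\infty(\Omega)$, with $\varepsilon\mapsto f_\varepsilon\in C^\infty(\Omega)$ continuous, such that for all $m\in\mathbb N_0$ and all $\omega\Subset\Omega$ the condition $$\int_0^1\varepsilon^{qt}\|f_\varepsilon\|_{W^{m,p}(\omega)}^q\,\frac{d\varepsilon}{\varepsilon}<\infty$$ holds for some (respectively, for every) $t\in\mathbb R$. Put $\mathcal G_q(\Omega)=\mathcal E_q(\Omega)/\mathcal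 N_q(\Omega)$. For $k\in\mathbb N_0$ and $s\in\mathbb R$ let $\mathcal G^{k,-s}_{q,p}(\Omega)$ be the set of all elements of $\mathcal G_q(\Omega)$ having a representative $(f_\varepsilon)_\varepsilon\in\mathcal E_q(\Omega)$ with $\int_0^1\varepsilon^{sq}\|f_\varepsilon\|_{W^{k,p}(\omega)}^q\frac{d\varepsilon}{\varepsilon}<\infty$ for every $\omega\Subset\Omega$. For $r\in\mathbb R$, an LP-pair of order $r$ is a pair $\varphi,\psi\in\mathcal S(\mathbb R^d)$ such that for some $\sigma>0$ and $\eta\in(0,1)$ one has $\hat\varphi(\xi)\neq0$ for $|\xi|\le\sigma$ and $\hat\psi(\xi)\ne0$ for $\eta\sigma\le|\xi|\le\sigma$, and such that $\int t^\alpha\psi(t)\,dt=0$ for all $|\alpha|\le\lfloor r\rfloor$. Given an LP-pair of order $r$, $B^r_{p,q}(\mathbb R^d)$ is the space of all $T\in\mathcal S'(\mathbb R^d)$ with $$\|T*\varphi\|_{L^p(\mathbb R^d)}+\Big(\int_0^1y^{-qr}\|T*\psi_y\|_{L^p(\mathbb R^d)}^q\,\frac{dy}{y}\Big)^{1/q}<\infty,\qquad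 \psi_y=y^{-d}\psi(\cdot/y),$$ and $B^r_{p,q,loc}(\Omega)=\{T\in\mathcal D'(\Omega):\chi T\in B^r_{p,q}(\mathbb R^d)\text{ for all }\chi\in\mathcal D(\Omega)\}$. **Theorem.** There is a unique family $\iota$ of injective linear maps $\iota=\iota_\Omega:\mathcal D'(\Omega)\to\mathcal G_q(\Omega)$, $\Omega\subseteq\mathbb R^d$ open, that is compatible with restriction to smaller open sets and satisfies $\iota(T)=[((T*\phi_\varepsilon)|_\Omega)_\varepsilon]$ for every compactly supported distribution $T$ on $\Omega$. For this $\iota$, every open $\Omega\subseteq\mathbb R^d$, every $k\in\mathbb N_0$, every $s>0$, and every choice of the LP-pair of order $k-s$ that is used to define $B^{k-s}_{p,q}(\mathbb R^d)$, $$\mathcal G^{k,-s}_{q,p}(\Omega)\cap\iota(\mathcal D'(\Omega))=\iota\big(B^{k-s}_{p,q,loc}(\Omega)\big).$$ -/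

import Mathlib

open MeasureTheory Set TopologicalSpace
open scoped ENNReal NNReal Distributions SchwartzMap FourierTransform

noncomputable section

namespace BesovGF

/-- The Euclidean space `ℝ^d`. -/
abbrev E (d : ℕ) := EuclideanSpace ℝ (Fin d)

variable {d : ℕ}

/-! ### Distributions, restriction, multiplication and convolution -/

/-- The space `𝓓'(Ω)` of complex distributions: continuous complex-linear functionals on the space
of complex-valued smooth functions with compact support in `Ω`. -/
abbrev Distr (Ω : Opens (E d)) := 𝓓(Ω, ℂ) →L[ℂ] ℂ

/-- Restriction of distributions to a smaller open set (only meaningful for `ω ≤ Ω`). -/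
def restrictDistr {Ω : Opens (E d)} (ω : Opens (E d)) (T : Distr Ω) : Distr ω :=
  T.comp (TestFunction.monoCLM ℂ : 𝓓(ω, ℂ) →L[ℂ] 𝓓(Ω, ℂ))

/-- The product `χ · f` of a test function `χ` and a smooth function `f`, as a test function. -/
def mulTest {Ω : Opens (E d)} (χ : 𝓓(Ω, ℂ)) (f : E d → ℂ) (hf : ContDiff ℝ (⊤ : ℕ∞) f) : 𝓓(Ω, ℂ) where
  toFun x := χ x * f x
  contDiff' := χ.contDiff.mul hf
  hasCompactSupport' := χ.hasCompactSupport.mul_right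
  tsupport_subset' := (tsupport_mul_subset_left (f := χ) (g := f)).trans χ.tsupport_subset

/-- Multiplication by a test function `χ`, as a continuous linear map `𝓓(Ω) → 𝓓(Ω)`. -/
def mulTestCLM {Ω : Opens (E d)} (χ : 𝓓(Ω, ℂ)) : 𝓓(Ω, ℂ) →L[ℂ] 𝓓(Ω, ℂ) :=
  TestFunction.limitCLM ℂ (fun f => mulTest χ f f.contDiff)
    (fun _ hK => TestFunction.ofSupportedInCLM ℂ hK ∘L
      ContDiffMapSupportedIn.bilinLeftCLM (ContinuousLinearMap.mul ℂ ℂ) χ.contDiff)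
    (fun _ _ _ => by ext x; simp [mulTest, mul_comm])

/-- The compactly supported distribution `χT ∈ 𝓓'(Ω)`, i.e. `⟨χT, f⟩ = ⟨T, χ f⟩`. -/
def mulDistr {Ω : Opens (E d)} (χ : 𝓓(Ω, ℂ)) (T : Distr Ω) : Distr Ω :=
  T.comp (mulTestCLM χ)

/-- Multiplication by a test function `χ`, as a continuous linear map `𝓢(ℝ^d) → 𝓓(Ω)`. -/
def cutoffCLM {Ω : Opens (E d)} (χ : 𝓓(Ω, ℂ)) : 𝓢(E d, ℂ) →L[ℂ] 𝓓(Ω, ℂ) where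
  toFun f := mulTest χ f (f.smooth ⊤)
  map_add' f g := by ext x; simp [mulTest, mul_add]
  map_smul' c f := by ext x; simp [mulTest]; ring
  cont := by
    have hχ : Function.HasTemperateGrowth (χ : E d → ℂ) :=
      χ.hasCompactSupport.hasTemperateGrowth χ.contDiff
    let K : Compacts (E d) := ⟨tsupport χ, χ.hasCompactSupport⟩
    let A : 𝓢(E d, ℂ) →ₗ[ℂ] ContDiffMapSupportedIn (E d) ℂ ⊤ K :=
      { toFun := fun f => .of_support_subset (f := fun x => χ x * f x)
          (χ.contDiff.mul (f.smooth ⊤)) (fun x hx => subset_tsupport _ (left_ne_zero_of_mul hx))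
        map_add' := fun f g => by ext x; exact mul_add _ _ _
        map_smul' := fun c f => by ext x; exact mul_left_comm _ _ _ }
    have hA : Continuous A := by
      refine WithSeminorms.continuous_of_isBounded (schwartz_withSeminorms ℂ (E d) ℂ)
        (ContDiffMapSupportedIn.withSeminorms ℂ (E d) ℂ ⊤ K) A (fun i => ?_)
      have hc : Continuous ((SchwartzMap.seminorm ℂ 0 i).comp
          (SchwartzMap.smulLeftCLM ℂ (χ : E d → ℂ)).toLinearMap :
          Seminorm ℂ 𝓢(E d, ℂ)) :=
        ((schwartz_withSeminorms ℂ (E d) ℂ).continuous_seminorm (0, i)).comp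
          (SchwartzMap.smulLeftCLM ℂ (χ : E d → ℂ)).continuous
      obtain ⟨s, C, -, hC⟩ := Seminorm.bound_of_continuous (schwartz_withSeminorms ℂ (E d) ℂ) _ hc
      refine ⟨s, C, le_trans (fun f => ?_) hC⟩
      change ContDiffMapSupportedIn.seminorm ℂ (E d) ℂ ⊤ K i (A f) ≤
        SchwartzMap.seminorm ℂ 0 i (SchwartzMap.smulLeftCLM ℂ (χ : E d → ℂ) f)
      rw [ContDiffMapSupportedIn.seminorm_top_le_iff ℂ (apply_nonneg _ _)]
      intro x _
      have h := SchwartzMap.norm_iteratedFDeriv_le_seminorm ℂ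
        (SchwartzMap.smulLeftCLM ℂ (χ : E d → ℂ) f) i x
      rwa [SchwartzMap.smulLeftCLM_apply hχ] at h
    exact (TestFunction.continuous_ofSupportedIn (Ω := Ω) (n := ⊤) (K := K)
      χ.tsupport_subset).comp hA

/-- The compactly supported distribution `χT`, regarded as a tempered distribution on `ℝ^d`:
`⟨χT, f⟩ = ⟨T, χ f⟩` for every Schwartz function `f`. -/
def mulTempered {Ω : Opens (E d)} (χ : 𝓓(Ω, ℂ)) (T : Distr Ω) : 𝓢'(E d, ℂ) :=
  ContinuousLinearMap.toPointwiseConvergenceCLM ℂ (RingHom.id ℂ) _ _ (T.comp (cutoffCLM χ))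

/-- The Schwartz function `y ↦ ψ (x - y)`. -/
def reflectTranslate (ψ : 𝓢(E d, ℂ)) (x : E d) : 𝓢(E d, ℂ) :=
  SchwartzMap.compSubConstCLM ℂ x
    (SchwartzMap.compCLMOfContinuousLinearEquiv ℂ (ContinuousLinearEquiv.neg ℝ) ψ)

/-- The convolution `T * ψ`, i.e. the function `x ↦ ⟨T, ψ(x - ·)⟩`. -/
def conv (T : 𝓢'(E d, ℂ)) (ψ : 𝓢(E d, ℂ)) (x : E d) : ℂ :=
  T (reflectTranslate ψ x)

/-- The dilate `ψ_ε = ε^{-d} ψ(· / ε)` (with the junk value `0` for `ε = 0`). -/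
def dilate (ψ : 𝓢(E d, ℂ)) (ε : ℝ) : 𝓢(E d, ℂ) :=
  if h : ε = 0 then 0 else
    ((ε ^ d)⁻¹ : ℝ) • SchwartzMap.compCLMOfContinuousLinearEquiv ℂ
      (ContinuousLinearEquiv.smulLeft (Units.mk0 ε⁻¹ (inv_ne_zero h)) : E d ≃L[ℝ] E d) ψ

@[simp] lemma reflectTranslate_apply (ψ : 𝓢(E d, ℂ)) (x y : E d) :
    reflectTranslate ψ x y = ψ (x - y) := by
  simp [reflectTranslate]

lemma dilate_apply (ψ : 𝓢(E d, ℂ)) {ε : ℝ} (hε : ε ≠ 0) (x : E d) :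
    dilate ψ ε x = ((ε ^ d)⁻¹ : ℝ) * ψ (ε⁻¹ • x) := by
  simp [dilate, hε, Units.smul_def]

@[simp] lemma mulTempered_apply {Ω : Opens (E d)} (χ : 𝓓(Ω, ℂ)) (T : Distr Ω) (f : 𝓢(E d, ℂ)) :
    mulTempered χ T f = T (mulTest χ f (f.smooth ⊤)) := rfl

@[simp] lemma mulDistr_apply {Ω : Opens (E d)} (χ : 𝓓(Ω, ℂ)) (T : Distr Ω) (f : 𝓓(Ω, ℂ)) :
    mulDistr χ T f = T (mulTest χ f f.contDiff) := rfl

/-! ### Mollifiers, Littlewood-Paley pairs and Besov spaces -/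

/-- The moment `∫ t^α ψ(t) dt`. -/
def moment (ψ : 𝓢(E d, ℂ)) (α : Fin d → ℕ) : ℂ :=
  ∫ t : E d, (∏ i, ((t i : ℝ) : ℂ) ^ α i) * ψ t

/-- `∫ φ = 1` and all higher moments of `φ` vanish. -/
structure IsMollifier (φ : 𝓢(E d, ℂ)) : Prop where
  integral_eq_one : ∫ x : E d, φ x = 1
  moment_eq_zero : ∀ α : Fin d → ℕ, α ≠ 0 → moment φ α = 0

/-- `(φ, ψ)` is an LP-pair of order `r`. -/
structure IsLPPair (φ ψ : 𝓢(E d, ℂ)) (r : ℝ) : Prop where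
  fourier_ne_zero : ∃ σ : ℝ, 0 < σ ∧ ∃ η ∈ Ioo (0 : ℝ) 1,
    (∀ ξ : E d, ‖ξ‖ ≤ σ → (𝓕 φ) ξ ≠ 0) ∧
    (∀ ξ : E d, η * σ ≤ ‖ξ‖ → ‖ξ‖ ≤ σ → (𝓕 ψ) ξ ≠ 0)
  moment_eq_zero : ∀ α : Fin d → ℕ, ((∑ i, α i : ℕ) : ℤ) ≤ ⌊r⌋ → moment ψ α = 0

/-- The weighted `L^q((0,1), dε/ε)` norm of `ε ↦ ε^s N(ε)`:
`(∫₀¹ ε^{sq} N(ε)^q dε/ε)^{1/q}` if `q < ∞`, and `sup_{0<ε<1} ε^s N(ε)` if `q = ∞`. -/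
def wNorm (q : ℝ≥0∞) (s : ℝ) (N : ℝ → ℝ≥0∞) : ℝ≥0∞ :=
  if q = ∞ then ⨆ ε ∈ Ioo (0 : ℝ) 1, ENNReal.ofReal (ε ^ s) * N ε
  else (∫⁻ ε in Ioo (0 : ℝ) 1,
    ENNReal.ofReal (ε ^ (s * q.toReal)) * N ε ^ q.toReal * ENNReal.ofReal ε⁻¹) ^ (1 / q.toReal)

/-- The Besov norm of order `r` of a tempered distribution, computed with the pair `(φ₀, ψ₀)`. -/
def besovNorm (φ₀ ψ₀ : 𝓢(E d, ℂ)) (r : ℝ) (p q : ℝ≥0∞) (T : 𝓢'(E d, ℂ)) : ℝ≥0∞ :=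
  eLpNorm (conv T φ₀) p volume +
    wNorm q (-r) (fun y => eLpNorm (conv T (dilate ψ₀ y)) p volume)

/-- The Besov space `B^r_{p,q}(ℝ^d)`, defined through the LP-pair `(φ₀, ψ₀)` of order `r`. -/
def besov (φ₀ ψ₀ : 𝓢(E d, ℂ)) (r : ℝ) (p q : ℝ≥0∞) : Set 𝓢'(E d, ℂ) :=
  {T | besovNorm φ₀ ψ₀ r p q T < ∞}

/-- The local Besov space `B^r_{p,q,loc}(Ω)`: all `T ∈ 𝓓'(Ω)` such that
`χT ∈ B^r_{p,q}(ℝ^d)` for every test function `χ` on `Ω`. -/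
def besovLoc (φ₀ ψ₀ : 𝓢(E d, ℂ)) (r : ℝ) (p q : ℝ≥0∞) (Ω : Opens (E d)) : Set (Distr Ω) :=
  {T | ∀ χ : 𝓓(Ω, ℂ), mulTempered χ T ∈ besov φ₀ ψ₀ r p q}

/-! ### Nets of smooth functions -/

/-- `ω ⋐ Ω`: the closure of `ω` is compact and contained in `Ω`. -/
def CompactlyIn (ω Ω : Opens (E d)) : Prop :=
  IsCompact (closure (ω : Set (E d))) ∧ closure (ω : Set (E d)) ⊆ Ω

/-- The partial derivative `∂_{j₁} ⋯ ∂_{j_m} f`. -/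
def partialDeriv {m : ℕ} (j : Fin m → Fin d) (f : E d → ℂ) (x : E d) : ℂ :=
  iteratedFDeriv ℝ m f x (fun i => EuclideanSpace.single (j i) 1)

/-- The Sobolev norm `‖f‖_{W^{k,p}(ω)}`: the maximum of the `L^p(ω)` norms of all partial
derivatives of `f` of order at most `k`. -/
def sobolevNorm (k : ℕ) (p : ℝ≥0∞) (ω : Opens (E d)) (f : E d → ℂ) : ℝ≥0∞ :=
  ⨆ (m : ℕ) (_ : m ≤ k) (j : Fin m → Fin d), eLpNorm (partialDeriv j f) p (volume.restrict ω)

/-- Nets `(f_ε)`. Only the values for `0 < ε < 1` and at points of the open set under consideration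
are relevant; nets that agree there are identified in the quotient below. -/
abbrev Net (d : ℕ) := ℝ → E d → ℂ

/-- A net of smooth functions on `Ω` such that `ε ↦ f_ε` is continuous from `(0,1)` to `C^∞(Ω)`. -/
structure IsSmoothNet (Ω : Opens (E d)) (f : Net d) : Prop where
  smooth : ∀ ε ∈ Ioo (0 : ℝ) 1, ContDiffOn ℝ (⊤ : ℕ∞) (f ε) Ω
  continuous : ∀ m : ℕ,
    ContinuousOn (fun z : ℝ × E d => iteratedFDeriv ℝ m (f z.1) z.2) (Ioo (0 : ℝ) 1 ×ˢ Ω)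

/-- The weighted `L^q(dε/ε)` norm of `ε ↦ ε^s ‖f_ε‖_{W^{k,p}(ω)}`. -/
def netNorm (q p : ℝ≥0∞) (s : ℝ) (k : ℕ) (ω : Opens (E d)) (f : Net d) : ℝ≥0∞ :=
  wNorm q s (fun ε => sobolevNorm k p ω (f ε))

/-! ### Facts needed to see that moderate and negligible nets form vector spaces -/

lemma wNorm_mono {q : ℝ≥0∞} {s s' : ℝ} (hs : s ≤ s') (N : ℝ → ℝ≥0∞) :
    wNorm q s' N ≤ wNorm q s N := by
  unfold wNorm
  split_ifs with h
  · exact iSup₂_mono fun ε hε => mul_le_mul' (ENNReal.ofReal_le_ofReal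
      (Real.rpow_le_rpow_of_exponent_ge hε.1 hε.2.le hs)) le_rfl
  · refine ENNReal.rpow_le_rpow (setLIntegral_mono' measurableSet_Ioo fun ε hε => ?_) (by positivity)
    exact mul_le_mul' (mul_le_mul' (ENNReal.ofReal_le_ofReal
      (Real.rpow_le_rpow_of_exponent_ge hε.1 hε.2.le
        (mul_le_mul_of_nonneg_right hs ENNReal.toReal_nonneg))) le_rfl) le_rfl

lemma wNorm_add_lt_top {q : ℝ≥0∞} (hq : 1 ≤ q) {s : ℝ} {N N₁ N₂ : ℝ → ℝ≥0∞}
    (hN : ∀ ε ∈ Ioo (0 : ℝ) 1, N ε ≤ N₁ ε + N₂ ε)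
    (hm : AEMeasurable N₁ (volume.restrict (Ioo (0 : ℝ) 1)))
    (h₁ : wNorm q s N₁ < ∞) (h₂ : wNorm q s N₂ < ∞) : wNorm q s N < ∞ := by
  unfold wNorm at *
  split_ifs at * with h
  · refine lt_of_le_of_lt (iSup₂_le fun ε hε => ?_) (ENNReal.add_lt_top.2 ⟨h₁, h₂⟩)
    calc ENNReal.ofReal (ε ^ s) * N ε
        ≤ ENNReal.ofReal (ε ^ s) * N₁ ε + ENNReal.ofReal (ε ^ s) * N₂ ε := by
          rw [← mul_add]; gcongr; exact hN ε hε
      _ ≤ _ := add_le_add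
          (le_iSup₂ (f := fun ε (_ : ε ∈ Ioo (0 : ℝ) 1) => ENNReal.ofReal (ε ^ s) * N₁ ε) ε hε)
          (le_iSup₂ (f := fun ε (_ : ε ∈ Ioo (0 : ℝ) 1) => ENNReal.ofReal (ε ^ s) * N₂ ε) ε hε)
  · have hq1 : 1 ≤ q.toReal := by simpa using ENNReal.toReal_mono h hq
    have hq0 : 0 < 1 / q.toReal := by positivity
    rw [ENNReal.rpow_lt_top_iff_of_pos hq0] at *
    set a : ℝ≥0∞ := (2 : ℝ≥0∞) ^ (q.toReal - 1)
    have ha : a ≠ ∞ := ENNReal.rpow_ne_top_of_nonneg (by linarith) (by simp)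
    refine lt_of_le_of_lt (b := a * (_ + _)) ?_
      (ENNReal.mul_lt_top ha.lt_top (ENNReal.add_lt_top.2 ⟨h₁, h₂⟩))
    rw [← lintegral_add_left' (by fun_prop), ← lintegral_const_mul' _ _ ha]
    refine setLIntegral_mono' measurableSet_Ioo fun ε hε => ?_
    calc ENNReal.ofReal (ε ^ (s * q.toReal)) * N ε ^ q.toReal * ENNReal.ofReal ε⁻¹
        ≤ ENNReal.ofReal (ε ^ (s * q.toReal)) * (a * (N₁ ε ^ q.toReal + N₂ ε ^ q.toReal)) *
          ENNReal.ofReal ε⁻¹ := by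
          gcongr
          exact (ENNReal.rpow_le_rpow (hN ε hε) (by positivity)).trans
            (ENNReal.rpow_add_le_mul_rpow_add_rpow _ _ hq1)
      _ = _ := by ring

lemma eLpNormEssSup_eq_iSup_dense {ω : Opens (E d)} {D : Set (E d)} (hD : D ⊆ ω)
    (hD' : (ω : Set (E d)) ⊆ closure D) {g : E d → ℂ} (hg : ContinuousOn g ω) :
    eLpNormEssSup g (volume.restrict ω) = ⨆ x ∈ D, ‖g x‖ₑ := by
  have hge : ContinuousOn (fun x => ‖g x‖ₑ) (ω : Set (E d)) := hg.enorm
  apply le_antisymm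
  · refine eLpNormEssSup_le_of_ae_enorm_bound ?_
    refine (ae_restrict_iff' ω.isOpen.measurableSet).2 (.of_forall fun x hx => ?_)
    by_contra! hlt
    obtain ⟨u, hu, hu'⟩ := (continuousOn_iff'.1 hge) (Ioi (⨆ x ∈ D, ‖g x‖ₑ)) isOpen_Ioi
    have hxu : x ∈ u ∩ ω := by rw [← hu']; exact ⟨hlt, hx⟩
    obtain ⟨y, hy, hyD⟩ := mem_closure_iff.1 (hD' hx) _ (hu.inter ω.isOpen) hxu
    rw [← hu'] at hy
    exact absurd hy.1 (not_lt.2 (le_iSup₂ (f := fun x (_ : x ∈ D) => ‖g x‖ₑ) y hyD))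
  · refine iSup₂_le fun x hx => ?_
    by_contra! hlt
    obtain ⟨u, hu, hu'⟩ := (continuousOn_iff'.1 hge)
      (Ioi (eLpNormEssSup g (volume.restrict ω))) isOpen_Ioi
    have hxu : x ∈ u ∩ ω := by rw [← hu']; exact ⟨hlt, hD hx⟩
    have hpos := (hu.inter ω.isOpen).measure_pos volume ⟨x, hxu⟩
    have hae := (ae_restrict_iff' ω.isOpen.measurableSet).1
      (enorm_ae_le_eLpNormEssSup g (volume.restrict (ω : Set (E d))))
    refine hpos.ne' (measure_mono_null (fun y hy => ?_) hae)
    have hy2 := hy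
    rw [← hu'] at hy
    exact fun hh => absurd (hh hy2.2) (not_le.2 hy.1)

lemma aemeasurable_eLpNorm {p : ℝ≥0∞} {ω : Opens (E d)} {g : ℝ → E d → ℂ}
    (hg : ContinuousOn (Function.uncurry g) (Ioo (0 : ℝ) 1 ×ˢ ω)) :
    AEMeasurable (fun ε => eLpNorm (g ε) p (volume.restrict ω))
      (volume.restrict (Ioo (0 : ℝ) 1)) := by
  by_cases hp0 : p = 0
  · simp [hp0]
  by_cases hp : p = ∞
  · obtain ⟨D, hDω, hDc, hD⟩ := (TopologicalSpace.IsSeparable.of_separableSpace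
      (ω : Set (E d))).exists_countable_dense_subset
    have heq : ∀ ε ∈ Ioo (0 : ℝ) 1, eLpNorm (g ε) p (volume.restrict ω) = ⨆ x ∈ D, ‖g ε x‖ₑ := by
      intro ε hε
      rw [hp, eLpNorm_exponent_top]
      refine eLpNormEssSup_eq_iSup_dense hDω hD ?_
      exact hg.comp (f := fun x => (ε, x)) (by fun_prop) (fun x hx => ⟨hε, hx⟩)
    refine AEMeasurable.congr (f := fun ε => ⨆ x ∈ D, ‖g ε x‖ₑ) ?_
      ((ae_restrict_iff' measurableSet_Ioo).2 (.of_forall fun ε hε => (heq ε hε).symm))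
    refine AEMeasurable.biSup D hDc fun x hx => ?_
    refine AEMeasurable.enorm (ContinuousOn.aemeasurable ?_ measurableSet_Ioo)
    exact hg.comp (f := fun ε => (ε, x)) (by fun_prop) (fun ε hε => ⟨hε, hDω hx⟩)
  · have hms : MeasurableSet (Ioo (0 : ℝ) 1 ×ˢ (ω : Set (E d))) :=
      measurableSet_Ioo.prod ω.isOpen.measurableSet
    have hG : Measurable (indicator (Ioo (0 : ℝ) 1 ×ˢ (ω : Set (E d))) (Function.uncurry g)) := by
      classical
      rw [← piecewise_eq_indicator]
      exact hg.measurable_piecewise continuousOn_const hms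
    have hI := ((hG.enorm.pow_const p.toReal).lintegral_prod_right'
      (ν := volume.restrict (ω : Set (E d)))).pow_const (1 / p.toReal)
    refine hI.aemeasurable.congr
      ((ae_restrict_iff' measurableSet_Ioo).2 (.of_forall fun ε hε => ?_))
    beta_reduce
    rw [eLpNorm_eq_lintegral_rpow_enorm_toReal hp0 hp]
    congr 1
    refine setLIntegral_congr_fun ω.isOpen.measurableSet fun x hx => ?_
    rw [indicator_of_mem (s := Ioo (0 : ℝ) 1 ×ˢ (ω : Set (E d))) (mk_mem_prod hε hx)]
    rfl

namespace IsSmoothNet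

variable {Ω ω : Opens (E d)} {f g : Net d}

lemma contDiffAt (hf : IsSmoothNet Ω f) {ε : ℝ} (hε : ε ∈ Ioo (0 : ℝ) 1) {x : E d} (hx : x ∈ Ω) :
    ContDiffAt ℝ (⊤ : ℕ∞) (f ε) x :=
  (hf.smooth ε hε).contDiffAt (Ω.isOpen.mem_nhds hx)

lemma mono (hf : IsSmoothNet Ω f) (h : ω ≤ Ω) : IsSmoothNet ω f where
  smooth ε hε := (hf.smooth ε hε).mono h
  continuous m := (hf.continuous m).mono (prod_mono_right h)

lemma iteratedFDeriv_add (hf : IsSmoothNet Ω f) (hg : IsSmoothNet Ω g) (m : ℕ) {ε : ℝ}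
    (hε : ε ∈ Ioo (0 : ℝ) 1) {x : E d} (hx : x ∈ Ω) :
    iteratedFDeriv ℝ m ((f + g) ε) x = iteratedFDeriv ℝ m (f ε) x + iteratedFDeriv ℝ m (g ε) x :=
  iteratedFDeriv_add_apply ((hf.contDiffAt hε hx).of_le (mod_cast le_top))
    ((hg.contDiffAt hε hx).of_le (mod_cast le_top))

lemma iteratedFDeriv_smul (hf : IsSmoothNet Ω f) (c : ℂ) (m : ℕ) {ε : ℝ}
    (hε : ε ∈ Ioo (0 : ℝ) 1) {x : E d} (hx : x ∈ Ω) :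
    iteratedFDeriv ℝ m ((c • f) ε) x = c • iteratedFDeriv ℝ m (f ε) x :=
  iteratedFDeriv_const_smul_apply (a := c) (f := f ε) (i := m) ((hf.contDiffAt hε hx).of_le (mod_cast le_top))

lemma zero : IsSmoothNet Ω (0 : Net d) where
  smooth _ _ := contDiffOn_const (c := (0 : ℂ))
  continuous m := by
    have : (fun z : ℝ × E d => iteratedFDeriv ℝ m ((0 : Net d) z.1) z.2) = fun _ => 0 := by
      funext z
      exact congrFun (iteratedFDeriv_fun_zero (𝕜 := ℝ) (E := E d) (F := ℂ) (n := m)) z.2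
    rw [this]
    exact continuousOn_const

lemma add (hf : IsSmoothNet Ω f) (hg : IsSmoothNet Ω g) : IsSmoothNet Ω (f + g) where
  smooth ε hε := (hf.smooth ε hε).add (hg.smooth ε hε)
  continuous m := ((hf.continuous m).add (hg.continuous m)).congr
    fun _ hz => hf.iteratedFDeriv_add hg m hz.1 hz.2

lemma smul (hf : IsSmoothNet Ω f) (c : ℂ) : IsSmoothNet Ω (c • f) where
  smooth ε hε := (hf.smooth ε hε).const_smul c
  continuous m := ((hf.continuous m).const_smul c).congr
    fun _ hz => hf.iteratedFDeriv_smul c m hz.1 hz.2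

lemma continuousOn_partialDeriv (hf : IsSmoothNet Ω f) {m : ℕ} (j : Fin m → Fin d) :
    ContinuousOn (Function.uncurry fun ε x => partialDeriv j (f ε) x) (Ioo (0 : ℝ) 1 ×ˢ Ω) :=
  (ContinuousMultilinearMap.apply ℝ (fun _ : Fin m => E d) ℂ
    (fun i => EuclideanSpace.single (j i) 1)).continuous.comp_continuousOn (hf.continuous m)

lemma aestronglyMeasurable (hf : IsSmoothNet Ω f) {m : ℕ} (j : Fin m → Fin d) {ε : ℝ}
    (hε : ε ∈ Ioo (0 : ℝ) 1) :
    AEStronglyMeasurable (partialDeriv j (f ε)) (volume.restrict Ω) :=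
  ContinuousOn.aestronglyMeasurable
    ((hf.continuousOn_partialDeriv j).comp (f := fun x => (ε, x)) (by fun_prop)
      (fun _ hx => ⟨hε, hx⟩)) Ω.isOpen.measurableSet

lemma aemeasurable_sobolevNorm (hf : IsSmoothNet Ω f) (k : ℕ) (p : ℝ≥0∞) :
    AEMeasurable (fun ε => sobolevNorm k p Ω (f ε)) (volume.restrict (Ioo (0 : ℝ) 1)) := by
  unfold sobolevNorm
  refine AEMeasurable.iSup fun m => AEMeasurable.iSup fun _ => AEMeasurable.iSup fun j => ?_
  exact aemeasurable_eLpNorm (hf.continuousOn_partialDeriv j)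

lemma sobolevNorm_add_le (hf : IsSmoothNet Ω f) (hg : IsSmoothNet Ω g) (k : ℕ) {p : ℝ≥0∞}
    (hp : 1 ≤ p) {ε : ℝ} (hε : ε ∈ Ioo (0 : ℝ) 1) :
    sobolevNorm k p Ω ((f + g) ε) ≤ sobolevNorm k p Ω (f ε) + sobolevNorm k p Ω (g ε) := by
  refine iSup_le fun m => iSup_le fun hm => iSup_le fun j => ?_
  have hae : partialDeriv j ((f + g) ε) =ᵐ[volume.restrict (Ω : Set (E d))]
      partialDeriv j (f ε) + partialDeriv j (g ε) :=
    (ae_restrict_iff' Ω.isOpen.measurableSet).2 (.of_forall fun x hx => by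
      simp only [partialDeriv, Pi.add_apply]
      rw [← Pi.add_apply f g, hf.iteratedFDeriv_add hg m hε hx]
      rfl)
  rw [eLpNorm_congr_ae hae]
  refine (eLpNorm_add_le (hf.aestronglyMeasurable j hε) (hg.aestronglyMeasurable j hε) hp).trans ?_
  exact add_le_add (le_iSup_of_le m (le_iSup_of_le hm (le_iSup_of_le j le_rfl)))
    (le_iSup_of_le m (le_iSup_of_le hm (le_iSup_of_le j le_rfl)))

lemma sobolevNorm_smul_le (hf : IsSmoothNet Ω f) (c : ℂ) (k : ℕ) {p : ℝ≥0∞}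
    {ε : ℝ} (hε : ε ∈ Ioo (0 : ℝ) 1) :
    sobolevNorm k p Ω ((c • f) ε) ≤ ‖c‖ₑ * sobolevNorm k p Ω (f ε) := by
  refine iSup_le fun m => iSup_le fun hm => iSup_le fun j => ?_
  have hae : partialDeriv j ((c • f) ε) =ᵐ[volume.restrict (Ω : Set (E d))]
      c • partialDeriv j (f ε) :=
    (ae_restrict_iff' Ω.isOpen.measurableSet).2 (.of_forall fun x hx => by
      simp only [partialDeriv, Pi.smul_apply]
      rw [← Pi.smul_apply c f, hf.iteratedFDeriv_smul c m hε hx]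
      rfl)
  rw [eLpNorm_congr_ae hae, eLpNorm_const_smul]
  gcongr
  exact le_iSup_of_le m (le_iSup_of_le hm (le_iSup_of_le j le_rfl))

lemma netNorm_add_lt_top (hf : IsSmoothNet ω f) (hg : IsSmoothNet ω g) {q p : ℝ≥0∞} (hq : 1 ≤ q)
    (hp : 1 ≤ p) {s : ℝ} {k : ℕ} (h₁ : netNorm q p s k ω f < ∞) (h₂ : netNorm q p s k ω g < ∞) :
    netNorm q p s k ω (f + g) < ∞ :=
  wNorm_add_lt_top hq (fun _ hε => hf.sobolevNorm_add_le hg k hp hε)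
    (hf.aemeasurable_sobolevNorm k p) h₁ h₂

lemma netNorm_smul_lt_top (hf : IsSmoothNet ω f) (c : ℂ) {q p : ℝ≥0∞}
    {s : ℝ} {k : ℕ} (h₁ : netNorm q p s k ω f < ∞) :
    netNorm q p s k ω (c • f) < ∞ := by
  have key := fun ε (hε : ε ∈ Ioo (0 : ℝ) 1) => hf.sobolevNorm_smul_le c k (p := p) hε
  unfold netNorm wNorm at *
  split_ifs at * with h
  · refine lt_of_le_of_lt (b := ‖c‖ₑ * _) (iSup₂_le fun ε hε => ?_)
      (ENNReal.mul_lt_top enorm_lt_top h₁)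
    calc _ ≤ ENNReal.ofReal (ε ^ s) * (‖c‖ₑ * sobolevNorm k p ω (f ε)) := by
          gcongr; exact key ε hε
      _ = ‖c‖ₑ * (ENNReal.ofReal (ε ^ s) * sobolevNorm k p ω (f ε)) := by ring
      _ ≤ _ := by
          gcongr
          exact le_iSup₂ (f := fun ε (_ : ε ∈ Ioo (0 : ℝ) 1) =>
            ENNReal.ofReal (ε ^ s) * sobolevNorm k p ω (f ε)) ε hε
  · rcases ENNReal.toReal_nonneg (a := q) |>.eq_or_lt with h0 | h0
    · simp [← h0]
    rw [ENNReal.rpow_lt_top_iff_of_pos (by positivity)] at *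
    have hc : ‖c‖ₑ ^ q.toReal ≠ ∞ := ENNReal.rpow_ne_top_of_nonneg h0.le enorm_ne_top
    refine lt_of_le_of_lt (b := ‖c‖ₑ ^ q.toReal * _) ?_ (ENNReal.mul_lt_top hc.lt_top h₁)
    rw [← lintegral_const_mul' _ _ hc]
    refine setLIntegral_mono' measurableSet_Ioo fun ε hε => ?_
    calc _ ≤ ENNReal.ofReal (ε ^ (s * q.toReal)) *
          (‖c‖ₑ * sobolevNorm k p ω (f ε)) ^ q.toReal * ENNReal.ofReal ε⁻¹ := by
          gcongr; exact key ε hε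
      _ = _ := by rw [ENNReal.mul_rpow_of_nonneg _ _ h0.le]; ring

end IsSmoothNet

lemma netNorm_zero {q p : ℝ≥0∞} (hq : 1 ≤ q) (s : ℝ) (k : ℕ) (ω : Opens (E d)) :
    netNorm q p s k ω (0 : Net d) = 0 := by
  have h0 : ∀ ε : ℝ, sobolevNorm k p ω ((0 : Net d) ε) = 0 := fun ε => by
    have : ∀ (m : ℕ) (j : Fin m → Fin d), partialDeriv j ((0 : Net d) ε) = 0 := fun m j => by
      funext x
      have := congrFun (iteratedFDeriv_fun_zero (𝕜 := ℝ) (E := E d) (F := ℂ) (n := m)) x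
      simp only [partialDeriv, Pi.zero_apply]
      exact congrArg (fun L => L (fun i => EuclideanSpace.single (j i) (1 : ℝ))) this
    simp only [sobolevNorm, this, eLpNorm_zero]
    simp
  unfold netNorm wNorm
  split_ifs with h
  · simp only [h0]
    simp
  · have hq1 : 0 < q.toReal := ENNReal.toReal_pos (by positivity) h
    simp only [h0]
    simp [hq1]

/-! ### The spaces of generalized functions -/

lemma CompactlyIn.le {ω Ω : Opens (E d)} (h : CompactlyIn ω Ω) : ω ≤ Ω :=
  subset_closure.trans h.2

variable (q p : ℝ≥0∞) [Fact (1 ≤ q)] [Fact (1 ≤ p)]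

/-- The space `𝓔_q(Ω)` of nets of smooth functions of `L^q`-moderate growth. -/
def moderate (Ω : Opens (E d)) : Submodule ℂ (Net d) where
  carrier := {f | IsSmoothNet Ω f ∧
    ∀ (k : ℕ) (ω : Opens (E d)), CompactlyIn ω Ω → ∃ s : ℝ, netNorm q p s k ω f < ∞}
  zero_mem' := ⟨.zero, fun k ω _ => ⟨0, by simp [netNorm_zero (Fact.out : 1 ≤ q)]⟩⟩
  add_mem' := by
    rintro f g ⟨hf, hf'⟩ ⟨hg, hg'⟩
    refine ⟨hf.add hg, fun k ω hω => ?_⟩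
    obtain ⟨s, hs⟩ := hf' k ω hω
    obtain ⟨t, ht⟩ := hg' k ω hω
    exact ⟨max s t, (hf.mono hω.le).netNorm_add_lt_top (hg.mono hω.le) Fact.out Fact.out
      ((wNorm_mono (le_max_left s t) _).trans_lt hs)
      ((wNorm_mono (le_max_right s t) _).trans_lt ht)⟩
  smul_mem' := by
    rintro c f ⟨hf, hf'⟩
    refine ⟨hf.smul c, fun k ω hω => ?_⟩
    obtain ⟨s, hs⟩ := hf' k ω hω
    exact ⟨s, (hf.mono hω.le).netNorm_smul_lt_top c hs⟩

/-- The space `𝓝_q(Ω)` of `L^q`-negligible nets. -/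
def negligible (Ω : Opens (E d)) : Submodule ℂ (Net d) where
  carrier := {f | IsSmoothNet Ω f ∧
    ∀ (k : ℕ) (ω : Opens (E d)), CompactlyIn ω Ω → ∀ s : ℝ, netNorm q p s k ω f < ∞}
  zero_mem' := ⟨.zero, fun k ω _ s => by simp [netNorm_zero (Fact.out : 1 ≤ q)]⟩
  add_mem' := by
    rintro f g ⟨hf, hf'⟩ ⟨hg, hg'⟩
    exact ⟨hf.add hg, fun k ω hω s => (hf.mono hω.le).netNorm_add_lt_top (hg.mono hω.le)
      Fact.out Fact.out (hf' k ω hω s) (hg' k ω hω s)⟩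
  smul_mem' := by
    rintro c f ⟨hf, hf'⟩
    exact ⟨hf.smul c, fun k ω hω s => (hf.mono hω.le).netNorm_smul_lt_top c (hf' k ω hω s)⟩

/-- The space of generalized functions `𝓖_q(Ω) = 𝓔_q(Ω) / 𝓝_q(Ω)`. -/
abbrev GenFun (Ω : Opens (E d)) :=
  moderate q p Ω ⧸ (negligible q p Ω).submoduleOf (moderate q p Ω)

variable {q p}

/-- The class `[(f_ε)] ∈ 𝓖_q(Ω)` of a moderate net. -/
def GenFun.mk {Ω : Opens (E d)} (f : Net d) (hf : f ∈ moderate q p Ω) : GenFun q p Ω :=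
  Submodule.Quotient.mk ⟨f, hf⟩

lemma CompactlyIn.mono {ω Ω₁ Ω₂ : Opens (E d)} (h : CompactlyIn ω Ω₁) (h' : Ω₁ ≤ Ω₂) :
    CompactlyIn ω Ω₂ :=
  ⟨h.1, h.2.trans h'⟩

lemma moderate_mono {ω Ω : Opens (E d)} (h : ω ≤ Ω) : moderate q p Ω ≤ moderate q p ω :=
  fun _ hf => ⟨hf.1.mono h, fun k _ hω' => hf.2 k _ (hω'.mono h)⟩

lemma negligible_mono {ω Ω : Opens (E d)} (h : ω ≤ Ω) : negligible q p Ω ≤ negligible q p ω :=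
  fun _ hf => ⟨hf.1.mono h, fun k _ hω' => hf.2 k _ (hω'.mono h)⟩

/-- The restriction map `𝓖_q(Ω) → 𝓖_q(ω)`, `[(f_ε)] ↦ [(f_ε|_ω)]`, for `ω ⊆ Ω`. -/
def GenFun.restrict {ω Ω : Opens (E d)} (h : ω ≤ Ω) : GenFun q p Ω →ₗ[ℂ] GenFun q p ω :=
  Submodule.mapQ _ _ (Submodule.inclusion (moderate_mono h)) (fun _ hf => negligible_mono h hf)

lemma GenFun.restrict_mk {ω Ω : Opens (E d)} (h : ω ≤ Ω) (f : Net d) (hf : f ∈ moderate q p Ω) :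
    GenFun.restrict h (GenFun.mk f hf) = GenFun.mk f (moderate_mono h hf) := rfl

lemma GenFun.mk_eq_mk_iff {Ω : Opens (E d)} {f g : Net d} (hf : f ∈ moderate q p Ω)
    (hg : g ∈ moderate q p Ω) : GenFun.mk f hf = GenFun.mk g hg ↔ f - g ∈ negligible q p Ω :=
  Submodule.Quotient.eq _

variable (q p)

/-- The space `𝓖^{k,-s}_{q,p}(Ω)`: generalized functions that have a representative `(f_ε)` with
`∫₀¹ ε^{sq} ‖f_ε‖_{W^{k,p}(ω)}^q dε/ε < ∞` for every `ω ⋐ Ω` (a supremum if `q = ∞`). -/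
def regGenFun (k : ℕ) (s : ℝ) (Ω : Opens (E d)) : Set (GenFun q p Ω) :=
  {g | ∃ (f : Net d) (hf : f ∈ moderate q p Ω),
    (∀ ω : Opens (E d), CompactlyIn ω Ω → netNorm q p s k ω f < ∞) ∧ g = GenFun.mk f hf}

variable {q p}

/-- A family of linear maps `ι_Ω : 𝓓'(Ω) → 𝓖_q(Ω)`, `Ω ⊆ ℝ^d` open, is the canonical embedding
associated with `φ` if it is an injective morphism of sheaves and is given on compactly
supported distributions by convolution with the net `(φ_ε)`. The compactly supported
distributions on `Ω` are exactly the products `χT` with `T ∈ 𝓓'(Ω)` and `χ ∈ 𝓓(Ω)`. -/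
structure IsCanonicalEmbedding (φ : 𝓢(E d, ℂ))
    (ι : ∀ Ω : Opens (E d), Distr Ω →ₗ[ℂ] GenFun q p Ω) : Prop where
  injective : ∀ Ω, Function.Injective (ι Ω)
  restrict : ∀ {ω Ω : Opens (E d)} (h : ω ≤ Ω) (T : Distr Ω),
    ι ω (restrictDistr ω T) = GenFun.restrict h (ι Ω T)
  compact : ∀ (Ω : Opens (E d)) (T : Distr Ω) (χ : 𝓓(Ω, ℂ)),
    ∃ h : (fun ε => conv (mulTempered χ T) (dilate φ ε)) ∈ moderate q p Ω,
      ι Ω (mulDistr χ T) = GenFun.mk (fun ε => conv (mulTempered χ T) (dilate φ ε)) h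

end BesovGF

end

/-! The embedding. If T has compact support, then T * φ_ε and its derivatives grow at most like
powers of 1/ε, and they are O(ε^P) for every P at positive distance from the support
(`exists_norm_iteratedFDeriv_mollify_le`). So where two cutoffs agree, the mollified nets differ by
a negligible net, and the nets χT * φ_ε glue along a partition of unity to a net depending linearly
on T (`exists_linear_rep`). The class of that net is described by `IsRep`, a condition on the
differences with χT * φ_ε where χ = 1. Compatibility with restriction and the prescribed values on
compactly supported distributions force this condition on any competing family, which gives
uniqueness. Injectivity holds because χT * φ_ε tends weakly to χT, while a negligible net has
arbitrarily small L^p norms at arbitrarily small scales.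

The regularity statement. Since ∂^α(T * φ_ε) = ε^{-|α|} T * (∂^α φ)_ε, the W^{k,p} growth of the net
is a weighted norm of local means of T with kernels ∂^α φ and weights ε^{s-|α|}, |α| ≤ k, whereas
the Besov norm uses the kernel ψ₀ and the weight ε^{s-k}. Both inclusions are therefore instances of
one comparison of local means, `wNorm_conv_lt_top`. A Calderón formula (`exists_isReproducing`,
`IsReproducing.apply_eq`) expresses T through its means with a family of kernels whose Fourier
transforms have no common zero on an annulus. Inserting it into T * θ_y gives an integral over
scales z against kernels that gain (y/z)^N or (z/y)^L from vanishing moments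
(`exists_norm_kernel_le`). Minkowski and Young in x, then Schur's test in the scale
(`wNorm_lt_top_of_hardy`), finish the comparison when θ has N > r vanishing moments.

From Besov regularity to growth, the reproducing kernel is ψ₀ and θ = ∂^α φ, which has |α| vanishing
moments; |α| exceeds r = |α| - s because s > 0. Conversely, the derivatives of φ of order exactly k
are the reproducing family and θ = ψ₀, whose moments vanish up to order ⌊k - s⌋.

Localization: cutoffs reduce everything to compactly supported distributions. On the Fourier side
these are functions b of polynomial growth (`exists_isDensity`), so that all formulas become
absolutely convergent integrals. -/

noncomputable section

namespace BesovGF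

variable {d : ℕ}

section

/-! ### Compactly supported distributions are given by densities -/

/-- A compactly supported distribution is controlled by finitely many derivatives on the support of
the cutoff. -/
lemma exists_norm_mulTempered_le {Ω : Opens (E d)} (χ : 𝓓(Ω, ℂ)) (T : Distr Ω) :
    ∃ (C : ℝ) (N : ℕ), 0 ≤ C ∧ ∀ (f : 𝓢(E d, ℂ)) (A : ℝ), 0 ≤ A →
      (∀ j ≤ N, ∀ w ∈ tsupport χ, ‖iteratedFDeriv ℝ j f w‖ ≤ A) → ‖mulTempered χ T f‖ ≤ C * A := by
  let K : Compacts (E d) := ⟨tsupport χ, χ.hasCompactSupport⟩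
  have hK : (K : Set (E d)) ⊆ Ω := χ.tsupport_subset
  have hcont : Continuous ((normSeminorm ℂ ℂ).comp
      (T.comp (TestFunction.ofSupportedInCLM ℂ hK :
        ContDiffMapSupportedIn (E d) ℂ ⊤ K →L[ℂ] 𝓓(Ω, ℂ))).toLinearMap) :=
    continuous_norm.comp (T.comp (TestFunction.ofSupportedInCLM ℂ hK :
        ContDiffMapSupportedIn (E d) ℂ ⊤ K →L[ℂ] 𝓓(Ω, ℂ))).continuous
  obtain ⟨s, C, -, hC⟩ := Seminorm.bound_of_continuous
    (ContDiffMapSupportedIn.withSeminorms ℂ (E d) ℂ ⊤ K) _ hcont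
  obtain ⟨N, hN⟩ : ∃ N : ℕ, ∀ i ∈ s, i ≤ N := ⟨s.sup id, fun i hi => Finset.le_sup (f := id) hi⟩
  obtain ⟨B, hB0, hB⟩ : ∃ B : ℝ, 0 ≤ B ∧ ∀ j ≤ N, ∀ x, ‖iteratedFDeriv ℝ j χ x‖ ≤ B := by
    have : ∀ j : ℕ, ∃ B : ℝ, ∀ x, ‖iteratedFDeriv ℝ j χ x‖ ≤ B := fun j =>
      (χ.hasCompactSupport.iteratedFDeriv j).exists_bound_of_continuous
        (χ.contDiff.continuous_iteratedFDeriv (mod_cast le_top))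
    choose B hB using this
    refine ⟨∑ j ∈ Finset.range (N + 1), |B j|, by positivity, fun j hj x => (hB j x).trans ?_⟩
    exact (le_abs_self _).trans (Finset.single_le_sum (f := fun j => |B j|)
      (fun _ _ => abs_nonneg _) (Finset.mem_range.2 (by omega)))
  -- The factor 2^N B comes from Leibniz: B bounds the derivatives of χ and the binomial
  -- coefficients sum to at most 2^N.
  refine ⟨C * (2 ^ N * B), N, by positivity, fun f A hA h => ?_⟩
  let g : ContDiffMapSupportedIn (E d) ℂ ⊤ K :=
    .of_support_subset (f := fun x => χ x * f x) (χ.contDiff.mul (f.smooth ⊤))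
      (fun x hx => subset_tsupport _ (left_ne_zero_of_mul hx))
  have key := hC g
  have h1 : ‖mulTempered χ T f‖ = ((normSeminorm ℂ ℂ).comp
      (T.comp (TestFunction.ofSupportedInCLM ℂ hK :
        ContDiffMapSupportedIn (E d) ℂ ⊤ K →L[ℂ] 𝓓(Ω, ℂ))).toLinearMap) g := rfl
  rw [h1]
  refine key.trans ?_
  change (C : ℝ) * (s.sup (ContDiffMapSupportedIn.seminorm ℂ (E d) ℂ ⊤ K)) g ≤ _
  rw [mul_assoc]
  refine mul_le_mul_of_nonneg_left ?_ C.2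
  refine Seminorm.finset_sup_apply_le (by positivity) fun i hi => ?_
  rw [ContDiffMapSupportedIn.seminorm_top_le_iff ℂ (by positivity)]
  intro x hx
  change ‖iteratedFDeriv ℝ i (fun x => χ x * f x) x‖ ≤ _
  refine (norm_iteratedFDeriv_mul_le (N := (⊤ : ℕ∞)) χ.contDiff (f.smooth ⊤) x
    (mod_cast le_top)).trans ?_
  have hiN := hN i hi
  calc _ ≤ ∑ j ∈ Finset.range (i + 1), (i.choose j : ℝ) * B * A := by
        refine Finset.sum_le_sum fun j hj => ?_
        have hj := Finset.mem_range.1 hj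
        gcongr
        · exact hB j (by omega) x
        · exact h _ (by omega) x hx
    _ = 2 ^ i * B * A := by
        rw [← Finset.sum_mul, ← Finset.sum_mul]
        congr 2
        exact_mod_cast Nat.sum_range_choose i
    _ ≤ _ := by gcongr; norm_num

/-- The weight `(1 + ‖x‖)^{-M}`. -/
def decay (M : ℕ) (x : E d) : ℝ := ((1 + ‖x‖) ^ M)⁻¹

lemma decay_pos (M : ℕ) (x : E d) : 0 < decay M x := by unfold decay; positivity

lemma decay_nonneg (M : ℕ) (x : E d) : 0 ≤ decay M x := (decay_pos M x).le

lemma decay_le_one (M : ℕ) (x : E d) : decay M x ≤ 1 :=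
  inv_le_one_of_one_le₀ (one_le_pow₀ (by linarith [norm_nonneg x]))

lemma decay_add (M N : ℕ) (x : E d) : decay (M + N) x = decay M x * decay N x := by
  simp [decay, pow_add, mul_comm]

lemma continuous_decay (M : ℕ) : Continuous (decay M : E d → ℝ) := by
  unfold decay
  exact Continuous.inv₀ (by fun_prop) fun x => by positivity

lemma integrable_decay : Integrable (decay (d + 1) : E d → ℝ) := by
  have := integrable_one_add_norm (E := E d) (μ := volume) (r := (d + 1 : ℕ))
    (by rw [finrank_euclideanSpace_fin]; push_cast; linarith)
  refine this.congr (.of_forall fun x => ?_)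
  simp only [decay]
  rw [Real.rpow_neg (by positivity), Real.rpow_natCast]

/-- The weight is at most 1, so its p-th power is dominated by the weight itself, which is
integrable because d + 1 > d. -/
lemma memLp_decay {p : ℝ≥0∞} (hp : 1 ≤ p) : MemLp (decay (d + 1) : E d → ℝ) p := by
  have htop : MemLp (decay (d + 1) : E d → ℝ) ∞ :=
    memLp_top_of_bound (continuous_decay _).aestronglyMeasurable 1
      (.of_forall fun x => by
        rw [Real.norm_of_nonneg (decay_nonneg _ _)]; exact decay_le_one _ _)
  rcases eq_or_ne p ∞ with rfl | hpt
  · exact htop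
  have hp0 : p ≠ 0 := by positivity
  have hp1 : 1 ≤ p.toReal := by simpa using ENNReal.toReal_mono hpt hp
  rw [← integrable_norm_rpow_iff (continuous_decay _).aestronglyMeasurable hp0 hpt]
  refine integrable_decay.mono' ?_ (.of_forall fun x => ?_)
  · exact ((continuous_decay _).norm.rpow_const (fun x => .inr (by positivity))).aestronglyMeasurable
  · rw [Real.norm_of_nonneg (by positivity), Real.norm_of_nonneg (decay_nonneg _ _)]
    calc _ ≤ decay (d + 1) x ^ (1 : ℝ) :=
          Real.rpow_le_rpow_of_exponent_ge (decay_pos _ _) (decay_le_one _ _) hp1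
      _ = _ := Real.rpow_one _

/-- A linear functional bounded by a weighted `L¹` norm is integration against a function of
polynomial growth. -/
lemma exists_density_of_bound (L : 𝓢(E d, ℂ) →ₗ[ℂ] ℂ) (C : ℝ) (N : ℕ)
    (hL : ∀ g, ‖L g‖ ≤ C * ∫ ξ, (1 + ‖ξ‖) ^ N * ‖g ξ‖) :
    ∃ (M : ℕ) (b : E d → ℂ), AEStronglyMeasurable b ∧
      Integrable (fun ξ => decay M ξ * ‖b ξ‖) ∧ ∀ g, L g = ∫ ξ, b ξ * g ξ := by
  -- With W = (1 + |ξ|²)^P, Cauchy-Schwarz bounds the weighted L¹ norm of g by the L² norm of W g.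
  -- The d + 1 extra powers make the remaining weight square integrable.
  let P : ℕ := N + (d + 1)
  let w : E d → ℝ := fun ξ => (1 + ‖ξ‖ ^ 2) ^ P
  let W : E d → ℂ := fun ξ => ((w ξ : ℝ) : ℂ)
  have hw1 : ∀ ξ, 0 < w ξ := fun ξ => by positivity
  have hWn : ∀ ξ, ‖W ξ‖ = w ξ := fun ξ => by
    simp only [W, Complex.norm_real]; exact Real.norm_of_nonneg (hw1 ξ).le
  have hWt : Function.HasTemperateGrowth W := by
    have h1 : Function.HasTemperateGrowth w := by
      have := Function.hasTemperateGrowth_one_add_norm_sq_rpow (E d) (P : ℝ)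
      simpa only [Real.rpow_natCast] using this
    exact (Complex.ofRealCLM.hasTemperateGrowth).comp h1
  have hWc : Continuous W := by fun_prop
  have hwc : Continuous w := by fun_prop
  let J : 𝓢(E d, ℂ) →L[ℂ] Lp ℂ 2 (volume : Measure (E d)) :=
    SchwartzMap.toLpCLM ℂ ℂ 2 volume ∘L SchwartzMap.smulLeftCLM ℂ W
  have hJ : Function.Injective J := by
    intro f g hfg
    have : SchwartzMap.smulLeftCLM ℂ W f = SchwartzMap.smulLeftCLM ℂ W g :=
      SchwartzMap.injective_toLp 2 volume hfg
    ext ξ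
    have h2 := DFunLike.congr_fun this ξ
    rw [SchwartzMap.smulLeftCLM_apply_apply hWt, SchwartzMap.smulLeftCLM_apply_apply hWt] at h2
    have : W ξ ≠ 0 := by rw [← norm_pos_iff, hWn]; exact hw1 ξ
    simpa [this] using h2
  have hk0 : ∀ ξ : E d, (1 + ‖ξ‖) ^ N ≤ 2 ^ P * (decay (d + 1) ξ * w ξ) := by
    intro ξ
    have h1 : 1 + ‖ξ‖ ≤ 2 * (1 + ‖ξ‖ ^ 2) := by nlinarith [sq_nonneg (‖ξ‖ - 1), norm_nonneg ξ]
    have h2 : (1 + ‖ξ‖) ^ P ≤ 2 ^ P * w ξ := by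
      rw [← mul_pow]; exact pow_le_pow_left₀ (by positivity) h1 _
    calc (1 + ‖ξ‖) ^ N = decay (d + 1) ξ * (1 + ‖ξ‖) ^ P := by
          simp only [decay, P, pow_add (1 + ‖ξ‖) N]; field_simp
      _ ≤ decay (d + 1) ξ * (2 ^ P * w ξ) := by
          gcongr; exact decay_nonneg _ _
      _ = _ := by ring
  let D : ℝ := (∫ ξ : E d, ‖decay (d + 1) ξ‖ ^ (2 : ℝ)) ^ (1 / (2 : ℝ))
  have hbound : ∀ g, ‖L g‖ ≤ |C| * 2 ^ P * D * ‖J g‖ := by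
    intro g
    have hJg : ‖J g‖ = (∫ ξ, ‖W ξ * g ξ‖ ^ (2 : ℝ)) ^ (1 / (2 : ℝ)) := by
      change ‖(SchwartzMap.smulLeftCLM ℂ W g).toLp 2 volume‖ = _
      rw [SchwartzMap.norm_toLp' (by norm_num) (by norm_num)]
      simp [SchwartzMap.smulLeftCLM_apply_apply hWt]
    have hm : MemLp (fun ξ => W ξ * g ξ) 2 := by
      have := (SchwartzMap.smulLeftCLM ℂ W g).memLp 2 volume
      refine this.ae_eq (.of_forall fun ξ => ?_)
      simp [SchwartzMap.smulLeftCLM_apply_apply hWt]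
    have hm' : MemLp (fun ξ => ((decay (d + 1) ξ : ℝ) : ℂ)) 2
        (volume : Measure (E d)) := (memLp_decay (by norm_num)).ofReal
    have hH := integral_mul_norm_le_Lp_mul_Lq (p := 2) (q := 2) (by
      constructor <;> norm_num) (by simpa using hm') (by simpa using hm)
    have hi : ∫ ξ, (1 + ‖ξ‖) ^ N * ‖g ξ‖ ≤
        ∫ ξ, 2 ^ P * (‖((decay (d + 1) ξ : ℝ) : ℂ)‖ * ‖W ξ * g ξ‖) := by
      refine integral_mono_of_nonneg (.of_forall fun ξ => by positivity) ?_
        (.of_forall fun ξ => ?_)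
      · exact ((MemLp.integrable_mul hm'.norm hm.norm :
          Integrable (fun ξ => ‖((decay (d + 1) ξ : ℝ) : ℂ)‖ * ‖W ξ * g ξ‖))).const_mul _
      · simp only [norm_mul, hWn, Complex.norm_real, Real.norm_of_nonneg (decay_nonneg (d + 1) ξ)]
        calc _ ≤ 2 ^ P * (decay (d + 1) ξ * w ξ) * ‖g ξ‖ := by gcongr; exact hk0 ξ
          _ = _ := by ring
    have hpos : 0 ≤ ∫ ξ, (1 + ‖ξ‖) ^ N * ‖g ξ‖ := integral_nonneg fun ξ => by positivity
    calc ‖L g‖ ≤ |C| * ∫ ξ, (1 + ‖ξ‖) ^ N * ‖g ξ‖ :=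
          (hL g).trans (by gcongr; exact le_abs_self C)
      _ ≤ |C| * (2 ^ P * (D * ‖J g‖)) := by
          gcongr
          refine hi.trans ?_
          rw [integral_const_mul]
          gcongr
          rw [hJg]
          simpa [D] using hH
      _ = _ := by ring
  -- L factors through the range of J in L² and is bounded there. Hahn-Banach extends it and the
  -- Riesz theorem represents it by some u in L², so the density is conj(u) W.
  let R := LinearMap.range J.toLinearMap
  let e := LinearEquiv.ofInjective J.toLinearMap hJ
  let F : StrongDual ℂ R := (L ∘ₗ e.symm.toLinearMap).mkContinuous (|C| * 2 ^ P * D) (by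
    intro x
    refine (hbound (e.symm x)).trans_eq ?_
    congr 1
    have : J (e.symm x) = (e (e.symm x) : Lp ℂ 2 (volume : Measure (E d))) := rfl
    rw [this, LinearEquiv.apply_symm_apply]
    rfl)
  obtain ⟨G, hG, -⟩ := exists_extension_norm_eq R F
  let u := (InnerProductSpace.toDual ℂ (Lp ℂ 2 (volume : Measure (E d)))).symm G
  have hu : ∀ g, L g = ∫ ξ, (starRingEnd ℂ (u ξ) * W ξ) * g ξ := by
    intro g
    have h1 : L g = G (J g) := by
      have := hG (e g)
      rw [show ((e g : R) : Lp ℂ 2 (volume : Measure (E d))) = J g from rfl] at this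
      rw [this]
      simp [F]
    rw [h1, ← InnerProductSpace.toDual_symm_apply, L2.inner_def]
    refine integral_congr_ae ?_
    have hae : J g =ᵐ[volume] SchwartzMap.smulLeftCLM ℂ W g :=
      (SchwartzMap.smulLeftCLM ℂ W g).coeFn_toLp 2 volume
    filter_upwards [hae] with ξ hξ
    rw [hξ, SchwartzMap.smulLeftCLM_apply_apply hWt]
    simp only [RCLike.inner_apply, smul_eq_mul]
    ring
  have hum : MemLp u 2 := Lp.memLp u
  -- The power 2P absorbs W, and the remaining d + 1 powers make u integrable by Cauchy-Schwarz.
  refine ⟨2 * P + (d + 1), fun ξ => starRingEnd ℂ (u ξ) * W ξ, ?_, ?_, hu⟩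
  · exact (Complex.continuous_conj.comp_aestronglyMeasurable hum.1).mul hWc.aestronglyMeasurable
  · have h1 : Integrable (fun ξ => decay (d + 1) ξ * ‖u ξ‖) :=
      MemLp.integrable_mul (memLp_decay (p := 2) (by norm_num)) hum.norm
    refine h1.mono' ?_ (.of_forall fun ξ => ?_)
    · exact (continuous_decay _).aestronglyMeasurable.mul
        ((Complex.continuous_conj.comp_aestronglyMeasurable hum.1).mul
          hWc.aestronglyMeasurable).norm
    · have h2 : w ξ ≤ (1 + ‖ξ‖) ^ (2 * P) := by
        rw [pow_mul]
        exact pow_le_pow_left₀ (by positivity) (by nlinarith [norm_nonneg ξ]) _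
      have h3 : decay (2 * P) ξ * w ξ ≤ 1 := by
        unfold decay
        rw [inv_mul_le_iff₀ (by positivity), mul_one]
        exact h2
      have hd := decay_nonneg (d + 1) ξ
      have hd' := decay_nonneg (2 * P + (d + 1)) ξ
      rw [Real.norm_of_nonneg (by positivity), norm_mul, hWn, RCLike.norm_conj, decay_add]
      calc _ = (decay (2 * P) ξ * w ξ) * (decay (d + 1) ξ * ‖u ξ‖) := by ring
        _ ≤ 1 * (decay (d + 1) ξ * ‖u ξ‖) := by gcongr
        _ = _ := one_mul _

end

section

/-! ### Fourier representation of mollified distributions -/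

/-- Rapid decay of all derivatives of a Schwartz function. -/
lemma exists_norm_iteratedFDeriv_le_decay (ψ : 𝓢(E d, ℂ)) (j K : ℕ) :
    ∃ C : ℝ, 0 ≤ C ∧ ∀ x, ‖iteratedFDeriv ℝ j ψ x‖ ≤ C * decay K x := by
  refine ⟨2 ^ K * ((Finset.Iic (K, j)).sup (schwartzSeminormFamily ℝ (E d) ℂ)) ψ,
    by positivity, fun x => ?_⟩
  have := SchwartzMap.one_add_le_sup_seminorm_apply (𝕜 := ℝ) (m := (K, j)) le_rfl le_rfl ψ x
  rw [decay, ← div_eq_mul_inv, le_div_iff₀ (by positivity), mul_comm]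
  exact this

lemma exists_norm_le_decay (ψ : 𝓢(E d, ℂ)) (K : ℕ) :
    ∃ C : ℝ, 0 ≤ C ∧ ∀ x, ‖ψ x‖ ≤ C * decay K x := by
  simpa using exists_norm_iteratedFDeriv_le_decay ψ 0 K

lemma decay_neg (M : ℕ) (x : E d) : decay M (-x) = decay M x := by simp [decay]

lemma pow_mul_decay_le (n M : ℕ) (x : E d) : ‖x‖ ^ n * decay (M + n) x ≤ decay M x := by
  have h : ‖x‖ ^ n * decay n x ≤ 1 := by
    unfold decay
    rw [mul_inv_le_iff₀ (by positivity), one_mul]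
    exact pow_le_pow_left₀ (norm_nonneg x) (by linarith) _
  have := decay_nonneg M x
  rw [decay_add]
  calc _ = decay M x * (‖x‖ ^ n * decay n x) := by ring
    _ ≤ decay M x * 1 := by gcongr
    _ = _ := mul_one _

/-- `S` acts as integration of the Fourier transform against the function `b` of polynomial
growth. -/
structure IsDensity (S : 𝓢'(E d, ℂ)) (M : ℕ) (b : E d → ℂ) : Prop where
  aestronglyMeasurable : AEStronglyMeasurable b
  integrable : Integrable (fun ξ => decay M ξ * ‖b ξ‖)
  apply_eq : ∀ f : 𝓢(E d, ℂ), S f = ∫ ξ, b ξ * 𝓕 f ξ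

/-- The functional has finite order N, and derivatives of 𝓕 g of order at most N are bounded by
moments of |g| of order at most N. So g ↦ S(𝓕 g) satisfies the hypothesis of
`exists_density_of_bound`. -/
lemma exists_isDensity {Ω : Opens (E d)} (χ : 𝓓(Ω, ℂ)) (T : Distr Ω) :
    ∃ (M : ℕ) (b : E d → ℂ), IsDensity (mulTempered χ T) M b := by
  obtain ⟨C, N, hC, hb⟩ := exists_norm_mulTempered_le χ T
  let S := mulTempered χ T
  let L : 𝓢(E d, ℂ) →ₗ[ℂ] ℂ :=
    { toFun := fun g => S (𝓕 g)
      map_add' := fun f g => by rw [FourierTransform.fourier_add, map_add]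
      map_smul' := fun c g => by rw [FourierTransform.fourier_smul, map_smul]; rfl }
  have hL : ∀ g, ‖L g‖ ≤ (C * ((2 * Real.pi) ^ N * (N + 1))) *
      ∫ ξ, (1 + ‖ξ‖) ^ N * ‖g ξ‖ := by
    intro g
    have hint : Integrable (fun ξ => (1 + ‖ξ‖) ^ N * ‖g ξ‖) := by
      obtain ⟨D, hD, hg⟩ := exists_norm_le_decay g ((d + 1) + N)
      refine (integrable_decay.const_mul D).mono'
        (Continuous.aestronglyMeasurable (by fun_prop)) (.of_forall fun ξ => ?_)
      rw [Real.norm_of_nonneg (by positivity)]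
      calc (1 + ‖ξ‖) ^ N * ‖g ξ‖ ≤ (1 + ‖ξ‖) ^ N * (D * decay (d + 1 + N) ξ) := by
            gcongr; exact hg ξ
        _ = D * decay (d + 1) ξ := by rw [decay_add]; simp only [decay]; field_simp
    rw [mul_assoc]
    refine hb (𝓕 g) _ ?_ fun j hj w _ => ?_
    · have : 0 ≤ ∫ ξ, (1 + ‖ξ‖) ^ N * ‖g ξ‖ := integral_nonneg fun ξ => by positivity
      positivity
    have := Real.pow_mul_norm_iteratedFDeriv_fourier_le (K := ⊤) (N := ⊤) (g.smooth ⊤)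
      (fun k n _ _ => g.integrable_pow_mul_iteratedFDeriv volume k n) (k := j) (n := 0)
      le_top le_top w
    rw [← SchwartzMap.fourier_coe] at this
    simp only [pow_zero, one_mul, mul_one, zero_add, norm_iteratedFDeriv_zero,
      Finset.sum_product, Finset.range_one, Finset.sum_singleton] at this
    refine this.trans ?_
    have h1 : ∀ i ∈ Finset.range (j + 1), ∫ v, ‖v‖ ^ i * ‖g v‖ ≤
        ∫ ξ, (1 + ‖ξ‖) ^ N * ‖g ξ‖ := by
      intro i hi
      have hi := Finset.mem_range.1 hi
      refine integral_mono (g.integrable_pow_mul volume i) hint fun ξ => ?_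
      have : ‖ξ‖ ^ i ≤ (1 + ‖ξ‖) ^ N :=
        (pow_le_pow_left₀ (norm_nonneg _) (by linarith) _).trans
          (pow_le_pow_right₀ (by linarith [norm_nonneg ξ]) (by omega))
      dsimp only
      gcongr
    have h2 := Finset.sum_le_sum h1
    rw [Finset.sum_const, Finset.card_range, nsmul_eq_mul] at h2
    have h0 : 0 ≤ ∫ ξ, (1 + ‖ξ‖) ^ N * ‖g ξ‖ := integral_nonneg fun ξ => by positivity
    rw [mul_assoc]
    have hpi : (1 : ℝ) ≤ 2 * Real.pi := by linarith [Real.pi_gt_three]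
    gcongr
    refine h2.trans ?_
    push_cast
    gcongr
  obtain ⟨M, b, hbm, hbi, hLb⟩ := exists_density_of_bound L _ N hL
  have hmp : MeasurePreserving (fun ξ : E d => -ξ) := Measure.measurePreserving_neg volume
  -- The reflection appears because S f is the functional evaluated at 𝓕⁻ f, that is, at ξ ↦ 𝓕 f
  -- (-ξ).
  refine ⟨M, fun ξ => b (-ξ), hbm.comp_measurePreserving hmp, ?_, fun f => ?_⟩
  · have := hbi.comp_neg
    simpa only [decay_neg] using this
  · have h1 : S f = L (𝓕⁻ f) := by
      change S f = S (𝓕 (𝓕⁻ f)); rw [FourierTransform.fourier_fourierInv_eq]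
    rw [h1, hLb, ← integral_neg_eq_self]
    refine integral_congr_ae (.of_forall fun ξ => ?_)
    simp only [SchwartzMap.fourierInv_apply_eq]
    simp

lemma fourier_reflectTranslate (ψ : 𝓢(E d, ℂ)) (x ξ : E d) :
    𝓕 (reflectTranslate ψ x) ξ = Real.fourierChar (-inner ℝ ξ x) • 𝓕 ψ (-ξ) := by
  simp only [SchwartzMap.fourier_coe, Real.fourier_eq, reflectTranslate_apply]
  simp only [Circle.smul_def, smul_eq_mul]
  rw [← integral_sub_left_eq_self _ _ x, ← integral_const_mul]
  refine integral_congr_ae (.of_forall fun y => ?_)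
  simp only [sub_sub_cancel, inner_neg_right, neg_neg]
  rw [← mul_assoc, ← Circle.coe_mul, ← AddChar.map_add_eq_mul]
  congr 3
  rw [inner_sub_left, real_inner_comm x ξ]
  ring

lemma fourier_dilate (ψ : 𝓢(E d, ℂ)) {ε : ℝ} (hε : 0 < ε) (ξ : E d) :
    𝓕 (dilate ψ ε) ξ = 𝓕 ψ (ε • ξ) := by
  simp only [SchwartzMap.fourier_coe, Real.fourier_eq, dilate_apply ψ hε.ne']
  have := Measure.integral_comp_inv_smul_of_nonneg (μ := (volume : Measure (E d)))
    (fun y : E d => Real.fourierChar (-inner ℝ y (ε • ξ)) • ψ y) hε.le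
  rw [finrank_euclideanSpace_fin] at this
  have h2 := congrArg (fun z : ℂ => ((ε ^ d)⁻¹ : ℝ) • z) this
  simp only [smul_smul] at h2
  rw [inv_mul_cancel₀ (by positivity), one_smul, ← integral_smul] at h2
  rw [← h2]
  refine integral_congr_ae (.of_forall fun y => ?_)
  simp only [real_inner_smul_left, real_inner_smul_right]
  rw [← mul_assoc, mul_inv_cancel₀ hε.ne', one_mul, ← Complex.real_smul, smul_comm]

namespace IsDensity

variable {S : 𝓢'(E d, ℂ)} {M : ℕ} {b : E d → ℂ}

lemma aestronglyMeasurable_mul (hb : IsDensity S M b) {h : E d → ℂ} (hh : Continuous h) :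
    AEStronglyMeasurable (fun ξ => b ξ * h ξ) :=
  hb.aestronglyMeasurable.mul hh.aestronglyMeasurable

lemma integrable_mul (hb : IsDensity S M b) {h : E d → ℂ} (hh : Continuous h) {C : ℝ}
    (hC : ∀ ξ, ‖h ξ‖ ≤ C * decay M ξ) : Integrable (fun ξ => b ξ * h ξ) := by
  refine (hb.integrable.const_mul C).mono' (hb.aestronglyMeasurable_mul hh)
    (.of_forall fun ξ => ?_)
  rw [norm_mul]
  calc ‖b ξ‖ * ‖h ξ‖ ≤ ‖b ξ‖ * (C * decay M ξ) := by gcongr; exact hC ξ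
    _ = _ := by ring

lemma integrable_pow_mul (hb : IsDensity S M b) (ψ : 𝓢(E d, ℂ)) (n : ℕ) :
    Integrable (fun ξ => ‖ξ‖ ^ n * ‖b ξ * 𝓕 ψ (-ξ)‖) := by
  obtain ⟨C, hC, h⟩ := exists_norm_le_decay (𝓕 ψ) (M + n)
  refine (hb.integrable.const_mul C).mono' ?_ (.of_forall fun ξ => ?_)
  · exact (continuous_norm.pow n).aestronglyMeasurable.mul
      (hb.aestronglyMeasurable_mul (by fun_prop)).norm
  · rw [Real.norm_of_nonneg (by positivity), norm_mul]
    have h1 := h (-ξ)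
    rw [decay_neg] at h1
    calc _ ≤ ‖ξ‖ ^ n * (‖b ξ‖ * (C * decay (M + n) ξ)) := by gcongr
      _ = (C * ‖b ξ‖) * (‖ξ‖ ^ n * decay (M + n) ξ) := by ring
      _ ≤ (C * ‖b ξ‖) * decay M ξ := by gcongr; exact pow_mul_decay_le n M ξ
      _ = _ := by ring

lemma integrable_fourier (hb : IsDensity S M b) (ψ : 𝓢(E d, ℂ)) :
    Integrable (fun ξ => b ξ * 𝓕 ψ (-ξ)) := by
  have := hb.integrable_pow_mul ψ 0
  simp only [pow_zero, one_mul] at this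
  exact (integrable_norm_iff (hb.aestronglyMeasurable_mul (by fun_prop))).1 this

/-- The convolution with `S` as a Fourier integral. -/
lemma conv_eq (hb : IsDensity S M b) (ψ : 𝓢(E d, ℂ)) :
    conv S ψ = 𝓕 (fun ξ => b ξ * 𝓕 ψ (-ξ)) := by
  funext x
  rw [conv, hb.apply_eq, Real.fourier_eq]
  refine integral_congr_ae (.of_forall fun ξ => ?_)
  simp only [fourier_reflectTranslate]
  rw [mul_smul_comm]

lemma contDiff_conv (hb : IsDensity S M b) (ψ : 𝓢(E d, ℂ)) :
    ContDiff ℝ (⊤ : ℕ∞) (conv S ψ) := by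
  rw [hb.conv_eq]
  exact Real.contDiff_fourier fun n _ => hb.integrable_pow_mul ψ n

lemma iteratedFDeriv_conv (hb : IsDensity S M b) (ψ : 𝓢(E d, ℂ)) (m : ℕ) :
    iteratedFDeriv ℝ m (conv S ψ) = 𝓕 (fun ξ =>
      VectorFourier.fourierPowSMulRight (innerSL ℝ) (fun ξ => b ξ * 𝓕 ψ (-ξ)) ξ m) := by
  rw [hb.conv_eq]
  exact Real.iteratedFDeriv_fourier (N := ⊤) (fun n _ => hb.integrable_pow_mul ψ n)
    (hb.integrable_fourier ψ).1 le_top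

end IsDensity

lemma fourier_iteratedLineDerivOp {m : ℕ} (v : Fin m → E d) (ψ : 𝓢(E d, ℂ)) (ξ : E d) :
    𝓕 (LineDeriv.iteratedLineDerivOp v ψ) ξ =
      (2 * Real.pi * Complex.I) ^ m * (∏ i, (inner ℝ ξ (v i) : ℝ) : ℝ) * 𝓕 ψ ξ := by
  induction m with
  | zero => simp
  | succ m ih =>
    have ht : Function.HasTemperateGrowth (fun ξ : E d => inner ℝ ξ (v 0)) :=
      ((innerSL ℝ).flip (v 0)).hasTemperateGrowth
    rw [LineDeriv.iteratedLineDerivOp_succ_left, SchwartzMap.fourier_lineDerivOp_eq]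
    simp only [smul_apply, SchwartzMap.smulLeftCLM_apply_apply ht]
    rw [ih, Fin.prod_univ_succ]
    simp only [Fin.tail, smul_eq_mul, Complex.real_smul]
    push_cast
    ring

/-- Both sides are Fourier integrals against b. The sign (-1)^m comes from the character on one side
and from the argument -ξ on the other. -/
lemma IsDensity.iteratedFDeriv_conv_apply {S : 𝓢'(E d, ℂ)} {M : ℕ} {b : E d → ℂ}
    (hb : IsDensity S M b) (ψ : 𝓢(E d, ℂ)) {m : ℕ} (v : Fin m → E d) (x : E d) :
    iteratedFDeriv ℝ m (conv S ψ) x v = conv S (LineDeriv.iteratedLineDerivOp v ψ) x := by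
  rw [hb.iteratedFDeriv_conv, Real.fourier_continuousMultilinearMap_apply, hb.conv_eq]
  · refine congrFun (congrArg _ (funext fun ξ => ?_)) x
    rw [fourier_iteratedLineDerivOp, VectorFourier.fourierPowSMulRight_apply]
    simp only [innerSL_apply_apply ℝ, inner_neg_left, Complex.real_smul, Finset.prod_neg,
      Finset.card_univ, Fintype.card_fin, smul_eq_mul]
    push_cast
    rw [neg_pow (2 * (Real.pi : ℂ) * Complex.I)]
    ring
  · exact VectorFourier.integrable_fourierPowSMulRight _ (hb.integrable_pow_mul ψ m)
      (hb.integrable_fourier ψ).1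

lemma IsDensity.partialDeriv_conv {S : 𝓢'(E d, ℂ)} {M : ℕ} {b : E d → ℂ}
    (hb : IsDensity S M b) (ψ : 𝓢(E d, ℂ)) {m : ℕ} (j : Fin m → Fin d) :
    partialDeriv j (conv S ψ) = conv S (LineDeriv.iteratedLineDerivOp
      (fun i => (EuclideanSpace.single (j i) 1 : E d)) ψ) :=
  funext fun x => hb.iteratedFDeriv_conv_apply ψ _ x

/-- Compared on the Fourier side, where dilation is ξ ↦ εξ. This identity turns Sobolev norms of the
net into local means with the kernels ∂^α φ. -/
lemma iteratedLineDerivOp_dilate {m : ℕ} (v : Fin m → E d) (ψ : 𝓢(E d, ℂ)) {ε : ℝ}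
    (hε : 0 < ε) : LineDeriv.iteratedLineDerivOp v (dilate ψ ε) =
      ((ε ^ m)⁻¹ : ℝ) • dilate (LineDeriv.iteratedLineDerivOp v ψ) ε := by
  have hinv : ∀ f : 𝓢(E d, ℂ), 𝓕⁻ (𝓕 f) = f := FourierTransform.fourierInv_fourier_eq
  have hinj : Function.Injective (fun f : 𝓢(E d, ℂ) => 𝓕 f) := fun f g h => by
    rw [← hinv f, ← hinv g]
    exact congrArg _ h
  refine hinj ?_
  ext ξ
  have h1 : 𝓕 (((ε ^ m)⁻¹ : ℝ) • dilate (LineDeriv.iteratedLineDerivOp v ψ) ε) =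
      (((ε ^ m)⁻¹ : ℝ) : ℂ) • 𝓕 (dilate (LineDeriv.iteratedLineDerivOp v ψ) ε) := by
    rw [← FourierTransform.fourier_smul]; rfl
  simp only [h1, smul_apply, smul_eq_mul]
  rw [fourier_iteratedLineDerivOp, fourier_dilate _ hε, fourier_dilate _ hε,
    fourier_iteratedLineDerivOp]
  simp only [real_inner_smul_left, Finset.prod_mul_distrib, Finset.prod_const, Finset.card_univ,
    Fintype.card_fin]
  push_cast
  have : (ε : ℂ) ≠ 0 := by exact_mod_cast hε.ne'
  field_simp

lemma conv_smul (S : 𝓢'(E d, ℂ)) (c : ℝ) (ψ : 𝓢(E d, ℂ)) (x : E d) :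
    conv S (c • ψ) x = c * conv S ψ x := by
  have : reflectTranslate (c • ψ) x = (c : ℂ) • reflectTranslate ψ x := by
    ext y; simp
  rw [conv, this, map_smul, conv, smul_eq_mul]

end

section

/-! ### Continuity of mollified distributions in the parameter -/

/-- Supplies a dominating function uniform in ε on scales bounded away from 0. -/
lemma decay_smul_le (K : ℕ) {δ ε : ℝ} (hδ : 0 < δ) (hε : δ ≤ ε) (ξ : E d) :
    decay K (ε • ξ) ≤ (1 + δ⁻¹) ^ K * decay K ξ := by
  have hε0 : 0 < ε := hδ.trans_le hε
  have h1 : 1 + ‖ξ‖ ≤ (1 + δ⁻¹) * (1 + ‖ε • ξ‖) := by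
    rw [norm_smul, Real.norm_of_nonneg hε0.le]
    have : ‖ξ‖ ≤ δ⁻¹ * (ε * ‖ξ‖) := by
      rw [← mul_assoc]
      have : 1 ≤ δ⁻¹ * ε := by rw [inv_mul_eq_div, one_le_div hδ]; exact hε
      exact le_mul_of_one_le_left (norm_nonneg _) this
    have h2 : 0 ≤ δ⁻¹ := by positivity
    have h3 : 0 ≤ ε * ‖ξ‖ := by positivity
    nlinarith
  have h2 := pow_le_pow_left₀ (by positivity) h1 K
  unfold decay
  rw [← div_eq_mul_inv, inv_eq_one_div, div_le_div_iff₀ (by positivity) (by positivity), one_mul,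
    ← mul_pow]
  exact h2

namespace IsDensity

variable {S : 𝓢'(E d, ℂ)} {M : ℕ} {b : E d → ℂ}

lemma continuousOn_iteratedFDeriv_conv (hb : IsDensity S M b) (φ : 𝓢(E d, ℂ)) (m : ℕ) :
    ContinuousOn (fun z : ℝ × E d => iteratedFDeriv ℝ m (conv S (dilate φ z.1)) z.2)
      (Ioi (0 : ℝ) ×ˢ univ) := by
  let G : ℝ → E d → ContinuousMultilinearMap ℝ (fun _ : Fin m => E d) ℂ := fun ε ξ =>
    VectorFourier.fourierPowSMulRight (innerSL ℝ) (fun ξ => b ξ * 𝓕 φ (ε • (-ξ))) ξ m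
  have heq : ∀ z ∈ Ioi (0 : ℝ) ×ˢ (univ : Set (E d)),
      iteratedFDeriv ℝ m (conv S (dilate φ z.1)) z.2 =
      ∫ ξ, Real.fourierChar (-inner ℝ ξ z.2) • G z.1 ξ := by
    rintro ⟨ε, x⟩ ⟨hε, -⟩
    rw [hb.iteratedFDeriv_conv, Real.fourier_eq]
    simp only [fourier_dilate φ hε, G]
  refine ContinuousOn.congr ?_ heq
  rintro ⟨ε₀, x₀⟩ ⟨hε₀, -⟩
  refine ContinuousAt.continuousWithinAt ?_
  have hδ : 0 < ε₀ / 2 := half_pos hε₀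
  -- M powers of decay integrate b and m powers absorb the factor |ξ|^m produced by m derivatives.
  obtain ⟨C, hC, hφ⟩ := exists_norm_le_decay (𝓕 φ) (M + m)
  have hmeas : ∀ ε : ℝ, AEStronglyMeasurable (G ε) := fun ε =>
    AEStronglyMeasurable.fourierPowSMulRight (innerSL ℝ)
      (hb.aestronglyMeasurable_mul (by fun_prop)) m
  refine continuousAt_of_dominated
    (bound := fun ξ => ((2 * Real.pi * ‖innerSL ℝ (E := E d)‖) ^ m * C *
      (1 + (ε₀ / 2)⁻¹) ^ (M + m)) * (decay M ξ * ‖b ξ‖)) ?_ ?_ (hb.integrable.const_mul _) ?_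
  · refine .of_forall fun z => ?_
    have h1 : Continuous (fun ξ : E d => (Real.fourierChar (-inner ℝ ξ z.2) : ℂ)) := by fun_prop
    exact h1.aestronglyMeasurable.smul (hmeas z.1)
  · have : ∀ᶠ z : ℝ × E d in nhds (ε₀, x₀), ε₀ / 2 < z.1 :=
      continuousAt_fst.eventually (lt_mem_nhds (half_lt_self hε₀))
    filter_upwards [this] with z hz
    refine .of_forall fun ξ => ?_
    rw [Circle.norm_smul]
    refine (VectorFourier.norm_fourierPowSMulRight_le _ _ _ _).trans ?_
    rw [norm_mul]
    have h1 := (hφ (z.1 • (-ξ))).trans (mul_le_mul_of_nonneg_left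
      (decay_smul_le (M + m) hδ hz.le (-ξ)) hC)
    rw [decay_neg] at h1
    have h2 := pow_mul_decay_le m M ξ
    calc _ ≤ (2 * Real.pi * ‖innerSL ℝ (E := E d)‖) ^ m * ‖ξ‖ ^ m * (‖b ξ‖ *
          (C * ((1 + (ε₀ / 2)⁻¹) ^ (M + m) * decay (M + m) ξ))) := by gcongr
      _ = ((2 * Real.pi * ‖innerSL ℝ (E := E d)‖) ^ m * C * (1 + (ε₀ / 2)⁻¹) ^ (M + m)) *
          ((‖ξ‖ ^ m * decay (M + m) ξ) * ‖b ξ‖) := by ring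
      _ ≤ _ := by gcongr
  · refine .of_forall fun ξ => ?_
    have h1 : Continuous fun z : ℝ × E d => (Real.fourierChar (-inner ℝ ξ z.2) : ℂ) := by fun_prop
    have h2 : Continuous fun z : ℝ × E d => G z.1 ξ := by
      simp only [G, VectorFourier.fourierPowSMulRight_eq_comp]
      refine Continuous.fun_const_smul ?_ _
      exact ((ContinuousMultilinearMap.smulRightL ℝ (fun _ : Fin m => E d) ℂ) _).continuous.comp
        (f := fun z : ℝ × E d => b ξ * 𝓕 φ (z.1 • (-ξ))) (by fun_prop)
    exact (h1.smul h2).continuousAt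

lemma isSmoothNet (hb : IsDensity S M b) (φ : 𝓢(E d, ℂ)) (Ω : Opens (E d)) :
    IsSmoothNet Ω (fun ε => conv S (dilate φ ε)) where
  smooth _ _ := (hb.contDiff_conv _).contDiffOn
  continuous m := (hb.continuousOn_iteratedFDeriv_conv φ m).mono
    (prod_mono (fun _ h => h.1) (subset_univ _))

lemma continuousOn_conv (hb : IsDensity S M b) (φ : 𝓢(E d, ℂ)) :
    ContinuousOn (fun z : ℝ × E d => conv S (dilate φ z.1) z.2) (Ioi (0 : ℝ) ×ˢ univ) := by
  have := (ContinuousMultilinearMap.apply ℝ (fun _ : Fin 0 => E d) ℂ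
    (fun i => 0)).continuous.comp_continuousOn (hb.continuousOn_iteratedFDeriv_conv φ 0)
  exact this.congr fun z _ => by simp

end IsDensity

end

section

/-! ### Pointwise bounds for mollified compactly supported distributions -/

lemma norm_iteratedFDeriv_dilate (ψ : 𝓢(E d, ℂ)) (j : ℕ) {ε : ℝ} (hε : 0 < ε) (u : E d) :
    ‖iteratedFDeriv ℝ j (dilate ψ ε) u‖ = (ε ^ (d + j))⁻¹ * ‖iteratedFDeriv ℝ j ψ (ε⁻¹ • u)‖ := by
  have h1 : (dilate ψ ε : E d → ℂ) = fun x => ((ε ^ d)⁻¹ : ℝ) • ψ (ε⁻¹ • x) := by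
    funext x; rw [dilate_apply ψ hε.ne', Complex.real_smul]
  have hs : ContDiff ℝ j (fun x => ψ (ε⁻¹ • x)) := (ψ.smooth j).comp (contDiff_const_smul _)
  rw [h1]
  have h2 := iteratedFDeriv_const_smul_apply (𝕜 := ℝ) (x := u) (a := ((ε ^ d)⁻¹ : ℝ))
    (f := fun x => ψ (ε⁻¹ • x)) (i := j) hs.contDiffAt
  have h3 := congrFun (iteratedFDeriv_comp_const_smul (𝕜 := ℝ) (i := j) (f := ψ) ε⁻¹
    (ψ.smooth j)) u
  change iteratedFDeriv ℝ j (fun x => ((ε ^ d)⁻¹ : ℝ) • ψ (ε⁻¹ • x)) u = _ at h2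
  rw [h2, h3, norm_smul, norm_smul, pow_add, mul_inv, Real.norm_of_nonneg (by positivity),
    Real.norm_of_nonneg (by positivity), inv_pow, mul_assoc]

lemma norm_iteratedFDeriv_reflectTranslate (ψ : 𝓢(E d, ℂ)) (j : ℕ) (x w : E d) :
    ‖iteratedFDeriv ℝ j (reflectTranslate ψ x) w‖ = ‖iteratedFDeriv ℝ j ψ (x - w)‖ := by
  have h1 : (reflectTranslate ψ x : E d → ℂ) = fun y => (fun z => ψ (x + z)) (-y) := by
    funext y; simp [sub_eq_add_neg]
  rw [h1]
  have := LinearIsometryEquiv.norm_iteratedFDeriv_comp_right (𝕜 := ℝ)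
    (LinearIsometryEquiv.neg ℝ : E d ≃ₗᵢ[ℝ] E d) (fun z => ψ (x + z)) w j
  rw [iteratedFDeriv_comp_add_left] at this
  simpa [sub_eq_add_neg, Function.comp_def] using this

lemma decay_inv_smul_le {K : ℕ} {ε δ : ℝ} (hε : 0 < ε) (hδ : 0 < δ) {u : E d} (hu : δ ≤ ‖u‖) :
    decay K (ε⁻¹ • u) ≤ (ε / δ) ^ K := by
  unfold decay
  rw [← inv_inv (ε / δ), inv_pow]
  gcongr
  rw [norm_smul, Real.norm_of_nonneg (by positivity), inv_div, div_eq_inv_mul]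
  have : ε⁻¹ * δ ≤ ε⁻¹ * ‖u‖ := by gcongr
  linarith

/-- The distribution has finite order, and a j-th derivative of the dilate has size ε^{-d-j}. -/
lemma exists_norm_conv_dilate_le {Ω : Opens (E d)} (χ : 𝓓(Ω, ℂ)) (T : Distr Ω) (ψ : 𝓢(E d, ℂ)) :
    ∃ (C : ℝ) (N : ℕ), 0 ≤ C ∧ ∀ ε ∈ Ioo (0 : ℝ) 1, ∀ x,
      ‖conv (mulTempered χ T) (dilate ψ ε) x‖ ≤ C * (ε ^ N)⁻¹ := by
  obtain ⟨C, N, hC, h⟩ := exists_norm_mulTempered_le χ T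
  choose B hB0 hB using fun j => exists_norm_iteratedFDeriv_le_decay ψ j 0
  refine ⟨C * ∑ j ∈ Finset.range (N + 1), B j, d + N,
    mul_nonneg hC (Finset.sum_nonneg fun j _ => hB0 j), fun ε hε x => ?_⟩
  have hS : 0 ≤ ∑ j ∈ Finset.range (N + 1), B j := Finset.sum_nonneg fun j _ => hB0 j
  have hε0 := hε.1
  rw [mul_assoc]
  refine h _ _ (by positivity) fun j hj w _ => ?_
  rw [norm_iteratedFDeriv_reflectTranslate, norm_iteratedFDeriv_dilate _ _ hε.1, mul_comm]
  gcongr ?_ * ?_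
  · refine (hB j _).trans ?_
    rw [decay, pow_zero, inv_one, mul_one]
    exact Finset.single_le_sum (f := B) (fun j _ => hB0 j) (Finset.mem_range.2 (by omega))
  · exact inv_anti₀ (pow_pos hε.1 _) (pow_le_pow_of_le_one hε.1.le hε.2.le (by omega))

/-- At distance δ from the support, ψ and its derivatives are evaluated at points of norm at least
δ/ε. Decay of order d + N + P compensates the loss ε^{-(d+N)} and leaves ε^P. -/
lemma exists_norm_conv_dilate_le_pow {Ω : Opens (E d)} (χ : 𝓓(Ω, ℂ)) (T : Distr Ω)
    (ψ : 𝓢(E d, ℂ)) {δ : ℝ} (hδ : 0 < δ) (P : ℕ) :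
    ∃ C : ℝ, 0 ≤ C ∧ ∀ ε ∈ Ioo (0 : ℝ) 1, ∀ x, (∀ w ∈ tsupport χ, δ ≤ ‖x - w‖) →
      ‖conv (mulTempered χ T) (dilate ψ ε) x‖ ≤ C * ε ^ P := by
  obtain ⟨C, N, hC, h⟩ := exists_norm_mulTempered_le χ T
  choose B hB0 hB using fun j => exists_norm_iteratedFDeriv_le_decay ψ j (d + N + P)
  have hS : 0 ≤ ∑ j ∈ Finset.range (N + 1), B j := Finset.sum_nonneg fun j _ => hB0 j
  refine ⟨C * ((∑ j ∈ Finset.range (N + 1), B j) * (δ ^ (d + N + P))⁻¹), by positivity,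
    fun ε hε x hx => ?_⟩
  have hε0 := hε.1
  rw [mul_assoc]
  refine h _ _ (by positivity) fun j hj w hw => ?_
  rw [norm_iteratedFDeriv_reflectTranslate, norm_iteratedFDeriv_dilate _ _ hε.1]
  have h1 : B j ≤ ∑ j ∈ Finset.range (N + 1), B j :=
    Finset.single_le_sum (f := B) (fun j _ => hB0 j) (Finset.mem_range.2 (by omega))
  have h2 : (ε ^ (d + j))⁻¹ ≤ (ε ^ (d + N))⁻¹ :=
    inv_anti₀ (pow_pos hε.1 _) (pow_le_pow_of_le_one hε.1.le hε.2.le (by omega))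
  calc _ ≤ (ε ^ (d + N))⁻¹ * ((∑ j ∈ Finset.range (N + 1), B j) * (ε / δ) ^ (d + N + P)) := by
        gcongr
        refine (hB j _).trans ?_
        gcongr
        · exact decay_nonneg _ _
        · exact decay_inv_smul_le hε.1 hδ (hx w hw)
    _ = _ := by
        rw [div_pow, pow_add ε]
        field_simp
        ring

/-! ### Weighted norms -/

lemma wNorm_mono_fun {q : ℝ≥0∞} {s : ℝ} {N N' : ℝ → ℝ≥0∞}
    (h : ∀ ε ∈ Ioo (0 : ℝ) 1, N ε ≤ N' ε) : wNorm q s N ≤ wNorm q s N' := by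
  unfold wNorm
  split_ifs
  · exact iSup₂_mono fun ε hε => mul_le_mul_right (h ε hε) _
  · refine ENNReal.rpow_le_rpow (setLIntegral_mono' measurableSet_Ioo fun ε hε => ?_)
      (by positivity)
    gcongr
    exact h ε hε

lemma wNorm_congr_fun {q : ℝ≥0∞} {s : ℝ} {N N' : ℝ → ℝ≥0∞}
    (h : ∀ ε ∈ Ioo (0 : ℝ) 1, N ε = N' ε) : wNorm q s N = wNorm q s N' :=
  le_antisymm (wNorm_mono_fun fun ε hε => (h ε hε).le) (wNorm_mono_fun fun ε hε => (h ε hε).ge)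

lemma wNorm_rpow_mul {q : ℝ≥0∞} (s t : ℝ) (N : ℝ → ℝ≥0∞) :
    wNorm q s (fun ε => ENNReal.ofReal (ε ^ t) * N ε) = wNorm q (s + t) N := by
  unfold wNorm
  split_ifs
  · refine iSup_congr fun ε => iSup_congr fun hε => ?_
    rw [← mul_assoc, ← ENNReal.ofReal_mul (Real.rpow_nonneg hε.1.le _), ← Real.rpow_add hε.1]
  · congr 1
    refine setLIntegral_congr_fun measurableSet_Ioo fun ε hε => ?_
    simp only
    rw [ENNReal.mul_rpow_of_nonneg _ _ ENNReal.toReal_nonneg,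
      ENNReal.ofReal_rpow_of_nonneg (Real.rpow_nonneg hε.1.le _) ENNReal.toReal_nonneg,
      ← mul_assoc, ← ENNReal.ofReal_mul (Real.rpow_nonneg hε.1.le _), ← Real.rpow_mul hε.1.le,
      ← Real.rpow_add hε.1, add_mul]

lemma wNorm_const_mul_lt_top {q : ℝ≥0∞} (hq : 1 ≤ q) {s : ℝ} {N : ℝ → ℝ≥0∞} {C : ℝ≥0∞} (hC : C ≠ ∞)
    (h : wNorm q s N < ∞) : wNorm q s (fun ε => C * N ε) < ∞ := by
  unfold wNorm at *
  split_ifs at * with hqt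
  · refine lt_of_le_of_lt (iSup₂_le fun ε hε => ?_) (ENNReal.mul_lt_top hC.lt_top h)
    rw [mul_left_comm]
    gcongr
    exact le_iSup₂ (f := fun ε (_ : ε ∈ Ioo (0 : ℝ) 1) => ENNReal.ofReal (ε ^ s) * N ε) ε hε
  · have hq1 : 1 ≤ q.toReal := by simpa using ENNReal.toReal_mono hqt hq
    rw [ENNReal.rpow_lt_top_iff_of_pos (by positivity)] at *
    have hc : C ^ q.toReal ≠ ∞ := ENNReal.rpow_ne_top_of_nonneg (by positivity) hC
    refine lt_of_eq_of_lt ?_ (ENNReal.mul_lt_top hc.lt_top h)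
    rw [← lintegral_const_mul' _ _ hc]
    refine lintegral_congr fun ε => ?_
    rw [ENNReal.mul_rpow_of_nonneg _ _ (by positivity)]
    ring

lemma wNorm_one_lt_top {q : ℝ≥0∞} {s : ℝ} (hs : 0 < s) (hq : 1 ≤ q) :
    wNorm q s (fun _ => 1) < ∞ := by
  unfold wNorm
  split_ifs with hqt
  · refine lt_of_le_of_lt (iSup₂_le fun ε hε => ?_) ENNReal.one_lt_top
    rw [mul_one, ← ENNReal.ofReal_one]
    exact ENNReal.ofReal_le_ofReal (Real.rpow_le_one hε.1.le hε.2.le hs.le)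
  · have hq1 : 1 ≤ q.toReal := by simpa using ENNReal.toReal_mono hqt hq
    rw [ENNReal.rpow_lt_top_iff_of_pos (by positivity)]
    have hi : IntegrableOn (fun ε : ℝ => ε ^ (s * q.toReal - 1)) (Ioo 0 1) :=
      (intervalIntegral.integrableOn_Ioo_rpow_iff one_pos).2 (by
        have : 0 < s * q.toReal := by positivity
        linarith)
    refine lt_of_eq_of_lt ?_ hi.lintegral_lt_top
    refine setLIntegral_congr_fun measurableSet_Ioo fun ε hε => ?_
    simp only
    rw [ENNReal.one_rpow, mul_one, ← ENNReal.ofReal_mul (Real.rpow_nonneg hε.1.le _),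
      Real.rpow_sub_one hε.1.ne', div_eq_mul_inv]

lemma wNorm_lt_top_of_le_rpow {q : ℝ≥0∞} (hq : 1 ≤ q) {s t : ℝ} {N : ℝ → ℝ≥0∞} {C : ℝ≥0∞}
    (hC : C ≠ ∞) (hst : 0 < s + t) (h : ∀ ε ∈ Ioo (0 : ℝ) 1, N ε ≤ C * ENNReal.ofReal (ε ^ t)) :
    wNorm q s N < ∞ := by
  refine (wNorm_mono_fun h).trans_lt (wNorm_const_mul_lt_top hq hC ?_)
  have := wNorm_rpow_mul (q := q) s t (fun _ => 1)
  simp only [mul_one] at this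
  rw [this]
  exact wNorm_one_lt_top hst hq

lemma wNorm_sum_lt_top {q : ℝ≥0∞} (hq : 1 ≤ q) {s : ℝ} {ι : Type*} (F : Finset ι)
    {N : ι → ℝ → ℝ≥0∞} (hm : ∀ i ∈ F, AEMeasurable (N i) (volume.restrict (Ioo (0 : ℝ) 1)))
    (h : ∀ i ∈ F, wNorm q s (N i) < ∞) : wNorm q s (fun ε => ∑ i ∈ F, N i ε) < ∞ := by
  classical
  induction F using Finset.induction_on with
  | empty =>
    refine wNorm_lt_top_of_le_rpow hq (t := 1 - s) (C := 0) (by simp) (by linarith) ?_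
    simp
  | insert a F ha ih =>
    refine wNorm_add_lt_top hq (N₁ := N a) (N₂ := fun ε => ∑ i ∈ F, N i ε) (fun ε _ => ?_)
      (hm a (Finset.mem_insert_self a F)) (h a (Finset.mem_insert_self a F))
      (ih (fun i hi => hm i (Finset.mem_insert_of_mem hi))
        (fun i hi => h i (Finset.mem_insert_of_mem hi)))
    rw [Finset.sum_insert ha]

/-! ### Moderateness and negligibility from pointwise bounds -/

/-- On a set of finite measure a pointwise bound gives an L^p bound. The supremum over derivatives
is replaced by a finite sum so that the exponent t may depend on the derivative. -/
lemma netNorm_lt_top_of_bounds {q p : ℝ≥0∞} (hq : 1 ≤ q) {s : ℝ} {k : ℕ} {ω : Opens (E d)}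
    (hω : IsCompact (closure (ω : Set (E d)))) {f : Net d}
    (h : ∀ m ≤ k, ∀ j : Fin m → Fin d, ∃ C t : ℝ, 0 < s + t ∧ ∀ ε ∈ Ioo (0 : ℝ) 1, ∀ x ∈ ω,
      ‖partialDeriv j (f ε) x‖ ≤ C * ε ^ t) : netNorm q p s k ω f < ∞ := by
  have h' : ∀ i : (Σ m : Fin (k + 1), Fin m → Fin d), ∃ C t : ℝ, 0 < s + t ∧
      ∀ ε ∈ Ioo (0 : ℝ) 1, ∀ x ∈ ω, ‖partialDeriv i.2 (f ε) x‖ ≤ C * ε ^ t :=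
    fun i => h i.1 (by omega) i.2
  choose C t ht hb using h'
  let V : ℝ≥0∞ := volume (ω : Set (E d)) ^ p.toReal⁻¹
  have hV : V ≠ ∞ := ENNReal.rpow_ne_top_of_nonneg (by positivity)
    ((measure_mono subset_closure).trans_lt hω.measure_lt_top).ne
  refine (wNorm_mono_fun (N' := fun ε => ∑ i : (Σ m : Fin (k + 1), Fin m → Fin d),
    V * ENNReal.ofReal (C i * ε ^ t i)) fun ε hε => ?_).trans_lt
    (wNorm_sum_lt_top hq _ (fun i _ => ?_) fun i _ => ?_)
  · refine iSup_le fun m => iSup_le fun hm => iSup_le fun j => ?_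
    refine le_trans ?_ (Finset.single_le_sum (f := fun i : (Σ m : Fin (k + 1), Fin m → Fin d) =>
      V * ENNReal.ofReal (C i * ε ^ t i)) (fun _ _ => zero_le)
      (Finset.mem_univ ⟨⟨m, by omega⟩, j⟩))
    refine (eLpNorm_le_of_ae_bound ((ae_restrict_iff' ω.isOpen.measurableSet).2
      (.of_forall fun x hx => hb ⟨⟨m, by omega⟩, j⟩ ε hε x hx))).trans_eq ?_
    simp [V]
  · fun_prop
  · refine wNorm_lt_top_of_le_rpow hq (C := V * ENNReal.ofReal (|C i|))
      (ENNReal.mul_ne_top hV ENNReal.ofReal_ne_top) (ht i) fun ε hε => ?_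
    rw [mul_assoc, ← ENNReal.ofReal_mul (abs_nonneg _)]
    have := Real.rpow_nonneg hε.1.le (t i)
    gcongr
    exact le_abs_self _

variable {q p : ℝ≥0∞} [Fact (1 ≤ q)] [Fact (1 ≤ p)]

lemma mem_negligible_of_bounds {ω : Opens (E d)} {f : Net d} (hf : IsSmoothNet ω f)
    (h : ∀ ω' : Opens (E d), CompactlyIn ω' ω → ∀ (m : ℕ) (j : Fin m → Fin d) (P : ℕ), ∃ C : ℝ,
      ∀ ε ∈ Ioo (0 : ℝ) 1, ∀ x ∈ ω', ‖partialDeriv j (f ε) x‖ ≤ C * ε ^ P) :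
    f ∈ negligible q p ω := by
  refine ⟨hf, fun k ω' hω' s => netNorm_lt_top_of_bounds Fact.out hω'.1 fun m _ j => ?_⟩
  obtain ⟨P, hP⟩ := exists_nat_gt (-s)
  obtain ⟨C, hC⟩ := h ω' hω' m j P
  refine ⟨C, P, by linarith, fun ε hε x hx => ?_⟩
  rw [Real.rpow_natCast]
  exact hC ε hε x hx

lemma mem_moderate_of_bounds {ω : Opens (E d)} {f : Net d} (hf : IsSmoothNet ω f)
    (h : ∀ ω' : Opens (E d), CompactlyIn ω' ω → ∀ (m : ℕ) (j : Fin m → Fin d),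
      ∃ (C : ℝ) (P : ℕ), ∀ ε ∈ Ioo (0 : ℝ) 1, ∀ x ∈ ω', ‖partialDeriv j (f ε) x‖ ≤ C * (ε ^ P)⁻¹) :
    f ∈ moderate q p ω := by
  refine ⟨hf, fun k ω' hω' => ?_⟩
  have h' : ∀ i : (Σ m : Fin (k + 1), Fin m → Fin d), ∃ (C : ℝ) (P : ℕ),
      ∀ ε ∈ Ioo (0 : ℝ) 1, ∀ x ∈ ω', ‖partialDeriv i.2 (f ε) x‖ ≤ C * (ε ^ P)⁻¹ :=
    fun i => h ω' hω' i.1 i.2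
  choose C P hb using h'
  -- A single weight exponent must exceed every P i strictly, since ε^0 is not integrable for dε/ε.
  refine ⟨1 + ∑ i, (P i : ℝ), netNorm_lt_top_of_bounds Fact.out hω'.1 fun m hm j => ?_⟩
  let i : (Σ m : Fin (k + 1), Fin m → Fin d) := ⟨⟨m, by omega⟩, j⟩
  refine ⟨C i, -(P i : ℝ), ?_, fun ε hε x hx => ?_⟩
  · have : (P i : ℝ) ≤ ∑ i, (P i : ℝ) :=
      Finset.single_le_sum (f := fun i => (P i : ℝ)) (fun _ _ => by positivity)
        (Finset.mem_univ i)
    linarith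
  · rw [Real.rpow_neg hε.1.le, Real.rpow_natCast]
    exact hb i ε hε x hx

end

section

/-! ### Multilinear maps in coordinates -/

lemma multilinear_apply_eq_sum {m : ℕ} (A : ContinuousMultilinearMap ℝ (fun _ : Fin m => E d) ℂ)
    (v : Fin m → E d) : A v = ∑ j : Fin m → Fin d,
      (∏ i, v i (j i)) • A (fun i => EuclideanSpace.single (j i) 1) := by
  have h : v = fun i => ∑ l : Fin d, (v i l) • (EuclideanSpace.single l 1 : E d) := by
    funext i
    have := (EuclideanSpace.basisFun (Fin d) ℝ).sum_repr (v i)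
    simpa using this.symm
  conv_lhs => rw [h]
  rw [A.map_sum]
  exact Finset.sum_congr rfl fun j _ => A.map_smul_univ _ _

lemma abs_apply_le_norm (x : E d) (i : Fin d) : |x i| ≤ ‖x‖ := by
  simpa using EuclideanSpace.norm_eq x ▸ Real.abs_le_sqrt (Finset.single_le_sum
    (f := fun i => ‖x i‖ ^ 2) (fun _ _ => by positivity) (Finset.mem_univ i) |>.trans' (by simp))

lemma norm_multilinear_le_sum {m : ℕ} (A : ContinuousMultilinearMap ℝ (fun _ : Fin m => E d) ℂ) :
    ‖A‖ ≤ ∑ j : Fin m → Fin d, ‖A (fun i => EuclideanSpace.single (j i) 1)‖ := by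
  refine A.opNorm_le_bound (Finset.sum_nonneg fun _ _ => norm_nonneg _) fun v => ?_
  rw [multilinear_apply_eq_sum A v, Finset.sum_mul]
  refine (norm_sum_le _ _).trans (Finset.sum_le_sum fun j _ => ?_)
  rw [norm_smul, mul_comm, Real.norm_eq_abs, Finset.abs_prod]
  gcongr with i
  exact abs_apply_le_norm _ _

lemma norm_iteratedFDeriv_le_sum_partialDeriv (f : E d → ℂ) (m : ℕ) (x : E d) :
    ‖iteratedFDeriv ℝ m f x‖ ≤ ∑ j : Fin m → Fin d, ‖partialDeriv j f x‖ :=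
  norm_multilinear_le_sum _

lemma norm_partialDeriv_le {m : ℕ} (j : Fin m → Fin d) (f : E d → ℂ) (x : E d) :
    ‖partialDeriv j f x‖ ≤ ‖iteratedFDeriv ℝ m f x‖ := by
  refine ((iteratedFDeriv ℝ m f x).le_opNorm _).trans_eq ?_
  simp

/-! ### Local properties of nets -/

lemma CompactlyIn.exists_between {ω Ω : Opens (E d)} (h : CompactlyIn ω Ω) :
    ∃ ω' : Opens (E d), CompactlyIn ω ω' ∧ CompactlyIn ω' Ω := by
  obtain ⟨K, hK, h1, h2⟩ := exists_compact_between h.1 Ω.isOpen h.2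
  have h3 : closure (interior K) ⊆ K := closure_minimal interior_subset hK.isClosed
  exact ⟨⟨interior K, isOpen_interior⟩, ⟨h.1, h1⟩, hK.of_isClosed_subset isClosed_closure h3,
    h3.trans h2⟩

lemma exists_compactlyIn_mem {Ω : Opens (E d)} {x : E d} (hx : x ∈ Ω) :
    ∃ ω : Opens (E d), x ∈ ω ∧ CompactlyIn ω Ω := by
  obtain ⟨K, hK, h1, h2⟩ := exists_compact_between (isCompact_singleton (x := x)) Ω.isOpen
    (singleton_subset_iff.2 hx)
  have h3 : closure (interior K) ⊆ K := closure_minimal interior_subset hK.isClosed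
  exact ⟨⟨interior K, isOpen_interior⟩, h1 rfl, hK.of_isClosed_subset isClosed_closure h3,
    h3.trans h2⟩

lemma iteratedFDeriv_congr_of_eqOn {ω : Opens (E d)} {f g : E d → ℂ} (h : EqOn f g ω) (m : ℕ)
    {x : E d} (hx : x ∈ ω) : iteratedFDeriv ℝ m f x = iteratedFDeriv ℝ m g x :=
  (Filter.EventuallyEq.iteratedFDeriv ℝ (h.eventuallyEq_of_mem (ω.isOpen.mem_nhds hx)) m).eq_of_nhds

lemma IsSmoothNet.congr {Ω : Opens (E d)} {f g : Net d} (hf : IsSmoothNet Ω f)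
    (h : ∀ ε ∈ Ioo (0 : ℝ) 1, EqOn (f ε) (g ε) Ω) : IsSmoothNet Ω g where
  smooth ε hε := (hf.smooth ε hε).congr fun _ hx => (h ε hε hx).symm
  continuous m := (hf.continuous m).congr fun z hz =>
    (iteratedFDeriv_congr_of_eqOn (h z.1 hz.1) m hz.2).symm

lemma IsSmoothNet.of_local {Ω : Opens (E d)} {f : Net d}
    (h : ∀ x ∈ Ω, ∃ ω : Opens (E d), x ∈ ω ∧ IsSmoothNet ω f) : IsSmoothNet Ω f where
  smooth ε hε x hx := by
    obtain ⟨ω, hxω, hω⟩ := h x hx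
    exact (hω.contDiffAt hε hxω).contDiffWithinAt
  continuous m := by
    rintro ⟨ε, x⟩ ⟨hε, hx⟩
    obtain ⟨ω, hxω, hω⟩ := h x hx
    exact ((hω.continuous m).continuousAt ((isOpen_Ioo.prod ω.isOpen).mem_nhds
      ⟨hε, hxω⟩)).continuousWithinAt

lemma sobolevNorm_congr {k : ℕ} {p : ℝ≥0∞} {ω : Opens (E d)} {f g : E d → ℂ} (h : EqOn f g ω) :
    sobolevNorm k p ω f = sobolevNorm k p ω g := by
  refine iSup_congr fun m => iSup_congr fun _ => iSup_congr fun j => eLpNorm_congr_ae ?_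
  refine (ae_restrict_iff' ω.isOpen.measurableSet).2 (.of_forall fun x hx => ?_)
  simp only [partialDeriv, iteratedFDeriv_congr_of_eqOn h m hx]

lemma netNorm_congr {q p : ℝ≥0∞} {s : ℝ} {k : ℕ} {ω : Opens (E d)} {f g : Net d}
    (h : ∀ ε ∈ Ioo (0 : ℝ) 1, EqOn (f ε) (g ε) ω) : netNorm q p s k ω f = netNorm q p s k ω g :=
  wNorm_congr_fun fun ε hε => sobolevNorm_congr (h ε hε)

variable {q p : ℝ≥0∞} [Fact (1 ≤ q)] [Fact (1 ≤ p)]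

lemma negligible_congr {ω : Opens (E d)} {f g : Net d} (hf : f ∈ negligible q p ω)
    (h : ∀ ε ∈ Ioo (0 : ℝ) 1, EqOn (f ε) (g ε) ω) : g ∈ negligible q p ω :=
  ⟨hf.1.congr h, fun k ω' hω' s => by
    rw [← netNorm_congr fun ε hε => (h ε hε).mono hω'.le]; exact hf.2 k ω' hω' s⟩

/-- The estimates only test sets ω ⋐ Ω, and an intermediate set ω ⋐ ω' ⋐ Ω lets the hypothesis on ω'
be used for ω. -/
lemma mem_negligible_of_local {Ω : Opens (E d)} {f : Net d}
    (h : ∀ ω : Opens (E d), CompactlyIn ω Ω → f ∈ negligible q p ω) : f ∈ negligible q p Ω := by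
  refine ⟨.of_local fun x hx => ?_, fun k ω hω s => ?_⟩
  · obtain ⟨ω, hxω, hω⟩ := exists_compactlyIn_mem hx
    exact ⟨ω, hxω, (h ω hω).1⟩
  · obtain ⟨ω', h1, h2⟩ := hω.exists_between
    exact (h ω' h2).2 k ω h1 s

lemma negligible_le_moderate {Ω : Opens (E d)} : negligible q p Ω ≤ moderate q p Ω :=
  fun _ hf => ⟨hf.1, fun k ω hω => ⟨0, hf.2 k ω hω 0⟩⟩

lemma mem_moderate_of_local {Ω : Opens (E d)} {f : Net d}
    (h : ∀ ω : Opens (E d), CompactlyIn ω Ω → f ∈ moderate q p ω) : f ∈ moderate q p Ω := by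
  refine ⟨.of_local fun x hx => ?_, fun k ω hω => ?_⟩
  · obtain ⟨ω, hxω, hω⟩ := exists_compactlyIn_mem hx
    exact ⟨ω, hxω, (h ω hω).1⟩
  · obtain ⟨ω', h1, h2⟩ := hω.exists_between
    exact (h ω' h2).2 k ω h1

/-- Joint continuity at (ε₀, x₀): by Leibniz, the derivatives of η (g_ε - g_ε₀) are bounded by
derivatives of g_ε - g_ε₀, which tend to 0 there; for the fixed function η g_ε₀ continuity is clear.
-/
lemma IsSmoothNet.mul_left {Ω : Opens (E d)} {g : Net d} (hg : IsSmoothNet Ω g)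
    (hg' : ∀ ε ∈ Ioo (0 : ℝ) 1, ContDiff ℝ (⊤ : ℕ∞) (g ε)) {η : E d → ℂ}
    (hη : ContDiff ℝ (⊤ : ℕ∞) η) : IsSmoothNet Ω (fun ε x => η x * g ε x) where
  smooth ε hε := (hη.mul (hg' ε hε)).contDiffOn
  continuous m := by
    rintro ⟨ε₀, x₀⟩ ⟨hε₀, hx₀⟩
    have hD : ∀ j, ContinuousAt (fun z : ℝ × E d =>
        iteratedFDeriv ℝ j (g z.1) z.2 - iteratedFDeriv ℝ j (g ε₀) z.2) (ε₀, x₀) := fun j =>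
      ((hg.continuous j).continuousAt ((isOpen_Ioo.prod Ω.isOpen).mem_nhds ⟨hε₀, hx₀⟩)).sub
        (((hg' ε₀ hε₀).continuous_iteratedFDeriv (mod_cast le_top)).continuousAt.comp
          continuousAt_snd)
    have hη' : ∀ j, Continuous (fun z : ℝ × E d => ‖iteratedFDeriv ℝ j η z.2‖) := fun j =>
      ((hη.continuous_iteratedFDeriv (mod_cast le_top)).comp continuous_snd).norm
    have hlim : Filter.Tendsto (fun z : ℝ × E d => ∑ i ∈ Finset.range (m + 1),
        (m.choose i : ℝ) * ‖iteratedFDeriv ℝ i η z.2‖ *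
          ‖iteratedFDeriv ℝ (m - i) (g z.1) z.2 - iteratedFDeriv ℝ (m - i) (g ε₀) z.2‖)
        (nhds (ε₀, x₀)) (nhds 0) := by
      have : ContinuousAt (fun z : ℝ × E d => ∑ i ∈ Finset.range (m + 1),
        (m.choose i : ℝ) * ‖iteratedFDeriv ℝ i η z.2‖ *
          ‖iteratedFDeriv ℝ (m - i) (g z.1) z.2 - iteratedFDeriv ℝ (m - i) (g ε₀) z.2‖)
          (ε₀, x₀) := by
        refine tendsto_finsetSum _ fun i _ => ?_
        exact (continuousAt_const.mul (hη' i).continuousAt).mul (hD (m - i)).norm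
      simpa [ContinuousAt] using this
    refine ContinuousAt.continuousWithinAt ?_
    have h0 : ContinuousAt (fun z : ℝ × E d =>
        iteratedFDeriv ℝ m (fun x => η x * g ε₀ x) z.2) (ε₀, x₀) :=
      ((hη.mul (hg' ε₀ hε₀)).continuous_iteratedFDeriv (mod_cast le_top)).continuousAt.comp
        continuousAt_snd
    have h1 : Filter.Tendsto (fun z : ℝ × E d => iteratedFDeriv ℝ m (fun x => η x * g z.1 x) z.2 -
        iteratedFDeriv ℝ m (fun x => η x * g ε₀ x) z.2) (nhds (ε₀, x₀)) (nhds 0) := by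
      refine squeeze_zero_norm' ?_ hlim
      filter_upwards [(isOpen_Ioo.prod Ω.isOpen).mem_nhds
        (show (ε₀, x₀) ∈ Ioo (0 : ℝ) 1 ×ˢ (Ω : Set (E d)) from ⟨hε₀, hx₀⟩)] with z hz
      have hs := hg' z.1 hz.1
      have hs0 := hg' ε₀ hε₀
      have e1 : iteratedFDeriv ℝ m (fun x => η x * g z.1 x) z.2 -
          iteratedFDeriv ℝ m (fun x => η x * g ε₀ x) z.2 =
          iteratedFDeriv ℝ m (fun x => η x * (g z.1 - g ε₀) x) z.2 := by
        have := iteratedFDeriv_sub_apply (𝕜 := ℝ) (i := m) (x := z.2)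
          (f := fun x => η x * g z.1 x) (g := fun x => η x * g ε₀ x)
          ((hη.mul hs).of_le (mod_cast le_top)).contDiffAt
          ((hη.mul hs0).of_le (mod_cast le_top)).contDiffAt
        rw [← this]
        congr 1
        funext x
        simp [mul_sub]
      rw [e1]
      refine (norm_iteratedFDeriv_mul_le hη (hs.sub hs0) z.2 (mod_cast le_top)).trans_eq ?_
      refine Finset.sum_congr rfl fun i _ => ?_
      have e2 := iteratedFDeriv_sub_apply (𝕜 := ℝ) (i := m - i) (x := z.2) (f := g z.1)
        (g := g ε₀) (contDiff_infty.1 hs (m - i)).contDiffAt (contDiff_infty.1 hs0 (m - i)).contDiffAt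
      rw [← e2]
      rfl
    have := h1.add h0
    simpa [ContinuousAt] using this

/-! ### Mollified compactly supported distributions -/

/-- The net `(S * φ_ε)`. -/
def mollify (φ : 𝓢(E d, ℂ)) (S : 𝓢'(E d, ℂ)) : Net d := fun ε => conv S (dilate φ ε)

lemma isSmoothNet_mollify {Ω : Opens (E d)} (χ : 𝓓(Ω, ℂ)) (T : Distr Ω) (φ : 𝓢(E d, ℂ))
    (ω : Opens (E d)) : IsSmoothNet ω (mollify φ (mulTempered χ T)) := by
  obtain ⟨M, b, hb⟩ := exists_isDensity χ T
  exact hb.isSmoothNet φ ω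

lemma contDiff_conv_mulTempered {Ω : Opens (E d)} (χ : 𝓓(Ω, ℂ)) (T : Distr Ω) (ψ : 𝓢(E d, ℂ)) :
    ContDiff ℝ (⊤ : ℕ∞) (conv (mulTempered χ T) ψ) := by
  obtain ⟨M, b, hb⟩ := exists_isDensity χ T
  exact hb.contDiff_conv ψ

lemma partialDeriv_conv_dilate {Ω : Opens (E d)} (χ : 𝓓(Ω, ℂ)) (T : Distr Ω) (ψ : 𝓢(E d, ℂ))
    {m : ℕ} (j : Fin m → Fin d) {ε : ℝ} (hε : 0 < ε) (x : E d) :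
    partialDeriv j (conv (mulTempered χ T) (dilate ψ ε)) x = ((ε ^ m)⁻¹ : ℝ) *
      conv (mulTempered χ T) (dilate (LineDeriv.iteratedLineDerivOp
        (fun i => (EuclideanSpace.single (j i) 1 : E d)) ψ) ε) x := by
  obtain ⟨M, b, hb⟩ := exists_isDensity χ T
  rw [hb.partialDeriv_conv, iteratedLineDerivOp_dilate _ _ hε, conv_smul]

lemma mollify_mem_moderate {Ω : Opens (E d)} (χ : 𝓓(Ω, ℂ)) (T : Distr Ω) (φ : 𝓢(E d, ℂ))
    (ω : Opens (E d)) : mollify φ (mulTempered χ T) ∈ moderate q p ω := by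
  refine mem_moderate_of_bounds (isSmoothNet_mollify χ T φ ω) fun ω' _ m j => ?_
  obtain ⟨C, N, hC, h⟩ := exists_norm_conv_dilate_le χ T (LineDeriv.iteratedLineDerivOp
        (fun i => (EuclideanSpace.single (j i) 1 : E d)) φ)
  refine ⟨C, m + N, fun ε hε x _ => ?_⟩
  have h0 := hε.1
  rw [mollify, partialDeriv_conv_dilate χ T φ j hε.1, norm_mul, Complex.norm_real,
    Real.norm_of_nonneg (by positivity), pow_add, mul_inv]
  calc _ ≤ (ε ^ m)⁻¹ * (C * (ε ^ N)⁻¹) := by gcongr; exact h ε hε x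
    _ = _ := by ring

lemma exists_norm_iteratedFDeriv_mollify_le {Ω : Opens (E d)} (χ : 𝓓(Ω, ℂ)) (T : Distr Ω)
    (φ : 𝓢(E d, ℂ)) {δ : ℝ} (hδ : 0 < δ) (m P : ℕ) : ∃ C : ℝ, 0 ≤ C ∧ ∀ ε ∈ Ioo (0 : ℝ) 1,
      ∀ x, (∀ w ∈ tsupport χ, δ ≤ ‖x - w‖) →
        ‖iteratedFDeriv ℝ m (mollify φ (mulTempered χ T) ε) x‖ ≤ C * ε ^ P := by
  -- The exponent m + P pays for the factor ε^{-m} of the m derivatives.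
  choose C hC h using fun j : Fin m → Fin d => exists_norm_conv_dilate_le_pow χ T
    (LineDeriv.iteratedLineDerivOp (fun i => (EuclideanSpace.single (j i) 1 : E d)) φ) hδ (m + P)
  refine ⟨∑ j, C j, Finset.sum_nonneg fun j _ => hC j, fun ε hε x hx => ?_⟩
  refine (norm_iteratedFDeriv_le_sum_partialDeriv _ m x).trans ?_
  rw [Finset.sum_mul]
  refine Finset.sum_le_sum fun j _ => ?_
  have h0 := hε.1
  rw [mollify, partialDeriv_conv_dilate χ T φ j hε.1, norm_mul, Complex.norm_real,
    Real.norm_of_nonneg (by positivity)]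
  calc _ ≤ (ε ^ m)⁻¹ * (C j * ε ^ (m + P)) := by gcongr; exact h j ε hε x hx
    _ = _ := by rw [pow_add]; field_simp

/-- Away from its support, a mollified distribution is negligible. -/
lemma mul_mollify_mem_negligible {Ω : Opens (E d)} (χ : 𝓓(Ω, ℂ)) (T : Distr Ω) (φ : 𝓢(E d, ℂ))
    {η : E d → ℂ} (hη : ContDiff ℝ (⊤ : ℕ∞) η) {ω U : Opens (E d)}
    (hU : (ω : Set (E d)) ∩ tsupport η ⊆ U) (hχ : ∀ x ∈ U, χ x = 0) :
    (fun ε x => η x * mollify φ (mulTempered χ T) ε x) ∈ negligible q p ω := by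
  refine mem_negligible_of_bounds ((isSmoothNet_mollify χ T φ ω).mul_left
    (fun ε _ => contDiff_conv_mulTempered χ T _) hη) fun ω' hω' m j P => ?_
  -- The first set is compact and lies in the open set U, where χ = 0. It is therefore at positive
  -- distance from the support of χ, and the rapid decay applies.
  have hdisj : Disjoint (closure (ω' : Set (E d)) ∩ tsupport η) (tsupport χ) := by
    refine Set.disjoint_left.2 fun x hx hx' => ?_
    have hxU : x ∈ U := hU ⟨hω'.2 hx.1, hx.2⟩
    obtain ⟨y, hy, hy'⟩ := mem_closure_iff.1 hx' U U.isOpen hxU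
    exact hy' (hχ y hy)
  obtain ⟨δ, hδ, hd⟩ := Metric.exists_pos_forall_lt_edist
    (hω'.1.inter_right (isClosed_tsupport η)) (isClosed_tsupport χ) hdisj
  have hδ' : ∀ x ∈ closure (ω' : Set (E d)) ∩ tsupport η, ∀ w ∈ tsupport χ, (δ : ℝ) ≤ ‖x - w‖ := by
    intro x hx w hw
    have := (hd x hx w hw).le
    rw [edist_nndist, ENNReal.coe_le_coe] at this
    rw [← dist_eq_norm, ← coe_nndist]
    exact_mod_cast this
  choose B hB using fun i : ℕ => hω'.1.exists_bound_of_continuousOn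
    (hη.continuous_iteratedFDeriv (m := i) (mod_cast le_top)).continuousOn
  choose C hC0 hC using fun i : ℕ => exists_norm_iteratedFDeriv_mollify_le χ T φ
    (δ := δ) (by exact_mod_cast hδ) i P
  refine ⟨∑ i ∈ Finset.range (m + 1), (m.choose i : ℝ) * |B i| * C (m - i),
    fun ε hε x hx => (norm_partialDeriv_le _ _ _).trans ?_⟩
  have h0 := hε.1
  have hpos : ∀ i, 0 ≤ C i := hC0
  by_cases hxη : x ∈ tsupport η
  · refine (norm_iteratedFDeriv_mul_le hη (contDiff_conv_mulTempered χ T _) x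
      (mod_cast le_top)).trans ?_
    rw [Finset.sum_mul]
    refine Finset.sum_le_sum fun i _ => ?_
    rw [mul_assoc _ (C _)]
    gcongr
    · exact (hB i x (subset_closure hx)).trans (le_abs_self _)
    · exact hC (m - i) ε hε x (hδ' x ⟨subset_closure hx, hxη⟩)
  · have hts : x ∉ tsupport (iteratedFDeriv ℝ m
        fun x => η x * mollify φ (mulTempered χ T) ε x) := fun h =>
      hxη (tsupport_mul_subset_left (tsupport_iteratedFDeriv_subset m h))
    rw [image_eq_zero_of_notMem_tsupport hts, norm_zero]
    have : ∀ i ∈ Finset.range (m + 1), 0 ≤ (m.choose i : ℝ) * |B i| * C (m - i) := fun i _ => by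
      have := hpos (m - i); positivity
    have := Finset.sum_nonneg this
    positivity

lemma mollify_mem_negligible {Ω : Opens (E d)} (χ : 𝓓(Ω, ℂ)) (T : Distr Ω) (φ : 𝓢(E d, ℂ))
    {ω : Opens (E d)} (hχ : ∀ x ∈ ω, χ x = 0) :
    mollify φ (mulTempered χ T) ∈ negligible q p ω := by
  have := mul_mollify_mem_negligible (q := q) (p := p) χ T φ (η := fun _ => 1) contDiff_const
    (ω := ω) (U := ω) inter_subset_left hχ
  simpa using this

lemma mollify_sub {Ω : Opens (E d)} (χ χ' : 𝓓(Ω, ℂ)) (T : Distr Ω) (φ : 𝓢(E d, ℂ)) :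
    mollify φ (mulTempered χ T) - mollify φ (mulTempered χ' T) =
      mollify φ (mulTempered (χ - χ') T) := by
  funext ε x
  simp only [Pi.sub_apply, mollify, conv, mulTempered_apply]
  rw [← map_sub]
  congr 1
  ext y
  simp [mulTest, sub_mul]

/-! ### Cutoff functions -/

/-- Having χ = 1 on an open neighbourhood, not merely on K, makes χT and T agree as distributions
near K. -/
lemma exists_cutoff {Ω : Opens (E d)} {K : Set (E d)} (hK : IsCompact K) (hKΩ : K ⊆ Ω) :
    ∃ (χ : 𝓓(Ω, ℂ)) (U : Opens (E d)), K ⊆ U ∧ U ≤ Ω ∧ ∀ x ∈ U, χ x = 1 := by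
  obtain ⟨K', hK', h1, h2⟩ := exists_compact_between hK Ω.isOpen hKΩ
  obtain ⟨f, hf1, hf0, -⟩ := exists_contMDiffMap_one_nhds_of_subset_interior
    (n := (⊤ : ℕ∞)) (modelWithCornersSelf ℝ (E d)) hK.isClosed h1
  obtain ⟨V, hV, hKV, hV1⟩ := mem_nhdsSet_iff_exists.1 hf1
  have hsupp : tsupport (fun x => ((f x : ℝ) : ℂ)) ⊆ K' := by
    refine closure_minimal (fun x hx => ?_) hK'.isClosed
    by_contra hxK
    exact hx (by simp [hf0 x hxK])
  have hcd : ContDiff ℝ (⊤ : ℕ∞) (fun x => ((f x : ℝ) : ℂ)) :=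
    Complex.ofRealCLM.contDiff.comp f.contMDiff.contDiff
  refine ⟨⟨fun x => ((f x : ℝ) : ℂ), hcd, hK'.of_isClosed_subset (isClosed_tsupport _) hsupp,
    hsupp.trans h2⟩, ⟨V ∩ Ω, hV.inter Ω.isOpen⟩, subset_inter hKV hKΩ, inter_subset_right, ?_⟩
  rintro x ⟨hx, -⟩
  have : f x = 1 := hV1 hx
  change ((f x : ℝ) : ℂ) = 1
  rw [this, Complex.ofReal_one]

/-- A sequence of cutoff functions for an exhaustion of `Ω`. -/
lemma exists_cutoff_seq (Ω : Opens (E d)) : ∃ a : ℕ → 𝓓(Ω, ℂ),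
    ∀ ω : Opens (E d), CompactlyIn ω Ω → ∃ m, ∀ n ≥ m, ∀ x ∈ ω, a n x = 1 := by
  have : LocallyCompactSpace Ω := Ω.isOpen.locallyCompactSpace
  let K := CompactExhaustion.choice Ω
  choose a U h1 h2 h3 using fun n => exists_cutoff (Ω := Ω) (K := Subtype.val '' K n)
    ((K.isCompact n).image continuous_subtype_val) (by rintro _ ⟨x, -, rfl⟩; exact x.2)
  refine ⟨a, fun ω hω => ?_⟩
  have hc : IsCompact ((Subtype.val : Ω → E d) ⁻¹' closure (ω : Set (E d))) :=
    Topology.IsInducing.subtypeVal.isCompact_preimage' hω.1 (by simpa using! hω.2)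
  obtain ⟨m, hm⟩ := K.exists_superset_of_isCompact hc
  refine ⟨m, fun n hn x hx => h3 n x (h1 n ?_)⟩
  exact ⟨⟨x, hω.le hx⟩, K.subset hn (hm (subset_closure hx)), rfl⟩

end

section

/-! ### Representatives of distributions -/

variable {q p : ℝ≥0∞} [Fact (1 ≤ q)] [Fact (1 ≤ p)]

variable (q p) in
/-- The net `f` represents the distribution `T`: wherever a cutoff function `χ` is `1`, it agrees
with `χT * φ_ε` up to a negligible net. -/
def IsRep {Ω : Opens (E d)} (φ : 𝓢(E d, ℂ)) (T : Distr Ω) (f : Net d) : Prop :=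
  ∀ (χ : 𝓓(Ω, ℂ)) (ω : Opens (E d)), (∀ x ∈ ω, χ x = 1) →
    f - mollify φ (mulTempered χ T) ∈ negligible q p ω

namespace IsRep

variable {Ω ω : Opens (E d)} {φ : 𝓢(E d, ℂ)} {T : Distr Ω} {f g : Net d}

lemma mem_moderate (hf : IsRep q p φ T f) : f ∈ moderate q p Ω := by
  refine mem_moderate_of_local fun ω hω => ?_
  obtain ⟨χ, U, h1, -, h2⟩ := exists_cutoff hω.1 hω.2
  have := add_mem (negligible_le_moderate (hf χ ω fun x hx => h2 x (h1 (subset_closure hx))))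
    (mollify_mem_moderate χ T φ ω)
  simpa using this

lemma sub_mem (hf : IsRep q p φ T f) (hg : IsRep q p φ T g) : f - g ∈ negligible q p Ω := by
  refine mem_negligible_of_local fun ω hω => ?_
  obtain ⟨χ, U, h1, -, h2⟩ := exists_cutoff hω.1 hω.2
  have h3 : ∀ x ∈ ω, χ x = 1 := fun x hx => h2 x (h1 (subset_closure hx))
  simpa using _root_.sub_mem (hf χ ω h3) (hg χ ω h3)

lemma of_sub_mem (hf : IsRep q p φ T f) (h : g - f ∈ negligible q p Ω) : IsRep q p φ T g := by
  intro χ ω hχ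
  -- Points where χ = 1 lie in the support of χ, hence in Ω.
  have hω : ω ≤ Ω := fun x hx => χ.tsupport_subset (subset_tsupport _ (by simp [hχ x hx]))
  simpa using add_mem (negligible_mono hω h) (hf χ ω hχ)

lemma restrict (hf : IsRep q p φ T f) (h : ω ≤ Ω) : IsRep q p φ (restrictDistr ω T) f := by
  intro χ ω' hχ
  have h1 : ⇑(TestFunction.monoCLM ℂ χ : 𝓓(Ω, ℂ)) = χ := by
    rw [TestFunction.monoCLM_apply]; simp [h]
  have h2 : mulTempered χ (restrictDistr ω T) =
      mulTempered (TestFunction.monoCLM ℂ χ : 𝓓(Ω, ℂ)) T := by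
    ext g
    simp only [mulTempered_apply, restrictDistr, ContinuousLinearMap.comp_apply]
    congr 1
    ext x
    rw [TestFunction.monoCLM_apply]
    simp [h, mulTest, h1]
  rw [h2]
  exact hf _ ω' fun x hx => by rw [h1]; exact hχ x hx

end IsRep

/-- Cutting χT off by χ' amounts to cutting T off by χχ', and χ - χχ' vanishes where χ' = 1. -/
lemma isRep_mollify {Ω : Opens (E d)} (φ : 𝓢(E d, ℂ)) (T : Distr Ω) (χ : 𝓓(Ω, ℂ)) :
    IsRep q p φ (mulDistr χ T) (mollify φ (mulTempered χ T)) := by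
  intro χ' ω hχ'
  have h : mulTempered χ' (mulDistr χ T) = mulTempered (mulTest χ χ' χ'.contDiff) T := by
    ext g
    simp only [mulTempered_apply, mulDistr_apply]
    congr 1
    ext x
    simp [mulTest, mul_assoc]
  rw [h, mollify_sub]
  refine mollify_mem_negligible _ T φ fun x hx => ?_
  simp [mulTest, hχ' x hx]

/-! ### The embedding -/

/-- Differences of consecutive cutoffs of an exhaustion: their partial sums telescope to a single
cutoff, which is eventually 1 on each ω ⋐ Ω. -/
lemma exists_partition (Ω : Opens (E d)) : ∃ η c : ℕ → 𝓓(Ω, ℂ),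
    (∀ n, ∃ U : Opens (E d), tsupport (η n) ⊆ U ∧ ∀ x ∈ U, c n x = 1) ∧
    ∀ ω : Opens (E d), CompactlyIn ω Ω → ∃ m, (∀ n ≥ m, ∀ x ∈ ω, η n x = 0) ∧
      ∀ x ∈ ω, ∑ n ∈ Finset.range m, η n x = 1 := by
  obtain ⟨a, ha⟩ := exists_cutoff_seq Ω
  let η : ℕ → 𝓓(Ω, ℂ) := fun n => Nat.rec (a 0) (fun n _ => a (n + 1) - a n) n
  choose c U hU _ hc using fun n => exists_cutoff (η n).hasCompactSupport (η n).tsupport_subset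
  refine ⟨η, c, fun n => ⟨U n, hU n, hc n⟩, fun ω hω => ?_⟩
  obtain ⟨m, hm⟩ := ha ω hω
  have hsum : ∀ n x, ∑ i ∈ Finset.range (n + 1), η i x = a n x := by
    intro n x
    induction n with
    | zero => simp [η]
    | succ n ih => rw [Finset.sum_range_succ, ih]; simp [η]
  refine ⟨m + 1, fun n hn x hx => ?_, fun x hx => by rw [hsum, hm m le_rfl x hx]⟩
  obtain ⟨n, rfl⟩ := Nat.exists_eq_succ_of_ne_zero (show n ≠ 0 by omega)
  change a (n + 1) x - a n x = 0
  rw [hm _ (by omega) x hx, hm _ (by omega) x hx, sub_self]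

/-- The net Σ η_n (c_n T * φ_ε) is linear in T because the cutoffs are fixed in advance. Where χ = 1
it differs from χT * φ_ε, locally, by the finite sum of the η_n ((c_n - χ)T * φ_ε), each negligible
because c_n - χ vanishes near the support of η_n. -/
lemma exists_linear_rep (φ : 𝓢(E d, ℂ)) (Ω : Opens (E d)) :
    ∃ F : Distr Ω →ₗ[ℂ] Net d, ∀ T, IsRep q p φ T (F T) := by
  obtain ⟨η, c, hc, hη⟩ := exists_partition Ω
  have hfin : ∀ x, {n | η n x ≠ 0}.Finite := by
    intro x
    by_cases hx : x ∈ Ω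
    · obtain ⟨ω, hxω, hω⟩ := exists_compactlyIn_mem hx
      obtain ⟨m, hm, -⟩ := hη ω hω
      refine (Finset.range m).finite_toSet.subset fun n hn => ?_
      by_contra hnm
      exact hn (hm n (by simpa using hnm) x hxω)
    · refine Set.Finite.subset Set.finite_empty fun n hn => hx ?_
      exact (η n).tsupport_subset (subset_tsupport _ hn)
  have hsupp : ∀ (x : E d) (h : ℕ → ℂ), (Function.support fun n => η n x * h n).Finite :=
    fun x h => (hfin x).subset fun n hn => left_ne_zero_of_mul hn
  refine ⟨{ toFun := fun T ε x => ∑ᶠ n, η n x * mollify φ (mulTempered (c n) T) ε x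
            map_add' := fun T T' => ?_
            map_smul' := fun a T => ?_ }, fun T χ ω hχ => ?_⟩
  · funext ε x
    simp only [Pi.add_apply]
    rw [← finsum_add_distrib (hsupp x _) (hsupp x _)]
    refine finsum_congr fun n => ?_
    simp only [mollify, conv, mulTempered_apply, add_apply]
    ring
  · funext ε x
    simp only [Pi.smul_apply, RingHom.id_apply]
    rw [smul_finsum' _ (hsupp x _)]
    refine finsum_congr fun n => ?_
    simp only [mollify, conv, mulTempered_apply, smul_apply, smul_eq_mul]
    ring
  · refine mem_negligible_of_local fun ω' hω' => ?_
    have hω : ω ≤ Ω := fun x hx => χ.tsupport_subset (subset_tsupport _ (by simp [hχ x hx]))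
    obtain ⟨m, hm0, hm1⟩ := hη ω' (hω'.mono hω)
    refine negligible_congr (f := ∑ n ∈ Finset.range m, fun ε x =>
      η n x * mollify φ (mulTempered (c n - χ) T) ε x) (sum_mem fun n _ => ?_) fun ε _ x hx => ?_
    · obtain ⟨U, hU, hcU⟩ := hc n
      refine mul_mollify_mem_negligible _ T φ (η n).contDiff (U := U ⊓ ω)
        (fun x hx => ⟨hU hx.2, hω'.le hx.1⟩) fun x hx => ?_
      change c n x - χ x = 0
      rw [hcU x hx.1, hχ x hx.2, sub_self]
    · simp only [Finset.sum_apply, ← mollify_sub, Pi.sub_apply, mul_sub, Finset.sum_sub_distrib,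
        ← Finset.sum_mul, hm1 x hx, one_mul]
      congr 1
      symm
      refine finsum_eq_sum_of_support_subset _ fun n hn => ?_
      by_contra hnm
      exact hn (by simp [hm0 n (by simpa using hnm) x hx])

/-- A linear choice of representatives of distributions. -/
def rep (q p : ℝ≥0∞) [Fact (1 ≤ q)] [Fact (1 ≤ p)] (φ : 𝓢(E d, ℂ)) (Ω : Opens (E d)) :
    Distr Ω →ₗ[ℂ] Net d :=
  (exists_linear_rep (q := q) (p := p) φ Ω).choose

lemma isRep_rep (φ : 𝓢(E d, ℂ)) {Ω : Opens (E d)} (T : Distr Ω) :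
    IsRep q p φ T (rep q p φ Ω T) :=
  (exists_linear_rep φ Ω).choose_spec T

/-- The embedding of distributions into generalized functions. -/
def embed (q p : ℝ≥0∞) [Fact (1 ≤ q)] [Fact (1 ≤ p)] (φ : 𝓢(E d, ℂ)) (Ω : Opens (E d)) :
    Distr Ω →ₗ[ℂ] GenFun q p Ω :=
  (Submodule.mkQ _).comp ((rep q p φ Ω).codRestrict _ fun T => (isRep_rep φ T).mem_moderate)

lemma embed_apply (φ : 𝓢(E d, ℂ)) {Ω : Opens (E d)} (T : Distr Ω) :
    embed q p φ Ω T = GenFun.mk (rep q p φ Ω T) (isRep_rep φ T).mem_moderate := rfl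

/-- Removes the dependence on the partition chosen in `rep`: the class is determined by the
intrinsic property `IsRep`. -/
lemma embed_eq_mk_iff {φ : 𝓢(E d, ℂ)} {Ω : Opens (E d)} {T : Distr Ω} {f : Net d}
    (hf : f ∈ moderate q p Ω) : embed q p φ Ω T = GenFun.mk f hf ↔ IsRep q p φ T f := by
  rw [embed_apply, GenFun.mk_eq_mk_iff]
  refine ⟨fun h => (isRep_rep φ T).of_sub_mem ?_, fun h => (isRep_rep φ T).sub_mem h⟩
  rw [← neg_mem_iff, neg_sub]
  exact h

/-! ### Uniqueness -/

lemma restrictDistr_mulDistr {Ω ω : Opens (E d)} (T : Distr Ω) {χ : 𝓓(Ω, ℂ)}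
    (hχ : ∀ x ∈ ω, χ x = 1) : restrictDistr ω (mulDistr χ T) = restrictDistr ω T := by
  have hω : ω ≤ Ω := fun x hx => χ.tsupport_subset (subset_tsupport _ (by simp [hχ x hx]))
  ext g
  simp only [restrictDistr, ContinuousLinearMap.comp_apply, mulDistr_apply]
  congr 1
  ext x
  simp only [mulTest, TestFunction.monoCLM_apply, TestFunction.coe_mk, hω, le_refl, and_self,
    if_true]
  by_cases hx : x ∈ ω
  · rw [hχ x hx, one_mul]
  · have : g x = 0 := by
      by_contra h
      exact hx (g.tsupport_subset (subset_tsupport _ h))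
    rw [this, mul_zero]

lemma GenFun.exists_rep {Ω : Opens (E d)} (g : GenFun q p Ω) :
    ∃ (f : Net d) (hf : f ∈ moderate q p Ω), g = GenFun.mk f hf := by
  obtain ⟨⟨f, hf⟩, rfl⟩ := Submodule.Quotient.mk_surjective _ g
  exact ⟨f, hf, rfl⟩

/-- On a set ω where χ = 1, T and χT have the same restriction, so the restriction of ι(T) to ω is
that of the prescribed class of χT * φ_ε. Any representative of ι(T) thus satisfies `IsRep`. -/
lemma IsCanonicalEmbedding.eq_embed {φ : 𝓢(E d, ℂ)}
    {ι : ∀ Ω : Opens (E d), Distr Ω →ₗ[ℂ] GenFun q p Ω} (hι : IsCanonicalEmbedding φ ι) :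
    ι = embed q p φ := by
  funext Ω
  ext T
  obtain ⟨f, hf, he⟩ := GenFun.exists_rep (ι Ω T)
  rw [he, eq_comm, embed_eq_mk_iff]
  intro χ ω hχ
  have hω : ω ≤ Ω := fun x hx => χ.tsupport_subset (subset_tsupport _ (by simp [hχ x hx]))
  obtain ⟨h1, h2⟩ := hι.compact Ω T χ
  have h3 := hι.restrict hω (mulDistr χ T)
  rw [restrictDistr_mulDistr T hχ, hι.restrict hω T, he, h2, GenFun.restrict_mk,
    GenFun.restrict_mk, GenFun.mk_eq_mk_iff] at h3
  exact h3

end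

section

/-! ### Injectivity of the embedding -/

lemma integral_fourier_mul_eq_of_integrable {f g : E d → ℂ} (hf : Integrable f)
    (hg : Integrable g) : ∫ x, 𝓕 f x * g x = ∫ ξ, f ξ * 𝓕 g ξ := by
  have := VectorFourier.integral_fourierIntegral_smul_eq_flip (L := innerₗ (E d))
    Real.continuous_fourierChar continuous_inner hf hg
  simpa using! this

lemma IsDensity.integral_conv_dilate_mul {S : 𝓢'(E d, ℂ)} {M : ℕ} {b : E d → ℂ}
    (hb : IsDensity S M b) (φ g : 𝓢(E d, ℂ)) {ε : ℝ} (hε : 0 < ε) :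
    ∫ x, conv S (dilate φ ε) x * g x = ∫ ξ, b ξ * (𝓕 φ (-(ε • ξ)) * 𝓕 g ξ) := by
  rw [hb.conv_eq, integral_fourier_mul_eq_of_integrable (hb.integrable_fourier _) g.integrable]
  refine integral_congr_ae (.of_forall fun ξ => ?_)
  simp only [fourier_dilate φ hε, SchwartzMap.fourier_coe, smul_neg]
  ring

/-- On the Fourier side the mollifier is the bounded factor 𝓕 φ (-εξ), which tends to 𝓕 φ 0 = ∫ φ =
1; dominated convergence applies. -/
lemma IsDensity.tendsto_integral_conv_mul {S : 𝓢'(E d, ℂ)} {M : ℕ} {b : E d → ℂ}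
    (hb : IsDensity S M b) {φ : 𝓢(E d, ℂ)} (hφ : ∫ x, φ x = 1) (g : 𝓢(E d, ℂ)) :
    Filter.Tendsto (fun ε => ∫ x, conv S (dilate φ ε) x * g x) (nhdsWithin 0 (Ioi 0))
      (nhds (S g)) := by
  have h1 : Filter.Tendsto (fun ε : ℝ => ∫ ξ, b ξ * (𝓕 φ (-(ε • ξ)) * 𝓕 g ξ))
      (nhdsWithin 0 (Ioi 0)) (nhds (S g)) := by
    rw [hb.apply_eq]
    obtain ⟨C, hC, hφC⟩ := exists_norm_le_decay (𝓕 φ) 0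
    obtain ⟨D, hD, hgD⟩ := exists_norm_le_decay (𝓕 g) M
    refine tendsto_integral_filter_of_dominated_convergence
      (fun ξ => (C * D) * (decay M ξ * ‖b ξ‖)) (.of_forall fun ε => ?_)
      (.of_forall fun ε => .of_forall fun ξ => ?_) (hb.integrable.const_mul _)
      (.of_forall fun ξ => ?_)
    · exact hb.aestronglyMeasurable_mul (by fun_prop)
    · rw [norm_mul, norm_mul]
      have := (hφC (-(ε • ξ))).trans (mul_le_of_le_one_right hC (decay_le_one _ _))
      calc _ ≤ ‖b ξ‖ * (C * (D * decay M ξ)) := by gcongr; exact hgD ξ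
        _ = _ := by ring
    · have h0 : 𝓕 φ 0 = 1 := by
        rw [SchwartzMap.fourier_coe, Real.fourier_eq]
        simpa using hφ
      have : Filter.Tendsto (fun ε : ℝ => b ξ * (𝓕 φ (-(ε • ξ)) * 𝓕 g ξ)) (nhds 0)
          (nhds (b ξ * (𝓕 φ (-((0 : ℝ) • ξ)) * 𝓕 g ξ))) := by
        have : Continuous fun ε : ℝ => b ξ * (𝓕 φ (-(ε • ξ)) * 𝓕 g ξ) := by fun_prop
        exact this.tendsto 0
      rw [zero_smul, neg_zero, h0, one_mul] at this
      exact this.mono_left nhdsWithin_le_nhds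
  refine h1.congr' ?_
  filter_upwards [self_mem_nhdsWithin] with ε hε
  exact (hb.integral_conv_dilate_mul φ g hε).symm

/-- A function with finite weighted norms cannot stay away from zero near `0`. -/
lemma exists_lt_of_wNorm_lt_top {q : ℝ≥0∞} (hq : 1 ≤ q) {N : ℝ → ℝ≥0∞}
    (hN : ∀ s, wNorm q s N < ∞) {δ : ℝ} (hδ : 0 < δ) {c : ℝ≥0∞} (hc : c ≠ 0) :
    ∃ ε ∈ Ioo (0 : ℝ) 1, ε < δ ∧ N ε < c := by
  by_contra! hcon
  set t := min δ 1
  have ht : 0 < t := lt_min hδ one_pos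
  have hcon' : ∀ ε ∈ Ioo 0 t, c ≤ N ε := fun ε hε =>
    hcon ε ⟨hε.1, hε.2.trans_le (min_le_right _ _)⟩ (hε.2.trans_le (min_le_left _ _))
  -- For q = ∞ the weight ε^{-1} is unbounded near 0. For q < ∞ the weight ε^0 suffices, since dε/ε
  -- has infinite mass near 0.
  by_cases hqt : q = ∞
  · have h1 := hN (-1)
    rw [wNorm, if_pos hqt] at h1
    refine h1.ne (ENNReal.eq_top_of_forall_nnreal_le fun r => ?_)
    have h2 : Filter.Tendsto (fun ε : ℝ => ENNReal.ofReal (ε ^ (-1 : ℝ)) * c)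
        (nhdsWithin 0 (Ioi 0)) (nhds ∞) := by
      have : Filter.Tendsto (fun ε : ℝ => ENNReal.ofReal (ε ^ (-1 : ℝ)))
          (nhdsWithin 0 (Ioi 0)) (nhds ∞) := by
        refine ENNReal.tendsto_ofReal_atTop.comp ?_
        simpa [Real.rpow_neg_one] using tendsto_inv_nhdsGT_zero (𝕜 := ℝ)
      have := ENNReal.Tendsto.mul_const (b := c) this (Or.inl (by simp))
      rwa [ENNReal.top_mul hc] at this
    obtain ⟨ε, hε, hε'⟩ := ((h2.eventually (lt_mem_nhds (ENNReal.coe_lt_top (r := r)))).and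
      (Ioo_mem_nhdsGT ht)).exists
    refine hε.le.trans ((mul_le_mul_right (hcon' ε hε') _).trans ?_)
    exact le_iSup₂ (f := fun ε (_ : ε ∈ Ioo (0 : ℝ) 1) => ENNReal.ofReal (ε ^ (-1 : ℝ)) * N ε) ε
      ⟨hε'.1, hε'.2.trans_le (min_le_right _ _)⟩
  · have h1 := hN 0
    have hq1 : 1 ≤ q.toReal := by simpa using ENNReal.toReal_mono hqt hq
    rw [wNorm, if_neg hqt, ENNReal.rpow_lt_top_iff_of_pos (by positivity)] at h1
    have h2 : c ^ q.toReal * ∫⁻ ε in Ioo 0 t, ENNReal.ofReal ε⁻¹ < ∞ := by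
      refine lt_of_le_of_lt ?_ h1
      rw [← lintegral_const_mul _ (by fun_prop)]
      refine le_trans ?_ (lintegral_mono_set
        (Ioo_subset_Ioo_right (min_le_right δ 1) : Ioo 0 t ⊆ Ioo 0 1))
      refine setLIntegral_mono' measurableSet_Ioo fun ε hε => ?_
      simp only [zero_mul, Real.rpow_zero, ENNReal.ofReal_one, one_mul]
      gcongr
      exact hcon' ε hε
    have hc' : c ^ q.toReal ≠ 0 := by simp [hc, (zero_lt_one.trans_le hq1).le]
    have h3 : ∫⁻ ε in Ioo 0 t, ENNReal.ofReal ε⁻¹ < ∞ :=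
      lt_top_iff_ne_top.2 fun h => by rw [h, ENNReal.mul_top hc'] at h2; exact h2.ne rfl
    have h4 : IntegrableOn (fun x : ℝ => x⁻¹) (Ioo 0 t) := by
      refine ⟨measurable_inv.aestronglyMeasurable, ?_⟩
      rw [hasFiniteIntegral_iff_ofReal]
      · exact h3
      · exact (ae_restrict_iff' measurableSet_Ioo).2
          (.of_forall fun ε hε => inv_nonneg.2 hε.1.le)
    rw [← intervalIntegrable_iff_integrableOn_Ioo_of_le ht.le, intervalIntegrable_inv_iff] at h4
    rcases h4 with h4 | h4
    · exact ht.ne h4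
    · exact h4 left_mem_uIcc

variable {q p : ℝ≥0∞} [Fact (1 ≤ q)] [Fact (1 ≤ p)]

/-- If T g ≠ 0, weak convergence keeps the integrals of χT * φ_ε against g above |T g|/2 for small
ε. Hölder on a relatively compact neighbourhood of the support of g bounds them by the L^p norm of a
negligible net, which is too small for some such ε. -/
lemma IsRep.eq_zero {Ω : Opens (E d)} {φ : 𝓢(E d, ℂ)} (hφ : ∫ x, φ x = 1) {T : Distr Ω}
    {f : Net d} (hf : IsRep q p φ T f) (hf0 : f ∈ negligible q p Ω) : T = 0 := by
  ext g
  obtain ⟨χ, U, h1, hUΩ, h2⟩ := exists_cutoff g.hasCompactSupport g.tsupport_subset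
  have hm : mollify φ (mulTempered χ T) ∈ negligible q p U := by
    simpa using _root_.sub_mem (negligible_mono hUΩ hf0) (hf χ U h2)
  obtain ⟨K, hK, hgK, hKU⟩ := exists_compact_between g.hasCompactSupport U.isOpen h1
  let ω : Opens (E d) := ⟨interior K, isOpen_interior⟩
  have h3 : closure (interior K) ⊆ K := closure_minimal interior_subset hK.isClosed
  have hω : CompactlyIn ω U := ⟨hK.of_isClosed_subset isClosed_closure h3, h3.trans hKU⟩
  let G : 𝓢(E d, ℂ) := g.hasCompactSupport.toSchwartzMap g.contDiff
  have hGg : ∀ x, G x = g x := fun x => rfl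
  obtain ⟨M, b, hb⟩ := exists_isDensity χ T
  have hlim := hb.tendsto_integral_conv_mul hφ G
  have hTG : mulTempered χ T G = T g := by
    rw [mulTempered_apply]
    congr 1
    ext x
    by_cases hx : x ∈ tsupport g
    · simp [mulTest, hGg, h2 x (h1 hx)]
    · simp [mulTest, hGg, image_eq_zero_of_notMem_tsupport hx]
  rw [hTG] at hlim
  obtain ⟨A, hA⟩ := g.hasCompactSupport.exists_bound_of_continuous g.continuous
  set V : ℝ≥0∞ := (volume.restrict (ω : Set (E d))) univ ^ (1 / (1 : ℝ≥0∞).toReal - 1 / p.toReal)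
  have hVol : volume (ω : Set (E d)) < ∞ :=
    (measure_mono (subset_closure.trans h3)).trans_lt hK.measure_lt_top
  have hp1 : (1 : ℝ≥0∞) ≤ p := Fact.out
  have hV : V ≠ ∞ := by
    refine ENNReal.rpow_ne_top_of_nonneg ?_ (by rw [Measure.restrict_apply_univ]; exact hVol.ne)
    rcases eq_or_ne p ∞ with rfl | hp
    · simp
    · have : 1 ≤ p.toReal := by simpa using ENNReal.toReal_mono hp hp1
      simp only [ENNReal.toReal_one, div_one, one_div, sub_nonneg]
      exact inv_le_one_of_one_le₀ this
  have hbd : ∀ ε, ‖∫ x, conv (mulTempered χ T) (dilate φ ε) x * G x‖ₑ ≤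
      ENNReal.ofReal A * V * sobolevNorm 0 p ω (mollify φ (mulTempered χ T) ε) := by
    intro ε
    have hcont : Continuous (mollify φ (mulTempered χ T) ε) :=
      (contDiff_conv_mulTempered χ T _).continuous
    have e1 : ∫ x, conv (mulTempered χ T) (dilate φ ε) x * G x =
        ∫ x in ω, conv (mulTempered χ T) (dilate φ ε) x * G x := by
      refine (setIntegral_eq_integral_of_forall_compl_eq_zero fun x hx => ?_).symm
      rw [hGg, image_eq_zero_of_notMem_tsupport (fun h => hx (hgK h)), mul_zero]
    rw [e1]
    refine (enorm_integral_le_lintegral_enorm _).trans ?_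
    calc _ ≤ ∫⁻ x in ω, ENNReal.ofReal A * ‖mollify φ (mulTempered χ T) ε x‖ₑ := by
          refine lintegral_mono fun x => ?_
          rw [enorm_mul, mul_comm]
          refine mul_le_mul' ?_ le_rfl
          rw [← ofReal_norm]
          exact ENNReal.ofReal_le_ofReal (hA x)
      _ = ENNReal.ofReal A * eLpNorm (mollify φ (mulTempered χ T) ε) 1 (volume.restrict ω) := by
          rw [lintegral_const_mul _ hcont.enorm.measurable, eLpNorm_one_eq_lintegral_enorm]
      _ ≤ ENNReal.ofReal A * (eLpNorm (mollify φ (mulTempered χ T) ε) p (volume.restrict ω) * V) := by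
          gcongr
          exact eLpNorm_le_eLpNorm_mul_rpow_measure_univ hp1 hcont.aestronglyMeasurable
      _ = ENNReal.ofReal A * V *
            eLpNorm (mollify φ (mulTempered χ T) ε) p (volume.restrict ω) := by ring
      _ ≤ _ := by
          gcongr
          refine le_iSup_of_le 0 (le_iSup_of_le le_rfl (le_iSup_of_le Fin.elim0 (le_of_eq ?_)))
          congr 1
  by_contra hne
  have hne : T g ≠ 0 := hne
  have hev : ∀ᶠ ε in nhdsWithin (0 : ℝ) (Ioi 0), ‖T g‖ₑ / 2 <
      ‖∫ x, conv (mulTempered χ T) (dilate φ ε) x * G x‖ₑ :=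
    hlim.enorm.eventually (lt_mem_nhds (ENNReal.half_lt_self (by simpa using hne) enorm_ne_top))
  obtain ⟨δ, hδ, hδ'⟩ := mem_nhdsGT_iff_exists_Ioo_subset.1 hev
  have hδ0 : 0 < δ := hδ
  have hB : ENNReal.ofReal A * V ≠ ∞ := ENNReal.mul_ne_top ENNReal.ofReal_ne_top hV
  obtain ⟨ε, hε, hεδ, hlt⟩ := exists_lt_of_wNorm_lt_top (Fact.out : 1 ≤ q) (hm.2 0 ω hω) hδ0
    (c := ‖T g‖ₑ / 2 / (ENNReal.ofReal A * V)) (ENNReal.div_pos (by simpa using hne) hB).ne'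
  have := hδ' ⟨hε.1, hεδ⟩
  refine absurd (lt_of_lt_of_le this (hbd ε)) (not_lt.2 ?_)
  rw [mul_comm]
  exact ENNReal.mul_le_of_le_div hlt.le

lemma isCanonicalEmbedding_embed {φ : 𝓢(E d, ℂ)} (hφ : ∫ x, φ x = 1) :
    IsCanonicalEmbedding φ (embed q p φ) where
  injective Ω := by
    rw [injective_iff_map_eq_zero]
    intro T hT
    have h0 : embed q p φ Ω T = GenFun.mk 0 (zero_mem _) := hT
    rw [embed_eq_mk_iff] at h0
    exact h0.eq_zero hφ (zero_mem _)
  restrict h T := by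
    rw [embed_apply φ T, GenFun.restrict_mk, embed_eq_mk_iff]
    exact (isRep_rep φ T).restrict h
  compact Ω T χ := ⟨mollify_mem_moderate χ T φ Ω, by
    exact (embed_eq_mk_iff (mollify_mem_moderate χ T φ Ω)).2 (isRep_mollify φ T χ)⟩

end

section

/-! ### Vanishing moments -/

/-- All moments of `θ` of order less than `N` vanish. -/
def VanishingMoments (θ : 𝓢(E d, ℂ)) (N : ℕ) : Prop :=
  ∀ j < N, ∀ f : Fin j → Fin d, ∫ u : E d, ((∏ i, u (f i) : ℝ) : ℂ) * θ u = 0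

lemma integrable_one_add_pow_mul (θ : 𝓢(E d, ℂ)) (P : ℕ) :
    Integrable (fun u => (1 + ‖u‖) ^ P * ‖θ u‖) := by
  obtain ⟨D, hD, hg⟩ := exists_norm_le_decay θ ((d + 1) + P)
  refine (integrable_decay.const_mul D).mono'
    (Continuous.aestronglyMeasurable (by fun_prop)) (.of_forall fun ξ => ?_)
  rw [Real.norm_of_nonneg (by positivity)]
  calc (1 + ‖ξ‖) ^ P * ‖θ ξ‖ ≤ (1 + ‖ξ‖) ^ P * (D * decay (d + 1 + P) ξ) := by
        gcongr; exact hg ξ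
    _ = D * decay (d + 1) ξ := by rw [decay_add]; simp only [decay]; field_simp

lemma integrable_multilinear_mul {j : ℕ} (A : ContinuousMultilinearMap ℝ (fun _ : Fin j => E d) ℂ)
    (θ : 𝓢(E d, ℂ)) : Integrable (fun u => A (fun _ => u) * θ u) := by
  refine ((integrable_one_add_pow_mul θ j).const_mul ‖A‖).mono'
    (Continuous.aestronglyMeasurable (by fun_prop)) (.of_forall fun u => ?_)
  rw [norm_mul, ← mul_assoc]
  gcongr
  refine (A.le_opNorm _).trans ?_
  simp only [Finset.prod_const, Finset.card_univ, Fintype.card_fin]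
  gcongr
  linarith

/-- In coordinates u ↦ A(u, …, u) is a combination of monomials of degree j; this is the form in
which Taylor polynomials are annihilated. -/
lemma VanishingMoments.integral_multilinear {θ : 𝓢(E d, ℂ)} {N j : ℕ} (h : VanishingMoments θ N)
    (hj : j < N) (A : ContinuousMultilinearMap ℝ (fun _ : Fin j => E d) ℂ) :
    ∫ u, A (fun _ => u) * θ u = 0 := by
  have h1 : ∀ f : Fin j → Fin d, Integrable fun u : E d => ((∏ i, u (f i) : ℝ) : ℂ) * θ u := by
    intro f
    refine (integrable_one_add_pow_mul θ j).mono'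
      (Continuous.aestronglyMeasurable (by fun_prop)) (.of_forall fun u => ?_)
    rw [norm_mul, Complex.norm_real, Real.norm_eq_abs, Finset.abs_prod]
    gcongr
    calc ∏ i, |u (f i)| ≤ ∏ _i : Fin j, (1 + ‖u‖) :=
          Finset.prod_le_prod (fun _ _ => abs_nonneg _) fun i _ =>
            (abs_apply_le_norm u (f i)).trans (by linarith)
      _ = _ := by simp
  have h2 : ∀ u : E d, A (fun _ => u) * θ u = ∑ f : Fin j → Fin d,
      A (fun i => EuclideanSpace.single (f i) 1) * (((∏ i, u (f i) : ℝ) : ℂ) * θ u) := by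
    intro u
    rw [multilinear_apply_eq_sum, Finset.sum_mul]
    refine Finset.sum_congr rfl fun f _ => ?_
    rw [Complex.real_smul]
    ring
  simp only [h2]
  rw [integral_finsetSum _ fun f _ => (h1 f).const_mul _]
  refine Finset.sum_eq_zero fun f _ => ?_
  rw [integral_const_mul, h j hj f, mul_zero]

/-- The derivatives of the Fourier transform at 0 are the moments, up to a nonzero power of 2πi and
sign. -/
lemma VanishingMoments.of_iteratedFDeriv {θ : 𝓢(E d, ℂ)} {N : ℕ}
    (h : ∀ n < N, iteratedFDeriv ℝ n ⇑(𝓕 θ : 𝓢(E d, ℂ)) 0 = 0) : VanishingMoments θ N := by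
  intro j hj f
  have h0 := h j hj
  have hi : ∀ n : ℕ, ((n : ℕ∞) ≤ (⊤ : ℕ∞)) → Integrable (fun v => ‖v‖ ^ n * ‖θ v‖) :=
    fun n _ => θ.integrable_pow_mul volume n
  have e := Real.iteratedFDeriv_fourier (N := ⊤) hi θ.continuous.aestronglyMeasurable
    (n := j) le_top
  rw [SchwartzMap.fourier_coe, e] at h0
  have h1 := congrArg (fun A : ContinuousMultilinearMap ℝ (fun _ : Fin j => E d) ℂ =>
    A (fun i => EuclideanSpace.single (f i) 1)) h0
  rw [Real.fourier_continuousMultilinearMap_apply] at h1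
  · rw [Real.fourier_eq] at h1
    simp only [inner_zero_right, neg_zero, AddChar.map_zero_eq_one, one_smul,
      VectorFourier.fourierPowSMulRight_apply, innerSL_apply_apply ℝ,
      zero_apply] at h1
    rw [integral_smul, smul_eq_zero] at h1
    rcases h1 with h1 | h1
    · exact absurd h1 (pow_ne_zero _ (by simp [Real.pi_ne_zero]))
    · rw [← h1]
      refine integral_congr_ae (.of_forall fun u => ?_)
      simp [EuclideanSpace.inner_single_right, Complex.real_smul]
  · exact VectorFourier.integrable_fourierPowSMulRight _ (hi j le_top)
      θ.continuous.aestronglyMeasurable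

lemma VanishingMoments.of_fourier_eq_zero {θ : 𝓢(E d, ℂ)} {ρ : ℝ} (hρ : 0 < ρ)
    (h : ∀ ξ, ‖ξ‖ < ρ → 𝓕 θ ξ = 0) (N : ℕ) : VanishingMoments θ N := by
  refine .of_iteratedFDeriv fun n _ => ?_
  have : ⇑(𝓕 θ : 𝓢(E d, ℂ)) =ᶠ[nhds 0] fun _ => 0 := by
    filter_upwards [Metric.ball_mem_nhds (0 : E d) hρ] with ξ hξ
    exact h ξ (by simpa using hξ)
  rw [(this.iteratedFDeriv ℝ n).eq_of_nhds]
  exact congrFun (iteratedFDeriv_fun_zero (𝕜 := ℝ) (E := E d) (F := ℂ) (n := n)) 0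

/-- In the Leibniz formula, the term with ℓ undifferentiated contains ℓ(0) = 0, and every other term
differentiates g fewer than N times. -/
lemma iteratedFDeriv_mul_eq_zero {ℓ g : E d → ℂ} (hℓ : ContDiff ℝ (⊤ : ℕ∞) ℓ)
    (hg : ContDiff ℝ (⊤ : ℕ∞) g) (h0 : ℓ 0 = 0) {N : ℕ}
    (h : ∀ n < N, iteratedFDeriv ℝ n g 0 = 0) :
    ∀ n < N + 1, iteratedFDeriv ℝ n (fun x => ℓ x * g x) 0 = 0 := by
  intro n hn
  rw [← norm_le_zero_iff]
  refine (norm_iteratedFDeriv_mul_le hℓ hg 0 (mod_cast le_top)).trans_eq ?_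
  refine Finset.sum_eq_zero fun i hi => ?_
  rcases Nat.eq_zero_or_pos i with rfl | hi0
  · simp [h0]
  · rw [h (n - i) (by have := Finset.mem_range.1 hi; omega)]
    simp

/-- The Fourier transform of an m-fold derivative contains m linear factors, and each raises the
order of vanishing at 0 by one. -/
lemma vanishingMoments_iteratedLineDerivOp {m : ℕ} (v : Fin m → E d) (φ : 𝓢(E d, ℂ)) :
    VanishingMoments (LineDeriv.iteratedLineDerivOp v φ) m := by
  refine .of_iteratedFDeriv ?_
  have key : ∀ (m : ℕ) (v : Fin m → E d), ∀ n < m, iteratedFDeriv ℝ n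
      (fun ξ : E d => (∏ i, ((inner ℝ ξ (v i) : ℝ) : ℂ)) *
        ((2 * Real.pi * Complex.I) ^ m * 𝓕 φ ξ)) 0 = 0 := by
    intro m
    have hc : ∀ w : E d, ContDiff ℝ (⊤ : ℕ∞) fun ξ : E d => ((inner ℝ ξ w : ℝ) : ℂ) := fun w =>
      Complex.ofRealCLM.contDiff.comp (contDiff_id.inner ℝ contDiff_const)
    have hgen : ∀ (c : ℂ) (v : Fin m → E d), ∀ n < m, iteratedFDeriv ℝ n
        (fun ξ : E d => (∏ i, ((inner ℝ ξ (v i) : ℝ) : ℂ)) * (c * 𝓕 φ ξ)) 0 = 0 := by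
      intro c
      induction m with
      | zero => intro v n hn; omega
      | succ m ih =>
        intro v
        have := iteratedFDeriv_mul_eq_zero (hc (v 0)) (g := fun ξ : E d =>
          (∏ i : Fin m, ((inner ℝ ξ (v i.succ) : ℝ) : ℂ)) * (c * 𝓕 φ ξ))
          ((contDiff_prod fun i _ => hc (v i.succ)).mul
            (contDiff_const.mul ((𝓕 φ).smooth _))) (by simp) (ih (fun i => v i.succ))
        simpa only [Fin.prod_univ_succ, mul_assoc] using this
    exact hgen _
  intro n hn
  rw [← key m v n hn]
  congr 1
  funext ξ
  rw [fourier_iteratedLineDerivOp]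
  push_cast
  ring

/-- The tuple f corresponds to the multi-index counting the occurrences of each coordinate. The + 1
appears because `VanishingMoments` concerns orders strictly below N; for r < 0 the truncation gives
N = 0 and no condition. -/
lemma IsLPPair.vanishingMoments {φ₀ ψ₀ : 𝓢(E d, ℂ)} {r : ℝ} (h : IsLPPair φ₀ ψ₀ r) :
    VanishingMoments ψ₀ (⌊r⌋ + 1).toNat := by
  classical
  intro j hj f
  have hα := h.moment_eq_zero (fun l => Finset.card {i | f i = l}) (by
    have : ∑ l, Finset.card {i | f i = l} = j := by
      have := Finset.card_eq_sum_card_fiberwise (f := f) (s := Finset.univ) (t := Finset.univ)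
        (fun _ _ => Finset.mem_coe.2 (Finset.mem_univ _))
      simpa using this.symm
    rw [this]
    omega)
  rw [moment] at hα
  rw [← hα]
  refine integral_congr_ae (.of_forall fun u => ?_)
  simp only
  congr 1
  push_cast
  rw [← Finset.prod_fiberwise Finset.univ f]
  refine Finset.prod_congr rfl fun l _ => ?_
  rw [← Finset.prod_const]
  exact Finset.prod_congr rfl fun i hi => by rw [(Finset.mem_filter.1 hi).2]

/-! ### Taylor expansion against functions with vanishing moments -/

lemma norm_taylor_remainder_le {F : E d → ℂ} (hF : ContDiff ℝ (⊤ : ℕ∞) F) (N : ℕ) (x h : E d)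
    {B : ℝ} (hB : ∀ t ∈ Icc (0 : ℝ) 1, ‖iteratedFDeriv ℝ N F (x + t • h)‖ ≤ B) :
    ‖F (x + h) - ∑ k ∈ Finset.range N, ((k.factorial : ℝ)⁻¹ • iteratedFDeriv ℝ k F x fun _ => h)‖ ≤
      B * ‖h‖ ^ N := by
  cases N with
  | zero =>
    have := hB 1 (by simp)
    simpa using this
  | succ n =>
    rw [map_add_eq_sum_add_integral_iteratedFDeriv (n := n) fun t _ =>
      (hF.of_le (mod_cast le_top)).contDiffAt, add_sub_cancel_left, norm_smul]
    have h1 : ‖∫ t in (0 : ℝ)..1, (1 - t) ^ n • iteratedFDeriv ℝ (n + 1) F (x + t • h)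
        (fun _ => h)‖ ≤ (B * ‖h‖ ^ (n + 1)) * |(1 : ℝ) - 0| := by
      refine intervalIntegral.norm_integral_le_of_norm_le_const fun t ht => ?_
      rw [uIoc_of_le zero_le_one] at ht
      rw [norm_smul, Real.norm_of_nonneg (pow_nonneg (by linarith [ht.2]) _)]
      have h2 : (1 - t) ^ n ≤ 1 := pow_le_one₀ (by linarith [ht.2]) (by linarith [ht.1])
      have h3 := (iteratedFDeriv ℝ (n + 1) F (x + t • h)).le_opNorm (fun _ => h)
      simp only [Finset.prod_const, Finset.card_univ, Fintype.card_fin] at h3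
      have h4 := hB t ⟨ht.1.le, ht.2⟩
      calc _ ≤ 1 * (B * ‖h‖ ^ (n + 1)) := by gcongr; exact h3.trans (by gcongr)
        _ = _ := one_mul _
    have h5 : ‖((n.factorial : ℝ)⁻¹)‖ ≤ 1 := by
      rw [norm_inv, Real.norm_natCast]
      exact inv_le_one_of_one_le₀ (mod_cast n.factorial_pos)
    simp only [sub_zero, abs_one, mul_one] at h1
    calc _ ≤ 1 * (B * ‖h‖ ^ (n + 1)) := by gcongr
      _ = _ := one_mul _

/-- Peetre's inequality: 1 + |x| ≤ (1 + |x - u|)(1 + |u|). -/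
lemma decay_sub_le (M : ℕ) (x u : E d) : decay M (x - u) ≤ decay M x * (1 + ‖u‖) ^ M := by
  unfold decay
  rw [inv_mul_eq_div, le_div_iff₀ (by positivity), inv_mul_le_iff₀ (by positivity), ← mul_pow]
  gcongr
  have := norm_add_le (x - u) u
  rw [sub_add_cancel] at this
  nlinarith [norm_nonneg (x - u), norm_nonneg u]

/-- The weight `(1 + dist(x, K) / ε)^{-M}`. -/
def distDecay (K : Set (E d)) (M : ℕ) (ε : ℝ) (x : E d) : ℝ := ((1 + Metric.infDist x K / ε) ^ M)⁻¹

lemma distDecay_nonneg (K : Set (E d)) (M : ℕ) {ε : ℝ} (hε : 0 < ε) (x : E d) :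
    0 ≤ distDecay K M ε x := by
  have := Metric.infDist_nonneg (x := x) (s := K)
  unfold distDecay
  positivity

lemma distDecay_le_one (K : Set (E d)) (M : ℕ) {ε : ℝ} (hε : 0 < ε) (x : E d) :
    distDecay K M ε x ≤ 1 := by
  have := Metric.infDist_nonneg (x := x) (s := K)
  refine inv_le_one_of_one_le₀ (one_le_pow₀ ?_)
  have : 0 ≤ Metric.infDist x K / ε := by positivity
  linarith

lemma decay_le_distDecay {K : Set (E d)} (M : ℕ) {ε : ℝ} (hε : 0 < ε) {w : E d} (hw : w ∈ K)
    (a : E d) : decay M (ε⁻¹ • (a - w)) ≤ distDecay K M ε a := by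
  have h0 := Metric.infDist_nonneg (x := a) (s := K)
  have h1 := Metric.infDist_le_dist_of_mem (x := a) hw
  unfold decay distDecay
  gcongr
  rw [norm_smul, Real.norm_of_nonneg (by positivity), div_eq_inv_mul, ← dist_eq_norm]
  gcongr

/-- The moments of θ annihilate the Taylor polynomial of F at x, and the remainder of order N gives
y^N. Since y ≤ z, Peetre's inequality transfers the decay at scale z from the intermediate points to
x, at the price of powers of 1 + |u| absorbed by θ. The decay in the distance from x to K comes from
the support of F. -/
theorem exists_norm_integral_mul_le {θ : 𝓢(E d, ℂ)} {N : ℕ} (hθ : VanishingMoments θ N)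
    (M M' : ℕ) : ∃ C : ℝ, 0 ≤ C ∧ ∀ (F : E d → ℂ) (K : Set (E d)) (a : E d) (A y z : ℝ),
      ContDiff ℝ (⊤ : ℕ∞) F → tsupport F ⊆ K → 0 ≤ A → 0 < y → y ≤ z →
      (∀ w, ‖iteratedFDeriv ℝ N F w‖ ≤ A * decay M (z⁻¹ • (a - w))) →
      ∀ x, ‖∫ u, F (x - y • u) * θ u‖ ≤
        C * (A * y ^ N * decay M (z⁻¹ • (a - x)) * distDecay K M' y x) := by
  -- N powers come from the Taylor remainder, M from Peetre's inequality and M' from the distance to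
  -- K.
  refine ⟨∫ u, (1 + ‖u‖) ^ (N + M + M') * ‖θ u‖, integral_nonneg fun u => by positivity,
    fun F K a A y z hF hK hA hy hyz hb x => ?_⟩
  have hz : 0 < z := hy.trans_le hyz
  let Ty : ℕ → E d → ℂ := fun k u =>
    (k.factorial : ℝ)⁻¹ • iteratedFDeriv ℝ k F x fun _ => -(y • u)
  let R : E d → ℂ := fun u => F (x - y • u) - ∑ k ∈ Finset.range N, Ty k u
  set D := distDecay K M' y x
  set B := A * y ^ N * decay M (z⁻¹ • (a - x))
  have hB : 0 ≤ B := by have := decay_nonneg M (z⁻¹ • (a - x)); positivity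
  have hD : 0 ≤ D := distDecay_nonneg K M' hy x
  have hinf := Metric.infDist_nonneg (x := x) (s := K)
  have hR1 : ∀ u, ‖R u‖ ≤ B * (1 + ‖u‖) ^ (N + M) := by
    intro u
    have hrem := norm_taylor_remainder_le hF N x (-(y • u))
      (B := A * (decay M (z⁻¹ • (a - x)) * (1 + ‖u‖) ^ M)) (fun t ht => (hb _).trans ?_)
    · rw [← sub_eq_add_neg] at hrem
      refine hrem.trans ?_
      rw [norm_neg, norm_smul, Real.norm_of_nonneg hy.le, mul_pow, pow_add]
      have h0 := decay_nonneg M (z⁻¹ • (a - x))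
      calc _ = B * (‖u‖ ^ N * (1 + ‖u‖) ^ M) := by ring
        _ ≤ B * ((1 + ‖u‖) ^ N * (1 + ‖u‖) ^ M) := by gcongr; linarith
    · have e : z⁻¹ • (a - (x + t • -(y • u))) = z⁻¹ • (a - x) - (-(t * (y / z)) • u) := by
        rw [smul_neg, ← sub_eq_add_neg, neg_smul, sub_neg_eq_add, sub_sub_eq_add_sub, add_sub_right_comm,
          smul_add, smul_smul, smul_smul]
        congr 2
        field_simp
      rw [e]
      refine mul_le_mul_of_nonneg_left ((decay_sub_le _ _ _).trans ?_) hA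
      have h0 := decay_nonneg M (z⁻¹ • (a - x))
      have h1 : t * (y / z) ≤ 1 :=
        mul_le_one₀ ht.2 (by positivity) ((div_le_one hz).2 hyz)
      gcongr
      rw [norm_smul, norm_neg, Real.norm_of_nonneg (mul_nonneg ht.1 (by positivity))]
      exact mul_le_of_le_one_left (norm_nonneg _) h1
  have hR2 : ∀ u, ‖R u‖ ≤ B * D * (1 + ‖u‖) ^ (N + M + M') := by
    intro u
    -- In the first case (1 + |u|)^{M'} compensates the factor D. In the second, both x and x - yu
    -- are outside the support of F, so the remainder is zero.
    by_cases hu : Metric.infDist x K ≤ y * ‖u‖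
    · have h1 : 1 ≤ D * (1 + ‖u‖) ^ M' := by
        simp only [D, distDecay]
        rw [inv_mul_eq_div, one_le_div (by positivity)]
        gcongr
        rw [div_le_iff₀ hy]
        linarith
      calc ‖R u‖ ≤ B * (1 + ‖u‖) ^ (N + M) * 1 := by rw [mul_one]; exact hR1 u
        _ ≤ B * (1 + ‖u‖) ^ (N + M) * (D * (1 + ‖u‖) ^ M') := by gcongr
        _ = _ := by rw [pow_add _ (N + M)]; ring
    · push Not at hu
      have hx : x ∉ tsupport F := fun h => by
        rw [Metric.infDist_zero_of_mem (hK h)] at hu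
        exact absurd hu (not_lt.2 (by positivity))
      have hxu : x - y • u ∉ tsupport F := fun h => by
        have := Metric.infDist_le_dist_of_mem (x := x) (hK h)
        rw [dist_eq_norm, sub_sub_cancel, norm_smul, Real.norm_of_nonneg hy.le] at this
        linarith
      have hD0 : ∀ k, iteratedFDeriv ℝ k F x = 0 := fun k =>
        image_eq_zero_of_notMem_tsupport fun h => hx (tsupport_iteratedFDeriv_subset k h)
      have : R u = 0 := by
        simp [R, Ty, hD0, image_eq_zero_of_notMem_tsupport hxu]
      rw [this, norm_zero]
      positivity
  have hRc : Continuous R := by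
    have : Continuous F := hF.continuous
    simp only [R, Ty]
    fun_prop
  have hRi : Integrable (fun u => R u * θ u) := by
    refine ((integrable_one_add_pow_mul θ (N + M + M')).const_mul (B * D)).mono'
      (hRc.mul θ.continuous).aestronglyMeasurable (.of_forall fun u => ?_)
    rw [norm_mul, ← mul_assoc]
    gcongr
    exact hR2 u
  have hTy : ∀ k (u : E d), Ty k u =
      ((((k.factorial : ℝ)⁻¹ * (-y) ^ k : ℝ)) : ℂ) * iteratedFDeriv ℝ k F x (fun _ => u) := by
    intro k u
    simp only [Ty]
    have : (fun _ : Fin k => -(y • u)) = fun i => (fun _ => -y) i • (fun _ => u) i := by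
      funext i; simp
    rw [this, ContinuousMultilinearMap.map_smul_univ, smul_smul]
    simp
  have hTi : ∀ k, Integrable (fun u => Ty k u * θ u) := fun k => by
    simp only [hTy, mul_assoc]
    exact (integrable_multilinear_mul _ θ).const_mul _
  have hT0 : ∀ k ∈ Finset.range N, ∫ u, Ty k u * θ u = 0 := fun k hk => by
    simp only [hTy, mul_assoc]
    rw [integral_const_mul, hθ.integral_multilinear (Finset.mem_range.1 hk), mul_zero]
  have e : ∫ u, F (x - y • u) * θ u = ∫ u, R u * θ u := by
    have : ∀ u, F (x - y • u) * θ u = R u * θ u + ∑ k ∈ Finset.range N, Ty k u * θ u := by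
      intro u
      rw [← Finset.sum_mul, ← add_mul]
      simp only [R, sub_add_cancel]
    simp only [this]
    rw [integral_add hRi (integrable_finsetSum _ fun k _ => hTi k),
      integral_finsetSum _ fun k _ => hTi k, Finset.sum_eq_zero hT0, add_zero]
  rw [e]
  calc _ ≤ ∫ u, B * D * ((1 + ‖u‖) ^ (N + M + M') * ‖θ u‖) := by
        refine norm_integral_le_of_norm_le ((integrable_one_add_pow_mul θ _).const_mul _)
          (.of_forall fun u => ?_)
        rw [norm_mul, ← mul_assoc]
        gcongr
        exact hR2 u
    _ = _ := by rw [integral_const_mul]; ring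

end

section

/-! ### Kernel estimates -/

lemma integral_mul_dilate_sub (F : E d → ℂ) (θ : 𝓢(E d, ℂ)) {y : ℝ} (hy : 0 < y) (x : E d) :
    ∫ w, F w * dilate θ y (x - w) = ∫ u, F (x - y • u) * θ u := by
  rw [← integral_sub_left_eq_self _ _ x]
  have := Measure.integral_comp_inv_smul_of_nonneg (μ := (volume : Measure (E d)))
    (fun u : E d => F (x - y • u) * θ u) hy.le
  rw [finrank_euclideanSpace_fin] at this
  have h2 := congrArg (fun z : ℂ => ((y ^ d)⁻¹ : ℝ) • z) this
  simp only [smul_smul] at h2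
  rw [inv_mul_cancel₀ (by positivity), one_smul, ← integral_smul] at h2
  rw [← h2]
  refine integral_congr_ae (.of_forall fun w => ?_)
  simp only [sub_sub_cancel, dilate_apply θ hy.ne', mul_inv_cancel₀ hy.ne', one_smul,
    Complex.real_smul]
  ring

lemma contDiff_cutoff_mul {χ : E d → ℂ} (hχ : ContDiff ℝ (⊤ : ℕ∞) χ) (ψ : 𝓢(E d, ℂ)) (a : E d) :
    ContDiff ℝ (⊤ : ℕ∞) (fun w => χ w * ψ (a - w)) :=
  hχ.mul ((ψ.smooth _).comp (contDiff_const.sub contDiff_id))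

/-- The decay M + M' of ψ is split: M powers remain as decay in a - w, and M' become decay in the
distance from a to the support of χ, because w lies in that support. -/
lemma exists_norm_iteratedFDeriv_cutoff_mul_le {χ : E d → ℂ} (hχ : ContDiff ℝ (⊤ : ℕ∞) χ)
    (hχc : HasCompactSupport χ) (ψ : 𝓢(E d, ℂ)) (N M M' : ℕ) :
    ∃ C : ℝ, 0 ≤ C ∧ ∀ ε ∈ Ioc (0 : ℝ) 1, ∀ a w,
      ‖iteratedFDeriv ℝ N (fun w => χ w * dilate ψ ε (a - w)) w‖ ≤
        C * (ε ^ (d + N))⁻¹ * distDecay (tsupport χ) M' ε a * decay M (ε⁻¹ • (a - w)) := by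
  choose B hB using fun i : ℕ => (hχc.iteratedFDeriv (𝕜 := ℝ) i).exists_bound_of_continuous
    (hχ.continuous_iteratedFDeriv (m := i) (mod_cast le_top))
  choose D hD0 hD using fun i : ℕ => exists_norm_iteratedFDeriv_le_decay ψ i (M + M')
  refine ⟨∑ i ∈ Finset.range (N + 1), (N.choose i : ℝ) * |B i| * D (N - i),
    Finset.sum_nonneg fun i _ => by have := hD0 (N - i); positivity, fun ε hε a w => ?_⟩
  have hε0 := hε.1
  have hdd := distDecay_nonneg (tsupport χ) M' hε0 a
  have hdc := decay_nonneg M (ε⁻¹ • (a - w))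
  by_cases hw : w ∈ tsupport χ
  · have hs : ContDiff ℝ (⊤ : ℕ∞) fun w => dilate ψ ε (a - w) :=
      ((dilate ψ ε).smooth _).comp (contDiff_const.sub contDiff_id)
    refine (norm_iteratedFDeriv_mul_le hχ hs w (mod_cast le_top)).trans ?_
    rw [Finset.sum_mul, Finset.sum_mul, Finset.sum_mul]
    refine Finset.sum_le_sum fun i hi => ?_
    have e : (fun w => dilate ψ ε (a - w)) = reflectTranslate (dilate ψ ε) a := by
      funext w; simp
    rw [e, norm_iteratedFDeriv_reflectTranslate, norm_iteratedFDeriv_dilate _ _ hε0]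
    have h1 := hD (N - i) (ε⁻¹ • (a - w))
    rw [decay_add] at h1
    have h2 := decay_le_distDecay M' hε0 hw a
    have h3 : (ε ^ (d + (N - i)))⁻¹ ≤ (ε ^ (d + N))⁻¹ := by
      gcongr ?_⁻¹
      exact pow_le_pow_of_le_one hε0.le hε.2 (by omega)
    have h4 := hD0 (N - i)
    calc _ ≤ (N.choose i : ℝ) * |B i| * ((ε ^ (d + N))⁻¹ *
          (D (N - i) * (decay M (ε⁻¹ • (a - w)) * distDecay (tsupport χ) M' ε a))) := by
          gcongr
          · exact (hB i w).trans (le_abs_self _)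
          · exact h1.trans (by gcongr)
      _ = _ := by ring
  · have : iteratedFDeriv ℝ N (fun w => χ w * dilate ψ ε (a - w)) w = 0 :=
      image_eq_zero_of_notMem_tsupport fun h => hw
        (tsupport_mul_subset_left (tsupport_iteratedFDeriv_subset (𝕜 := ℝ) N h))
    rw [this, norm_zero]
    have : 0 ≤ ∑ i ∈ Finset.range (N + 1), (N.choose i : ℝ) * |B i| * D (N - i) :=
      Finset.sum_nonneg fun i _ => by have := hD0 (N - i); positivity
    positivity

/-- The kernel `∫ χ(w) ψ_z(v - w) θ_y(x - w) dw`. -/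
def kernel (χ : E d → ℂ) (ψ θ : 𝓢(E d, ℂ)) (z y : ℝ) (x v : E d) : ℂ :=
  ∫ w, χ w * dilate ψ z (v - w) * dilate θ y (x - w)

lemma kernel_comm (χ : E d → ℂ) (ψ θ : 𝓢(E d, ℂ)) (z y : ℝ) (x v : E d) :
    kernel χ ψ θ z y x v = kernel χ θ ψ y z v x :=
  integral_congr_ae (.of_forall fun w => by ring)

/-- Relative to θ_y the product χ ψ_z(v - ·) is smooth at the larger scale z: N derivatives cost
z^{-N}, and the N moments of θ give y^N. -/
lemma exists_norm_kernel_le_of_le {χ : E d → ℂ} (hχ : ContDiff ℝ (⊤ : ℕ∞) χ)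
    (hχc : HasCompactSupport χ) (ψ : 𝓢(E d, ℂ)) {θ : 𝓢(E d, ℂ)} {N : ℕ}
    (hθ : VanishingMoments θ N) (M M' : ℕ) :
    ∃ C : ℝ, 0 ≤ C ∧ ∀ y z : ℝ, 0 < y → y ≤ z → z ≤ 1 → ∀ x v,
      ‖kernel χ ψ θ z y x v‖ ≤ C * ((y / z) ^ N * (z ^ d)⁻¹ * decay M (z⁻¹ • (x - v)) *
        distDecay (tsupport χ) M' z v * distDecay (tsupport χ) M' y x) := by
  obtain ⟨C₁, hC₁, h₁⟩ := exists_norm_iteratedFDeriv_cutoff_mul_le hχ hχc ψ N M M'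
  obtain ⟨C₂, hC₂, h₂⟩ := exists_norm_integral_mul_le hθ M M'
  refine ⟨C₂ * C₁, by positivity, fun y z hy hyz hz x v => ?_⟩
  have hz0 := hy.trans_le hyz
  have h0 := distDecay_nonneg (tsupport χ) M' hz0 v
  rw [kernel, integral_mul_dilate_sub (fun w => χ w * dilate ψ z (v - w)) θ hy]
  refine (h₂ (fun w => χ w * dilate ψ z (v - w)) (tsupport χ) v
    (C₁ * (z ^ (d + N))⁻¹ * distDecay (tsupport χ) M' z v) y z (contDiff_cutoff_mul hχ _ v)
    tsupport_mul_subset_left (by positivity) hy hyz (h₁ z ⟨hz0, hz⟩ v) x).trans_eq ?_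
  have : decay M (z⁻¹ • (v - x)) = decay M (z⁻¹ • (x - v)) := by
    rw [← decay_neg, ← smul_neg, neg_sub]
  rw [this, div_pow, pow_add]
  field_simp

/-- The gain from cancellation at the scales `y` and `z`. -/
def scaleGain (N L : ℕ) (y z : ℝ) : ℝ := if y ≤ z then (y / z) ^ N else (z / y) ^ L

/-- The moments of the kernel at the smaller scale are used, hence the two cases. Only the distance
weight in v is kept: it localizes the means that are integrated over v. -/
lemma exists_norm_kernel_le {χ : E d → ℂ} (hχ : ContDiff ℝ (⊤ : ℕ∞) χ)
    (hχc : HasCompactSupport χ) {ψ θ : 𝓢(E d, ℂ)} {N L : ℕ}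
    (hψ : VanishingMoments ψ L) (hθ : VanishingMoments θ N) (M M' : ℕ) :
    ∃ C : ℝ, 0 ≤ C ∧ ∀ y ∈ Ioo (0 : ℝ) 1, ∀ z ∈ Ioo (0 : ℝ) 1, ∀ x v,
      ‖kernel χ ψ θ z y x v‖ ≤ C * (scaleGain N L y z * ((max y z ^ d)⁻¹ *
        decay M ((max y z)⁻¹ • (x - v))) * distDecay (tsupport χ) M' z v) := by
  obtain ⟨C₁, hC₁, h₁⟩ := exists_norm_kernel_le_of_le hχ hχc ψ hθ M M'
  obtain ⟨C₂, hC₂, h₂⟩ := exists_norm_kernel_le_of_le hχ hχc θ hψ M M'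
  refine ⟨max C₁ C₂, le_max_of_le_left hC₁, fun y hy z hz x v => ?_⟩
  have hy0 := hy.1
  have hz0 := hz.1
  have d1 := distDecay_le_one (tsupport χ) M' hy0 x
  have d2 := distDecay_nonneg (tsupport χ) M' hz0 v
  have d0 := distDecay_nonneg (tsupport χ) M' hy0 x
  have m1 := le_max_left C₁ C₂
  have m2 := le_max_right C₁ C₂
  rcases le_or_gt y z with h | h
  · have d3 := decay_nonneg M (z⁻¹ • (x - v))
    rw [scaleGain, if_pos h, max_eq_right h]
    calc _ ≤ C₁ * ((y / z) ^ N * (z ^ d)⁻¹ * decay M (z⁻¹ • (x - v)) *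
        distDecay (tsupport χ) M' z v * distDecay (tsupport χ) M' y x) :=
          h₁ y z hy.1 h hz.2.le x v
      _ ≤ max C₁ C₂ * ((y / z) ^ N * (z ^ d)⁻¹ * decay M (z⁻¹ • (x - v)) *
        distDecay (tsupport χ) M' z v * 1) := by
          gcongr
      _ = _ := by ring
  · have d3 := decay_nonneg M (y⁻¹ • (x - v))
    rw [scaleGain, if_neg (not_le.2 h), max_eq_left h.le, kernel_comm]
    have e : decay M (y⁻¹ • (v - x)) = decay M (y⁻¹ • (x - v)) := by
      rw [← decay_neg, ← smul_neg, neg_sub]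
    have := h₂ z y hz.1 h.le hy.2.le v x
    rw [e] at this
    calc _ ≤ C₂ * ((z / y) ^ L * (y ^ d)⁻¹ * decay M (y⁻¹ • (x - v)) *
        distDecay (tsupport χ) M' y x * distDecay (tsupport χ) M' z v) := this
      _ ≤ max C₁ C₂ * ((z / y) ^ L * (y ^ d)⁻¹ * decay M (y⁻¹ • (x - v)) *
        1 * distDecay (tsupport χ) M' z v) := by
          gcongr
      _ = _ := by ring

/-- A smooth compactly supported function integrates to something small against oscillating
functions. -/
lemma exists_norm_integral_mul_dilate_le {F : E d → ℂ} (hF : ContDiff ℝ (⊤ : ℕ∞) F)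
    (hFc : HasCompactSupport F) {θ : 𝓢(E d, ℂ)} {N : ℕ} (hθ : VanishingMoments θ N) (M : ℕ) :
    ∃ C : ℝ, 0 ≤ C ∧ ∀ y ∈ Ioo (0 : ℝ) 1, ∀ x,
      ‖∫ w, F w * dilate θ y (x - w)‖ ≤ C * y ^ N * decay M x := by
  obtain ⟨C₂, hC₂, h₂⟩ := exists_norm_integral_mul_le hθ M 0
  let G : 𝓢(E d, ℂ) := hFc.toSchwartzMap hF
  obtain ⟨D, hD, hG⟩ := exists_norm_iteratedFDeriv_le_decay G N M
  refine ⟨C₂ * D, by positivity, fun y hy x => ?_⟩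
  rw [integral_mul_dilate_sub _ _ hy.1]
  -- F is itself a Schwartz function, so the larger scale is 1 and the centre is 0.
  have := h₂ F (tsupport F) 0 D y 1 hF subset_rfl hD hy.1 hy.2.le (fun w => by
    simpa [decay_neg] using! hG w) x
  simp only [inv_one, one_smul, zero_sub, decay_neg, distDecay, pow_zero, mul_one] at this
  exact this.trans_eq (by ring)

end

section

/-! ### A continuous reproducing formula -/

/-- The Fourier transforms of `Λ` and of the products `ψ_i * Ψ_i` resolve the identity. -/
structure IsReproducing {ι : Type*} [Fintype ι] (ψ Ψ : ι → 𝓢(E d, ℂ)) (Λ : 𝓢(E d, ℂ)) : Prop where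
  eq_one : ∀ ξ : E d, 𝓕 Λ (-ξ) + ∫ z in Ioo (0 : ℝ) 1,
    ((z⁻¹ : ℝ) : ℂ) * ∑ i, 𝓕 (ψ i) (-(z • ξ)) * 𝓕 (Ψ i) (z • ξ) = 1
  eq_zero : ∃ ρ : ℝ, 0 < ρ ∧ ∀ i ξ, ‖ξ‖ < ρ → 𝓕 (Ψ i) ξ = 0

lemma fourier_fourier_apply (f : 𝓢(E d, ℂ)) (ξ : E d) : 𝓕 (𝓕 f) ξ = f (-ξ) := by
  have h := SchwartzMap.fourierInv_apply_eq (𝓕 f)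
  have h1 : 𝓕⁻ (𝓕 f) (-ξ) = f (-ξ) := by rw [FourierTransform.fourierInv_fourier_eq]
  rw [h] at h1
  simpa using h1

/-- Let λ be a bump equal to 1 near 0 and m its radial derivative ξ·∇λ, supported in the annulus ησ
≤ |ξ| ≤ σ. Integrating z⁻¹ m(zξ) = (d/dz) λ(zξ) over (0,1) gives λ(ξ) - 1. On the annulus D = Σ |𝓕
ψ_i|² is positive, so -m = Σ 𝓕 ψ_i Q_i with Q_i = -m conj(𝓕 ψ_i)/D smooth. -/
theorem exists_isReproducing {ι : Type*} [Fintype ι] (ψ : ι → 𝓢(E d, ℂ)) {σ η : ℝ} (hσ : 0 < σ)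
    (hη : η ∈ Ioo (0 : ℝ) 1)
    (h : ∀ ξ : E d, η * σ ≤ ‖ξ‖ → ‖ξ‖ ≤ σ → ∃ i, 𝓕 (ψ i) ξ ≠ 0) :
    ∃ (Ψ : ι → 𝓢(E d, ℂ)) (Λ : 𝓢(E d, ℂ)), IsReproducing ψ Ψ Λ := by
  let lam : ContDiffBump (0 : E d) :=
    ⟨η * σ, σ, mul_pos hη.1 hσ, mul_lt_of_lt_one_left hσ hη.2⟩
  have hlam : ContDiff ℝ (⊤ : ℕ∞) lam := lam.contDiff
  let m : E d → ℝ := fun ξ => fderiv ℝ lam ξ ξ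
  have hm : ContDiff ℝ (⊤ : ℕ∞) m := (hlam.fderiv_right (m := (⊤ : ℕ∞)) (by simp)).clm_apply contDiff_id
  have hm0 : ∀ ξ, ‖ξ‖ < η * σ → m ξ = 0 := fun ξ hξ => by
    have : (lam : E d → ℝ) =ᶠ[nhds ξ] fun _ => 1 := by
      filter_upwards [Metric.isOpen_ball.mem_nhds (show ξ ∈ Metric.ball 0 (η * σ) by simpa using hξ)]
        with x hx
      exact lam.one_of_mem_closedBall (Metric.ball_subset_closedBall hx)
    simp [m, this.fderiv_eq]
  have hm1 : ∀ ξ, σ < ‖ξ‖ → m ξ = 0 := fun ξ hξ => by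
    have : (lam : E d → ℝ) =ᶠ[nhds ξ] fun _ => 0 := by
      filter_upwards [(isOpen_lt continuous_const continuous_norm).mem_nhds hξ] with x hx
      exact lam.zero_of_le_dist (by simpa using (show σ < ‖x‖ from hx).le)
    simp [m, this.fderiv_eq]
  have hsupp : tsupport m ⊆ {ξ | η * σ ≤ ‖ξ‖} ∩ {ξ | ‖ξ‖ ≤ σ} := by
    refine closure_minimal (fun ξ hξ => ⟨?_, ?_⟩)
      ((isClosed_le continuous_const continuous_norm).inter
        (isClosed_le continuous_norm continuous_const))
    · by_contra hcon
      exact hξ (hm0 ξ (not_le.1 hcon))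
    · by_contra hcon
      exact hξ (hm1 ξ (not_le.1 hcon))
  have hmc : HasCompactSupport m := (isCompact_closedBall (0 : E d) σ).of_isClosed_subset
    (isClosed_tsupport _) fun ξ hξ => by simpa using (hsupp hξ).2
  let D : E d → ℂ := fun ξ => ∑ i, 𝓕 (ψ i) ξ * starRingEnd ℂ (𝓕 (ψ i) ξ)
  have hD : ContDiff ℝ (⊤ : ℕ∞) D := ContDiff.sum fun i _ =>
    ((𝓕 (ψ i)).smooth _).mul (Complex.conjCLE.contDiff.comp ((𝓕 (ψ i)).smooth _))
  have hD0 : ∀ ξ ∈ tsupport m, D ξ ≠ 0 := by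
    intro ξ hξ hcon
    obtain ⟨i, hi⟩ := h ξ (hsupp hξ).1 (hsupp hξ).2
    have : ∑ i, ‖𝓕 (ψ i) ξ‖ ^ 2 = 0 := by
      have h1 : ((∑ i, ‖𝓕 (ψ i) ξ‖ ^ 2 : ℝ) : ℂ) = D ξ := by
        push_cast
        exact Finset.sum_congr rfl fun i _ => (Complex.mul_conj' _).symm
      rw [hcon] at h1
      exact_mod_cast h1
    rw [Finset.sum_eq_zero_iff_of_nonneg fun _ _ => by positivity] at this
    exact hi (by simpa using this i (Finset.mem_univ _))
  let Q : ι → E d → ℂ := fun i ξ => ((m ξ : ℝ) : ℂ) * (-starRingEnd ℂ (𝓕 (ψ i) ξ) / D ξ)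
  have hQ : ∀ i, ContDiff ℝ (⊤ : ℕ∞) (Q i) := by
    intro i
    rw [contDiff_iff_contDiffAt]
    intro ξ
    by_cases hξ : ξ ∈ tsupport m
    · simp only [Q, div_eq_mul_inv]
      exact (Complex.ofRealCLM.contDiff.comp hm).contDiffAt.mul
        ((Complex.conjCLE.contDiff.comp ((𝓕 (ψ i)).smooth _)).neg.contDiffAt.mul
          (hD.contDiffAt.inv (hD0 ξ hξ)))
    · have : Q i =ᶠ[nhds ξ] fun _ => 0 := by
        filter_upwards [notMem_tsupport_iff_eventuallyEq.1 hξ] with x hx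
        simp [Q, hx]
      exact contDiffAt_const.congr_of_eventuallyEq this
  have hQc : ∀ i, HasCompactSupport (Q i) := fun i =>
    (hmc.comp_left (g := ((↑) : ℝ → ℂ)) Complex.ofReal_zero).mul_right
  have hLc : HasCompactSupport fun ξ => ((lam ξ : ℝ) : ℂ) :=
    lam.hasCompactSupport.comp_left (g := ((↑) : ℝ → ℂ)) Complex.ofReal_zero
  let L : 𝓢(E d, ℂ) := hLc.toSchwartzMap (Complex.ofRealCLM.contDiff.comp hlam)
  let q : ι → 𝓢(E d, ℂ) := fun i => (hQc i).toSchwartzMap (hQ i)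
  have hq : ∀ i ξ, 𝓕 (𝓕 (q i)) ξ = Q i (-ξ) := fun i ξ => fourier_fourier_apply _ _
  have hsum : ∀ ξ, ∑ i, 𝓕 (ψ i) ξ * Q i ξ = -((m ξ : ℝ) : ℂ) := by
    intro ξ
    by_cases hξ : ξ ∈ tsupport m
    · have : ∀ i, 𝓕 (ψ i) ξ * Q i ξ =
          (-(m ξ : ℂ) / D ξ) * (𝓕 (ψ i) ξ * starRingEnd ℂ (𝓕 (ψ i) ξ)) := fun i => by
        simp only [Q]; ring
      simp only [this]
      rw [← Finset.mul_sum]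
      exact div_mul_cancel₀ _ (hD0 ξ hξ)
    · simp [Q, image_eq_zero_of_notMem_tsupport hξ]
  -- Applying 𝓕 twice reflects, so 𝓕 Ψ_i (zξ) = Q_i(-zξ) is evaluated at the same point as 𝓕 ψ_i
  -- (-zξ).
  refine ⟨fun i => 𝓕 (q i), 𝓕⁻ L, fun ξ => ?_, η * σ, mul_pos hη.1 hσ, fun i ξ hξ => ?_⟩
  · rw [FourierTransform.fourier_fourierInv_eq]
    have e : ∀ z ∈ Ioo (0 : ℝ) 1,
        ((z⁻¹ : ℝ) : ℂ) * ∑ i, 𝓕 (ψ i) (-(z • ξ)) * 𝓕 (𝓕 (q i)) (z • ξ) =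
        ((-fderiv ℝ lam (z • (-ξ)) (-ξ) : ℝ) : ℂ) := by
      intro z hz
      simp only [hq, hsum]
      have hz0 : z ≠ 0 := hz.1.ne'
      simp only [m, ← smul_neg]
      rw [map_smul, smul_eq_mul, ← Complex.ofReal_neg, ← Complex.ofReal_mul]
      congr 1
      field_simp
    rw [setIntegral_congr_fun measurableSet_Ioo e, integral_complex_ofReal, integral_neg,
      ← integral_Ioc_eq_integral_Ioo, ← intervalIntegral.integral_of_le zero_le_one,
      intervalIntegral.integral_eq_sub_of_hasDerivAt (f := fun z : ℝ => lam (z • (-ξ)))]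
    · have h0 : lam ((0 : ℝ) • (-ξ)) = 1 := by
        rw [zero_smul]
        exact lam.one_of_mem_closedBall (by simpa using lam.rIn_pos.le)
      rw [h0, one_smul]
      change ((lam (-ξ) : ℝ) : ℂ) + _ = 1
      push_cast
      ring
    · intro z _
      have h1 : HasDerivAt (fun z : ℝ => z • (-ξ)) (-ξ) z := by
        simpa using (hasDerivAt_id z).smul_const (-ξ)
      exact ((hlam.differentiable (by simp)).differentiableAt.hasFDerivAt).comp_hasDerivAt z h1
    · refine Continuous.intervalIntegrable ?_ _ _
      exact ((hlam.continuous_fderiv (by simp)).comp (by fun_prop)).clm_apply continuous_const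
  · rw [hq]
    simp only [Q, hm0 (-ξ) (by simpa using hξ)]
    simp

/-- As N is arbitrary, the gain (z/y)^L is available with L > -r, however negative r is. -/
lemma IsReproducing.vanishingMoments {ι : Type*} [Fintype ι] {ψ Ψ : ι → 𝓢(E d, ℂ)}
    {Λ : 𝓢(E d, ℂ)} (h : IsReproducing ψ Ψ Λ) (i : ι) (N : ℕ) : VanishingMoments (Ψ i) N := by
  obtain ⟨ρ, hρ, h0⟩ := h.eq_zero
  exact .of_fourier_eq_zero hρ (h0 i) N

lemma IsDensity.integral_conv_dilate_mul_convolution {S : 𝓢'(E d, ℂ)} {M : ℕ} {b : E d → ℂ}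
    (hb : IsDensity S M b) (ψ Ψ g : 𝓢(E d, ℂ)) {z : ℝ} (hz : 0 < z) :
    ∫ v, conv S (dilate ψ z) v * (∫ w, g w * dilate Ψ z (v - w)) =
      ∫ ξ, b ξ * 𝓕 g ξ * (𝓕 ψ (-(z • ξ)) * 𝓕 Ψ (z • ξ)) := by
  let h : 𝓢(E d, ℂ) := SchwartzMap.convolution (ContinuousLinearMap.mul ℂ ℂ) g (dilate Ψ z)
  have h1 : ∀ v, h v = ∫ w, g w * dilate Ψ z (v - w) := fun v => by
    simp only [h, SchwartzMap.convolution_apply]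
    rfl
  have h2 : ∀ ξ, 𝓕 h ξ = 𝓕 g ξ * 𝓕 Ψ (z • ξ) := fun ξ => by
    simp only [h, SchwartzMap.fourier_convolution, ← fourier_dilate Ψ hz]
    rfl
  simp only [← h1]
  rw [hb.integral_conv_dilate_mul ψ h hz]
  refine integral_congr_ae (.of_forall fun ξ => ?_)
  simp only [h2]
  ring

/-- The resolution of the identity is integrated against b 𝓕 g, followed by Fubini. Since 𝓕 Ψ_i is
bounded and vanishes near 0, it is O(|ξ|); so |𝓕 Ψ_i (zξ)| ≤ C z|ξ| cancels z⁻¹, and 𝓕 g absorbs the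
factor |ξ|. -/
lemma IsReproducing.apply_eq {ι : Type*} [Fintype ι] {ψ Ψ : ι → 𝓢(E d, ℂ)}
    {Λ : 𝓢(E d, ℂ)} (h : IsReproducing ψ Ψ Λ) {S : 𝓢'(E d, ℂ)} {M : ℕ} {b : E d → ℂ}
    (hb : IsDensity S M b) (g : 𝓢(E d, ℂ)) :
    S g = (∫ v, conv S Λ v * g v) + ∫ z in Ioo (0 : ℝ) 1, ((z⁻¹ : ℝ) : ℂ) *
      ∑ i, ∫ v, conv S (dilate (ψ i) z) v * (∫ w, g w * dilate (Ψ i) z (v - w)) := by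
  obtain ⟨ρ, hρ, h0⟩ := h.eq_zero
  choose A hA0 hA using fun i => exists_norm_le_decay (𝓕 (ψ i)) 0
  choose B hB0 hB using fun i => exists_norm_le_decay (𝓕 (Ψ i)) 0
  obtain ⟨C, hC, hg⟩ := exists_norm_le_decay (𝓕 g) (M + 1)
  have hA' : ∀ i ξ, ‖𝓕 (ψ i) ξ‖ ≤ A i := fun i ξ =>
    (hA i ξ).trans (mul_le_of_le_one_right (hA0 i) (decay_le_one _ _))
  have hB' : ∀ i ξ, ‖𝓕 (Ψ i) ξ‖ ≤ B i / ρ * ‖ξ‖ := fun i ξ => by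
    have := hB0 i
    rcases lt_or_ge ‖ξ‖ ρ with hξ | hξ
    · rw [h0 i ξ hξ, norm_zero]; positivity
    · refine ((hB i ξ).trans (mul_le_of_le_one_right (hB0 i) (decay_le_one _ _))).trans ?_
      rw [div_mul_eq_mul_div, le_div_iff₀ hρ]
      gcongr
  let m : E d → ℝ → ℂ := fun ξ z =>
    ((z⁻¹ : ℝ) : ℂ) * ∑ i, 𝓕 (ψ i) (-(z • ξ)) * 𝓕 (Ψ i) (z • ξ)
  have hm : ∀ ξ, ∀ z ∈ Ioo (0 : ℝ) 1, ‖m ξ z‖ ≤ (∑ i, A i * (B i / ρ)) * ‖ξ‖ := by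
    intro ξ z hz
    have hz0 := hz.1
    have h1 : ‖∑ i, 𝓕 (ψ i) (-(z • ξ)) * 𝓕 (Ψ i) (z • ξ)‖ ≤
        ∑ i, A i * (B i / ρ * (z * ‖ξ‖)) := by
      refine norm_sum_le_of_le _ fun i _ => ?_
      rw [norm_mul]
      have := hA0 i
      gcongr
      · exact hA' i _
      · refine (hB' i _).trans_eq ?_
        rw [norm_smul, Real.norm_of_nonneg hz0.le]
    rw [norm_mul, Complex.norm_real, Real.norm_of_nonneg (by positivity)]
    calc _ ≤ z⁻¹ * ∑ i, A i * (B i / ρ * (z * ‖ξ‖)) := by gcongr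
      _ = _ := by
        rw [Finset.mul_sum, Finset.sum_mul]
        refine Finset.sum_congr rfl fun i _ => ?_
        field_simp
  have hbg : Integrable fun ξ => b ξ * 𝓕 g ξ :=
    hb.integrable_mul (by fun_prop) (C := C) fun ξ => (hg ξ).trans <| by
      gcongr
      rw [decay_add]
      exact mul_le_of_le_one_right (decay_nonneg _ _) (decay_le_one _ _)
  have hbg1 : Integrable fun ξ => b ξ * (((‖ξ‖ : ℝ) : ℂ) * 𝓕 g ξ) :=
    hb.integrable_mul (by fun_prop) (C := C) fun ξ => by
      rw [norm_mul, Complex.norm_real, norm_norm]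
      calc _ ≤ ‖ξ‖ * (C * decay (M + 1) ξ) := by gcongr; exact hg ξ
        _ = C * (‖ξ‖ ^ 1 * decay (M + 1) ξ) := by ring
        _ ≤ _ := by gcongr; exact pow_mul_decay_le 1 M ξ
  have hint : Integrable (Function.uncurry fun ξ z => b ξ * 𝓕 g ξ * m ξ z)
      (volume.prod (volume.restrict (Ioo (0 : ℝ) 1))) := by
    have hdom : Integrable (fun w : E d × ℝ => (∑ i, A i * (B i / ρ)) *
        ‖b w.1 * (((‖w.1‖ : ℝ) : ℂ) * 𝓕 g w.1)‖)
        (volume.prod (volume.restrict (Ioo (0 : ℝ) 1))) :=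
      (hbg1.norm.const_mul _).comp_fst _
    refine hdom.mono' ?_ ?_
    · have h1 : Measurable fun w : E d × ℝ => m w.1 w.2 := by
        simp only [m]
        refine Measurable.mul (by fun_prop) (Continuous.measurable ?_)
        fun_prop
      exact (hbg.aestronglyMeasurable.comp_fst).mul h1.aestronglyMeasurable
    · have h2 : ∀ᵐ w : E d × ℝ ∂(volume.prod (volume.restrict (Ioo (0 : ℝ) 1))),
          w.2 ∈ Ioo (0 : ℝ) 1 :=
        Measure.quasiMeasurePreserving_snd.ae (ae_restrict_mem measurableSet_Ioo)
      filter_upwards [h2] with w hw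
      have h3 : ‖b w.1 * (((‖w.1‖ : ℝ) : ℂ) * 𝓕 g w.1)‖ = ‖b w.1‖ * (‖w.1‖ * ‖𝓕 g w.1‖) := by
        rw [norm_mul, norm_mul, Complex.norm_real, norm_norm]
      simp only [Function.uncurry]
      rw [h3, norm_mul, norm_mul]
      calc _ ≤ ‖b w.1‖ * ‖𝓕 g w.1‖ * ((∑ i, A i * (B i / ρ)) * ‖w.1‖) := by
            gcongr; exact hm w.1 w.2 hw
        _ = _ := by ring
  have hLow : ∫ v, conv S Λ v * g v = ∫ ξ, b ξ * 𝓕 g ξ * 𝓕 Λ (-ξ) := by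
    rw [hb.conv_eq, integral_fourier_mul_eq_of_integrable (hb.integrable_fourier _) g.integrable]
    refine integral_congr_ae (.of_forall fun ξ => ?_)
    simp only [SchwartzMap.fourier_coe]
    ring
  have hHigh : ∫ z in Ioo (0 : ℝ) 1, ((z⁻¹ : ℝ) : ℂ) *
      ∑ i, ∫ v, conv S (dilate (ψ i) z) v * (∫ w, g w * dilate (Ψ i) z (v - w)) =
      ∫ z in Ioo (0 : ℝ) 1, ∫ ξ, b ξ * 𝓕 g ξ * m ξ z := by
    refine setIntegral_congr_fun measurableSet_Ioo fun z hz => ?_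
    simp only [hb.integral_conv_dilate_mul_convolution _ _ _ hz.1]
    rw [← integral_finsetSum, ← integral_const_mul]
    · refine integral_congr_ae (.of_forall fun ξ => ?_)
      simp only [m, ← Finset.mul_sum]
      ring
    · intro i _
      refine (hbg.norm.mul_const (A i * B i)).mono' ?_ (.of_forall fun ξ => ?_)
      · exact hbg.aestronglyMeasurable.mul (Continuous.aestronglyMeasurable (by fun_prop))
      · rw [norm_mul _ (𝓕 (ψ i) _ * _), norm_mul (𝓕 (ψ i) _)]
        have := hA0 i
        gcongr
        · exact hA' i _
        · exact (hB i _).trans (mul_le_of_le_one_right (hB0 i) (decay_le_one _ _))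
  rw [hLow, hHigh, ← integral_integral_swap hint, ← integral_add, hb.apply_eq]
  · refine integral_congr_ae (.of_forall fun ξ => ?_)
    simp only [m]
    rw [integral_const_mul, ← mul_add, h.eq_one, mul_one]
  · obtain ⟨D, hD, hΛ⟩ := exists_norm_le_decay (𝓕 Λ) 0
    refine (hbg.norm.mul_const D).mono' ?_ (.of_forall fun ξ => ?_)
    · exact hbg.aestronglyMeasurable.mul (Continuous.aestronglyMeasurable (by fun_prop))
    · rw [norm_mul _ (𝓕 Λ _)]
      gcongr
      exact (hΛ _).trans (mul_le_of_le_one_right hD (decay_le_one _ _))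
  · exact hint.integral_prod_left

end

section

/-! ### Integral inequalities -/

/-- Minkowski's integral inequality. -/
theorem eLpNorm_lintegral_le {α β : Type*} [MeasurableSpace α] [MeasurableSpace β]
    {μ : Measure α} {ν : Measure β} [SigmaFinite μ] [SFinite ν] {p : ℝ≥0∞} (hp : 1 ≤ p)
    {f : α → β → ℝ≥0∞} (hf : Measurable (Function.uncurry f)) {c : β → ℝ≥0∞}
    (hc : AEMeasurable c ν) (h : ∀ᵐ z ∂ν, eLpNorm (fun x => f x z) p μ ≤ c z) :
    eLpNorm (fun x => ∫⁻ z, f x z ∂ν) p μ ≤ ∫⁻ z, c z ∂ν := by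
  rcases eq_or_ne p ∞ with rfl | hpt
  · have h1 : ∀ᵐ z ∂ν, ∀ᵐ x ∂μ, f x z ≤ hc.mk c z := by
      filter_upwards [h, hc.ae_eq_mk] with z hz hz'
      rw [← hz']
      filter_upwards [enorm_ae_le_eLpNormEssSup (fun x => f x z) μ] with x hx
      exact (by simpa using hx : f x z ≤ _).trans (by simpa using! hz)
    have h2 : ∀ᵐ x ∂μ, ∀ᵐ z ∂ν, f x z ≤ hc.mk c z := by
      refine (Measure.ae_ae_comm ?_).2 h1
      exact measurableSet_le hf (hc.measurable_mk.comp measurable_snd)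
    rw [lintegral_congr_ae hc.ae_eq_mk, eLpNorm_exponent_top]
    refine eLpNormEssSup_le_of_ae_enorm_bound ?_
    filter_upwards [h2] with x hx
    exact lintegral_mono_ae hx
  have hp0 : p ≠ 0 := by positivity
  have hf' : ∀ z, Measurable fun x => f x z := fun z => hf.comp measurable_prodMk_right
  have hfx : ∀ x, Measurable (f x) := fun x => hf.comp measurable_prodMk_left
  set g : α → ℝ≥0∞ := fun x => ∫⁻ z, f x z ∂ν
  have hg : Measurable g := hf.lintegral_prod_right'
  rcases eq_or_ne p 1 with rfl | hp1
  · rw [eLpNorm_one_eq_lintegral_enorm]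
    simp only [enorm_eq_self, g]
    rw [lintegral_lintegral_swap hf.aemeasurable]
    refine lintegral_mono_ae ?_
    filter_upwards [h] with z hz
    rw [eLpNorm_one_eq_lintegral_enorm] at hz
    simpa using hz
  set r := p.toReal
  have hr : 1 < r := by
    have := (ENNReal.toReal_lt_toReal ENNReal.one_ne_top hpt).2 (lt_of_le_of_ne hp hp1.symm)
    simpa using this
  have hr0 : 0 < r := zero_lt_one.trans hr
  have hconj := Real.HolderConjugate.conjExponent hr
  set r' := r.conjExponent
  rw [eLpNorm_eq_lintegral_rpow_enorm_toReal hp0 hpt, one_div,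
    ENNReal.rpow_inv_le_iff hr0]
  simp only [enorm_eq_self]
  set J := ∫⁻ z, c z ∂ν
  -- The truncation makes A = ∫ G^r finite, so that A^{1/r'} can be cancelled from A ≤ A^{1/r'} J.
  -- Monotone convergence then removes the truncation.
  let G : ℕ → α → ℝ≥0∞ := fun n => indicator (spanningSets μ n) fun x => min (g x) n
  have hG : ∀ n, Measurable (G n) := fun n =>
    (hg.min measurable_const).indicator (measurableSet_spanningSets μ n)
  have hGg : ∀ n x, G n x ≤ g x := fun n x =>
    (indicator_le_self' (fun _ _ => zero_le) x).trans (min_le_left _ _)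
  have hbound : ∀ n, ∫⁻ x, G n x ^ r ∂μ ≤ J ^ r := by
    intro n
    set A := ∫⁻ x, G n x ^ r ∂μ
    have hA : A ≠ ∞ := by
      have : A ≤ (n : ℝ≥0∞) ^ r * μ (spanningSets μ n) := by
        rw [← setLIntegral_const, ← lintegral_indicator (measurableSet_spanningSets μ n)]
        refine lintegral_mono fun x => ?_
        by_cases hx : x ∈ spanningSets μ n
        · simp only [G, indicator_of_mem hx]
          gcongr
          exact min_le_right _ _
        · simp [G, indicator_of_notMem hx, hr0]
      refine (this.trans_lt (ENNReal.mul_lt_top ?_ (measure_spanningSets_lt_top μ n))).ne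
      exact ENNReal.rpow_lt_top_of_nonneg hr0.le (by simp)
    -- Bound G^r by G^{r-1} g, exchange the integrals and apply Hölder in x, using (r - 1) r' = r.
    have h1 : A ≤ A ^ (1 / r') * J := by
      calc A ≤ ∫⁻ x, ∫⁻ z, G n x ^ (r - 1) * f x z ∂ν ∂μ := by
            refine lintegral_mono fun x => ?_
            rw [lintegral_const_mul _ (hfx x)]
            calc G n x ^ r = G n x ^ (r - 1) * G n x := by
                  conv_lhs => rw [show r = (r - 1) + 1 by ring]
                  rw [ENNReal.rpow_add_of_nonneg _ _ (by linarith) zero_le_one, ENNReal.rpow_one]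
              _ ≤ _ := by gcongr; exact hGg n x
        _ = ∫⁻ z, ∫⁻ x, G n x ^ (r - 1) * f x z ∂μ ∂ν := by
            refine lintegral_lintegral_swap (Measurable.aemeasurable ?_)
            exact (((hG n).comp measurable_fst).pow_const _).mul hf
        _ ≤ ∫⁻ z, A ^ (1 / r') * c z ∂ν := by
            refine lintegral_mono_ae ?_
            filter_upwards [h] with z hz
            refine (ENNReal.lintegral_mul_le_Lp_mul_Lq μ hconj.symm
              ((hG n).pow_const _).aemeasurable (hf' z).aemeasurable).trans ?_
            rw [eLpNorm_eq_lintegral_rpow_enorm_toReal hp0 hpt] at hz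
            simp only [enorm_eq_self] at hz
            refine mul_le_mul' (le_of_eq ?_) hz
            congr 2
            funext x
            rw [← ENNReal.rpow_mul]
            congr 1
            have := hconj.sub_one_mul_conj
            linarith
        _ = _ := lintegral_const_mul'' _ hc
    rcases eq_or_ne A 0 with hA0 | hA0
    · rw [hA0]; exact zero_le
    rw [← ENNReal.rpow_inv_le_iff hr0, ← one_div]
    have h2 : A = A ^ (1 / r') * A ^ (1 / r) := by
      rw [← ENNReal.rpow_add _ _ hA0 hA, one_div, one_div, add_comm, hconj.inv_add_inv_eq_one,
        ENNReal.rpow_one]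
    have h3 : A ^ (1 / r') * A ^ (1 / r) ≤ A ^ (1 / r') * J := by rw [← h2]; exact h1
    refine (ENNReal.mul_le_mul_iff_right ?_ ?_).1 h3
    · exact (ENNReal.rpow_pos (pos_iff_ne_zero.2 hA0) hA).ne'
    · exact ENNReal.rpow_ne_top_of_nonneg (by have := hconj.symm.pos; positivity) hA
  refine le_of_tendsto' (lintegral_tendsto_of_tendsto_of_monotone
    (fun n => ((hG n).pow_const r).aemeasurable) (.of_forall fun x => ?_)
    (.of_forall fun x => ?_)) hbound
  · intro n m hnm
    simp only
    gcongr
    refine indicator_le_indicator_of_subset (monotone_spanningSets μ hnm) (fun _ => zero_le) x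
      |>.trans ?_
    refine indicator_le_indicator ?_
    gcongr
  · refine (ENNReal.continuous_rpow_const.tendsto _).comp ?_
    have h1 : Filter.Tendsto (fun n : ℕ => min (g x) n) Filter.atTop (nhds (g x)) := by
      have := (tendsto_const_nhds (x := g x)).min ENNReal.tendsto_nat_nhds_top
      rwa [min_eq_left le_top] at this
    refine h1.congr' ?_
    filter_upwards [Filter.eventually_ge_atTop (spanningSetsIndex μ x)] with n hn
    simp only [G]
    rw [indicator_of_mem (monotone_spanningSets μ hn (mem_spanningSetsIndex μ x))]

lemma eLpNorm_const_mul_le {α : Type*} [MeasurableSpace α] {μ : Measure α} (p : ℝ≥0∞)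
    {a : ℝ≥0∞} (ha : a ≠ ∞) (f : α → ℝ≥0∞) :
    eLpNorm (fun x => a * f x) p μ ≤ a * eLpNorm f p μ := by
  lift a to ℝ≥0 using ha
  have := eLpNorm_le_nnreal_smul_eLpNorm_of_ae_le_mul' (μ := μ) (f := fun x => (a : ℝ≥0∞) * f x)
    (g := f) (c := a) (.of_forall fun x => by simp) p
  simpa [ENNReal.smul_def] using this

/-- Young's inequality for a convolution with an integrable kernel. -/
lemma eLpNorm_convolution_le {p : ℝ≥0∞} (hp : 1 ≤ p) {k H : E d → ℝ≥0∞} (hk : Measurable k)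
    (hk' : ∀ u, k u ≠ ∞) (hH : Measurable H) :
    eLpNorm (fun x => ∫⁻ v, k (x - v) * H v) p volume ≤ (∫⁻ u, k u) * eLpNorm H p volume := by
  have h1 : ∀ x, ∫⁻ v, k (x - v) * H v = ∫⁻ u, k u * H (x - u) := fun x => by
    rw [← lintegral_sub_left_eq_self _ x]
    simp
  simp only [h1]
  refine (eLpNorm_lintegral_le hp (c := fun u => k u * eLpNorm H p volume) ?_ ?_
    (.of_forall fun u => ?_)).trans_eq (lintegral_mul_const _ hk)
  · exact (hk.comp measurable_snd).mul (hH.comp (measurable_fst.sub measurable_snd))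
  · exact (hk.mul_const _).aemeasurable
  · refine (eLpNorm_const_mul_le p (hk' u) _).trans (mul_le_mul' le_rfl (le_of_eq ?_))
    exact eLpNorm_comp_measurePreserving (g := H) hH.aestronglyMeasurable
      (measurePreserving_sub_right volume u)

/-! ### A Hardy inequality -/

/-- The kernel is scale invariant for dz/z; each of the ranges z ≤ y and z > y contributes at most
1/δ. -/
lemma lintegral_min_rpow_le {δ : ℝ} (hδ : 0 < δ) {y : ℝ} (hy : 0 < y) :
    ∫⁻ z in Ioo (0 : ℝ) 1, ENNReal.ofReal (min (y / z) (z / y) ^ δ) * ENNReal.ofReal z⁻¹ ≤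
      ENNReal.ofReal (δ⁻¹ + δ⁻¹) := by
  have hI1 : IntegrableOn (fun z : ℝ => y ^ (-δ) * z ^ (δ - 1)) (Ioc 0 y) :=
    ((intervalIntegral.intervalIntegrable_rpow' (by linarith)).1).const_mul _
  have hI2 : IntegrableOn (fun z : ℝ => y ^ δ * z ^ (-δ - 1)) (Ioi y) :=
    (integrableOn_Ioi_rpow_of_lt (by linarith) hy).const_mul _
  have e1 : ∫ z in Ioc 0 y, y ^ (-δ) * z ^ (δ - 1) = δ⁻¹ := by
    rw [integral_const_mul, ← intervalIntegral.integral_of_le hy.le,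
      integral_rpow (Or.inl (by linarith)), sub_add_cancel, Real.zero_rpow hδ.ne', sub_zero,
      ← mul_div_assoc, ← Real.rpow_add hy, neg_add_cancel, Real.rpow_zero, one_div]
  have e2 : ∫ z in Ioi y, y ^ δ * z ^ (-δ - 1) = δ⁻¹ := by
    rw [integral_const_mul, integral_Ioi_rpow_of_lt (by linarith) hy, sub_add_cancel, neg_div_neg_eq,
      ← mul_div_assoc, ← Real.rpow_add hy, add_neg_cancel, Real.rpow_zero, one_div]
  calc _ ≤ ∫⁻ z in Ioc 0 y ∪ Ioi y,
        ENNReal.ofReal (min (y / z) (z / y) ^ δ) * ENNReal.ofReal z⁻¹ := by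
        refine lintegral_mono_set fun z hz => ?_
        rw [Ioc_union_Ioi_eq_Ioi hy.le]
        exact hz.1
    _ ≤ (∫⁻ z in Ioc 0 y, ENNReal.ofReal (min (y / z) (z / y) ^ δ) * ENNReal.ofReal z⁻¹) +
        ∫⁻ z in Ioi y, ENNReal.ofReal (min (y / z) (z / y) ^ δ) * ENNReal.ofReal z⁻¹ :=
        lintegral_union_le _ _ _
    _ ≤ (∫⁻ z in Ioc 0 y, ENNReal.ofReal (y ^ (-δ) * z ^ (δ - 1))) +
        ∫⁻ z in Ioi y, ENNReal.ofReal (y ^ δ * z ^ (-δ - 1)) := by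
        refine add_le_add (setLIntegral_mono' measurableSet_Ioc fun z hz => ?_)
          (setLIntegral_mono' measurableSet_Ioi fun z hz => ?_)
        · have hz0 : 0 < z := hz.1
          rw [← ENNReal.ofReal_mul (by positivity)]
          refine ENNReal.ofReal_le_ofReal ?_
          calc _ ≤ (z / y) ^ δ * z⁻¹ := by gcongr; exact min_le_right _ _
            _ = _ := by
              rw [Real.div_rpow hz0.le hy.le, Real.rpow_neg hy.le, Real.rpow_sub_one hz0.ne']
              field_simp
        · have hz0 : 0 < z := hy.trans hz
          rw [← ENNReal.ofReal_mul (by positivity)]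
          refine ENNReal.ofReal_le_ofReal ?_
          calc _ ≤ (y / z) ^ δ * z⁻¹ := by gcongr; exact min_le_left _ _
            _ = _ := by
              rw [Real.div_rpow hy.le hz0.le, Real.rpow_sub_one hz0.ne', Real.rpow_neg hz0.le]
              field_simp
    _ = _ := by
        rw [← ofReal_integral_eq_lintegral_ofReal hI1, ← ofReal_integral_eq_lintegral_ofReal hI2,
          e1, e2, ENNReal.ofReal_add (by positivity) (by positivity)]
        · refine (ae_restrict_iff' measurableSet_Ioi).2 (.of_forall fun z hz => ?_)
          have hz0 : 0 < z := hy.trans hz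
          simp only [Pi.zero_apply]
          positivity
        · refine (ae_restrict_iff' measurableSet_Ioc).2 (.of_forall fun z hz => ?_)
          have hz0 : 0 < z := hz.1
          simp only [Pi.zero_apply]
          positivity

/-- Hölder's inequality for the measure with density w, comparing the L¹ and L^q norms of h. -/
lemma lintegral_mul_rpow_le {α : Type*} [MeasurableSpace α] {μ : Measure α} {w h : α → ℝ≥0∞}
    (hw : AEMeasurable w μ) (hh : AEMeasurable h μ) {q : ℝ} (hq : 1 ≤ q) :
    (∫⁻ x, w x * h x ∂μ) ^ q ≤ (∫⁻ x, w x ∂μ) ^ (q - 1) * ∫⁻ x, w x * h x ^ q ∂μ := by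
  have hq0 : 0 < q := by linarith
  have hh' : AEMeasurable h (μ.withDensity w) := hh.mono_ac (withDensity_absolutelyContinuous _ _)
  have h1 := eLpNorm'_le_eLpNorm'_mul_rpow_measure_univ zero_lt_one hq hh'.aestronglyMeasurable
  simp only [eLpNorm', enorm_eq_self, ENNReal.rpow_one, div_one, withDensity_apply _ MeasurableSet.univ,
    Measure.restrict_univ] at h1
  rw [lintegral_withDensity_eq_lintegral_mul₀ hw hh,
    lintegral_withDensity_eq_lintegral_mul₀ hw (hh.pow_const q)] at h1
  have h2 := ENNReal.rpow_le_rpow h1 hq0.le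
  rw [ENNReal.mul_rpow_of_nonneg _ _ hq0.le, ← ENNReal.rpow_mul, ← ENNReal.rpow_mul,
    one_div_mul_cancel hq0.ne', ENNReal.rpow_one, sub_mul, one_mul, one_div_mul_cancel hq0.ne'] at h2
  rw [mul_comm]
  exact h2

/-- Schur's test: once the weights y^t and z^t are absorbed, the kernel is min(y/z, z/y)^δ on (0,1)
with dz/z, and its row and column integrals are at most 2/δ. -/
theorem wNorm_lt_top_of_hardy {q : ℝ≥0∞} (hq : 1 ≤ q) {t δ : ℝ} (hδ : 0 < δ) {N G : ℝ → ℝ≥0∞}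
    (hNm : AEMeasurable N (volume.restrict (Ioo (0 : ℝ) 1))) {κ : ℝ → ℝ → ℝ}
    (hκ : ∀ y ∈ Ioo (0 : ℝ) 1, ∀ z ∈ Ioo (0 : ℝ) 1,
      y ^ t * κ y z ≤ min (y / z) (z / y) ^ δ * z ^ t)
    (hG : ∀ y ∈ Ioo (0 : ℝ) 1, G y ≤
      ∫⁻ z in Ioo (0 : ℝ) 1, ENNReal.ofReal z⁻¹ * (ENNReal.ofReal (κ y z) * N z))
    (hN : wNorm q t N < ∞) : wNorm q t G < ∞ := by
  set A := ENNReal.ofReal (δ⁻¹ + δ⁻¹)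
  let h : ℝ → ℝ≥0∞ := fun z => ENNReal.ofReal (z ^ t) * N z
  let w : ℝ → ℝ → ℝ≥0∞ := fun y z =>
    ENNReal.ofReal (min (y / z) (z / y) ^ δ) * ENNReal.ofReal z⁻¹
  have hw : Measurable (Function.uncurry w) := by
    simp only [w, Function.uncurry_def]
    fun_prop
  have hwy : ∀ y, Measurable (w y) := fun y => by
    simp only [w]
    fun_prop
  have hhm : AEMeasurable h (volume.restrict (Ioo (0 : ℝ) 1)) :=
    AEMeasurable.mul (by fun_prop) hNm
  have hGh : ∀ y ∈ Ioo (0 : ℝ) 1, ENNReal.ofReal (y ^ t) * G y ≤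
      ∫⁻ z in Ioo (0 : ℝ) 1, w y z * h z := by
    intro y hy
    refine (mul_le_mul' le_rfl (hG y hy)).trans ?_
    rw [← lintegral_const_mul' _ _ ENNReal.ofReal_ne_top]
    refine setLIntegral_mono' measurableSet_Ioo fun z hz => ?_
    have hy0 := hy.1
    have hz0 := hz.1
    have := ENNReal.ofReal_le_ofReal (hκ y hy z hz)
    rw [ENNReal.ofReal_mul (by positivity), ENNReal.ofReal_mul (by positivity)] at this
    calc _ = (ENNReal.ofReal (y ^ t) * ENNReal.ofReal (κ y z)) * (ENNReal.ofReal z⁻¹ * N z) := by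
          ring
      _ ≤ (ENNReal.ofReal (min (y / z) (z / y) ^ δ) * ENNReal.ofReal (z ^ t)) *
          (ENNReal.ofReal z⁻¹ * N z) := by gcongr
      _ = _ := by simp only [w, h]; ring
  have hA : ∀ y ∈ Ioo (0 : ℝ) 1, ∫⁻ z in Ioo (0 : ℝ) 1, w y z ≤ A := fun y hy =>
    lintegral_min_rpow_le hδ hy.1
  unfold wNorm at hN ⊢
  split_ifs at hN ⊢ with hqt
  · set B := ⨆ ε ∈ Ioo (0 : ℝ) 1, ENNReal.ofReal (ε ^ t) * N ε
    refine lt_of_le_of_lt (iSup₂_le fun y hy => ?_)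
      (ENNReal.mul_lt_top (ENNReal.ofReal_lt_top (r := δ⁻¹ + δ⁻¹)) hN)
    calc _ ≤ ∫⁻ z in Ioo (0 : ℝ) 1, w y z * h z := hGh y hy
      _ ≤ ∫⁻ z in Ioo (0 : ℝ) 1, w y z * B := by
          refine setLIntegral_mono' measurableSet_Ioo fun z hz => ?_
          gcongr
          exact le_iSup₂ (f := fun ε (_ : ε ∈ Ioo (0 : ℝ) 1) => ENNReal.ofReal (ε ^ t) * N ε) z hz
      _ = (∫⁻ z in Ioo (0 : ℝ) 1, w y z) * B :=
          lintegral_mul_const _ (hwy y)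
      _ ≤ A * B := by gcongr; exact hA y hy
  · have hq1 : 1 ≤ q.toReal := by simpa using ENNReal.toReal_mono hqt hq
    have hq0 : 0 < q.toReal := by linarith
    set r := q.toReal
    rw [ENNReal.rpow_lt_top_iff_of_pos (by positivity)] at hN ⊢
    have hpow : ∀ (F : ℝ → ℝ≥0∞), ∀ y ∈ Ioo (0 : ℝ) 1,
        ENNReal.ofReal (y ^ (t * r)) * F y ^ r = (ENNReal.ofReal (y ^ t) * F y) ^ r := by
      intro F y hy
      rw [ENNReal.mul_rpow_of_nonneg _ _ hq0.le, ENNReal.ofReal_rpow_of_nonneg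
        (Real.rpow_nonneg hy.1.le _) hq0.le, ← Real.rpow_mul hy.1.le]
    have hA' : A ≠ ∞ := ENNReal.ofReal_ne_top
    have hwt : Measurable fun a : ℝ × ℝ => w a.1 a.2 := hw
    calc ∫⁻ y in Ioo (0 : ℝ) 1, ENNReal.ofReal (y ^ (t * r)) * G y ^ r * ENNReal.ofReal y⁻¹
        ≤ ∫⁻ y in Ioo (0 : ℝ) 1, ∫⁻ z in Ioo (0 : ℝ) 1,
            A ^ (r - 1) * (w y z * h z ^ r * ENNReal.ofReal y⁻¹) := by
          refine setLIntegral_mono' measurableSet_Ioo fun y hy => ?_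
          rw [hpow G y hy, lintegral_const_mul' _ _ (ENNReal.rpow_ne_top_of_nonneg (by linarith) hA'),
            lintegral_mul_const' _ _ ENNReal.ofReal_ne_top, ← mul_assoc]
          gcongr
          refine (ENNReal.rpow_le_rpow (hGh y hy) hq0.le).trans ?_
          refine (lintegral_mul_rpow_le (hwy y).aemeasurable hhm hq1).trans ?_
          gcongr
          exact hA y hy
      _ = ∫⁻ z in Ioo (0 : ℝ) 1, ∫⁻ y in Ioo (0 : ℝ) 1,
            A ^ (r - 1) * (w y z * h z ^ r * ENNReal.ofReal y⁻¹) := by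
          refine lintegral_lintegral_swap ?_
          exact ((hwt.aemeasurable.mul (hhm.pow_const r).comp_snd).mul (by fun_prop)).const_mul _
      _ ≤ ∫⁻ z in Ioo (0 : ℝ) 1, A ^ (r - 1) *
            (A * (ENNReal.ofReal (z ^ (t * r)) * N z ^ r * ENNReal.ofReal z⁻¹)) := by
          refine setLIntegral_mono' measurableSet_Ioo fun z hz => ?_
          rw [lintegral_const_mul' _ _ (ENNReal.rpow_ne_top_of_nonneg (by linarith) hA')]
          gcongr
          rw [hpow N z hz]
          -- By symmetry of the kernel, column integrals for dy/y are the row integrals already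
          -- bounded.
          have e : ∀ y : ℝ, w y z * h z ^ r * ENNReal.ofReal y⁻¹ =
              w z y * (h z ^ r * ENNReal.ofReal z⁻¹) := by
            intro y
            simp only [w, min_comm (z / y)]
            ring
          simp only [e]
          rw [lintegral_mul_const _ (hwy z)]
          gcongr
          exact hA z hz
      _ = A ^ (r - 1) * (A * ∫⁻ z in Ioo (0 : ℝ) 1,
            (ENNReal.ofReal (z ^ (t * r)) * N z ^ r * ENNReal.ofReal z⁻¹)) := by
          rw [lintegral_const_mul' _ _ (ENNReal.rpow_ne_top_of_nonneg (by linarith) hA'),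
            lintegral_const_mul' _ _ hA']
      _ < ∞ := ENNReal.mul_lt_top (ENNReal.rpow_lt_top_of_nonneg (by linarith) hA')
          (ENNReal.mul_lt_top hA'.lt_top hN)

end

section

/-! ### Comparison of local means -/

lemma aemeasurable_eLpNorm_conv {Ω : Opens (E d)} (χ : 𝓓(Ω, ℂ)) (T : Distr Ω)
    (ψ : 𝓢(E d, ℂ)) (p : ℝ≥0∞) (V : Opens (E d)) :
    AEMeasurable (fun z => eLpNorm (conv (mulTempered χ T) (dilate ψ z)) p (volume.restrict V))
      (volume.restrict (Ioo (0 : ℝ) 1)) := by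
  obtain ⟨M, b, hb⟩ := exists_isDensity χ T
  exact aemeasurable_eLpNorm ((hb.continuousOn_conv ψ).mono
    (prod_mono (fun _ h => h.1) (subset_univ _)))

/-- Off V the distance to K is bounded below by some δ and therefore dominates a multiple of 1 +
|v|. -/
lemma exists_distDecay_le {K : Set (E d)} (hK : IsCompact K) (hKn : K.Nonempty) {V : Opens (E d)}
    (hV : K ⊆ V) (M : ℕ) : ∃ C : ℝ, 0 ≤ C ∧ ∀ z > 0, ∀ v ∉ V,
      distDecay K M z v ≤ C * z ^ M * decay M v := by
  obtain ⟨δ, hδ, hδV⟩ := hK.exists_thickening_subset_open V.isOpen hV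
  obtain ⟨R, hR⟩ := hK.isBounded.exists_norm_le
  obtain ⟨w₀, hw₀⟩ := hKn
  have hR0 : 0 ≤ R := (norm_nonneg _).trans (hR w₀ hw₀)
  refine ⟨(1 + (1 + R) / δ) ^ M, by positivity, fun z hz v hv => ?_⟩
  have hd : δ ≤ Metric.infDist v K := by
    by_contra hcon
    exact hv (hδV ((Metric.mem_thickening_iff_infDist_lt ⟨w₀, hw₀⟩).2 (not_le.1 hcon)))
  have hpos : 0 < Metric.infDist v K := hδ.trans_le hd
  obtain ⟨w, hw, hwd⟩ := hK.exists_infDist_eq_dist ⟨w₀, hw₀⟩ v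
  have h1 : 1 + ‖v‖ ≤ (1 + (1 + R) / δ) * Metric.infDist v K := by
    have h2 : ‖v‖ ≤ Metric.infDist v K + R := by
      rw [hwd, dist_eq_norm]
      have := norm_add_le (v - w) w
      rw [sub_add_cancel] at this
      linarith [hR w hw]
    have h3 : 1 + R ≤ (1 + R) / δ * Metric.infDist v K := by
      rw [div_mul_eq_mul_div, le_div_iff₀ hδ]
      gcongr
    nlinarith
  unfold distDecay decay
  rw [← mul_pow, ← inv_pow, ← inv_pow, ← mul_pow]
  refine pow_le_pow_left₀ (by positivity) ?_ M
  rw [← div_eq_mul_inv, le_div_iff₀ (by positivity), inv_mul_le_iff₀ (by positivity)]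
  calc 1 + ‖v‖ ≤ (1 + (1 + R) / δ) * Metric.infDist v K := h1
    _ = (Metric.infDist v K / z) * ((1 + (1 + R) / δ) * z) := by field_simp
    _ ≤ _ := by gcongr; linarith

lemma decay_anti {M M' : ℕ} (h : M ≤ M') (x : E d) : decay M' x ≤ decay M x := by
  obtain ⟨k, rfl⟩ := Nat.exists_eq_add_of_le h
  rw [decay_add]
  exact mul_le_of_le_one_right (decay_nonneg _ _) (decay_le_one _ _)

/-- On V the weight is at most 1. Off V it gives z^M with decay of order M = N + P + (d + 1): N
powers beat the growth z^{-N} of the means, P give the remainder and d + 1 secure membership in L^p.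
-/
lemma exists_eLpNorm_mul_distDecay_le {Ω : Opens (E d)} (χ : 𝓓(Ω, ℂ)) (T : Distr Ω)
    (ψ : 𝓢(E d, ℂ)) {p : ℝ≥0∞} (hp : 1 ≤ p) {K : Set (E d)} (hK : IsCompact K)
    (hKn : K.Nonempty) {V : Opens (E d)} (hV : K ⊆ V) (P : ℕ) :
    ∃ (M : ℕ) (C : ℝ≥0∞), C ≠ ∞ ∧ ∀ z ∈ Ioo (0 : ℝ) 1,
      eLpNorm (fun v => ‖conv (mulTempered χ T) (dilate ψ z) v‖ₑ *
        ENNReal.ofReal (distDecay K M z v)) p volume ≤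
      eLpNorm (conv (mulTempered χ T) (dilate ψ z)) p (volume.restrict V) +
        C * ENNReal.ofReal (z ^ (P : ℝ)) := by
  obtain ⟨A, N, hA, hN⟩ := exists_norm_conv_dilate_le χ T ψ
  obtain ⟨B, hB, hd⟩ := exists_distDecay_le hK hKn hV (N + P + (d + 1))
  have hmem : MemLp (decay (d + 1) : E d → ℝ) p := memLp_decay hp
  refine ⟨N + P + (d + 1), ENNReal.ofReal (A * B) * eLpNorm (decay (d + 1) : E d → ℝ) p volume,
    ENNReal.mul_ne_top ENNReal.ofReal_ne_top hmem.2.ne, fun z hz => ?_⟩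
  have hz0 := hz.1
  set f := conv (mulTempered χ T) (dilate ψ z)
  have hf : Continuous f := (contDiff_conv_mulTempered χ T _).continuous
  let F₁ : E d → ℝ := indicator V fun v => ‖f v‖
  let F₂ : E d → ℝ := (A * B * z ^ P) • decay (d + 1)
  have hpt : ∀ v, ‖‖f v‖ₑ * ENNReal.ofReal (distDecay K (N + P + (d + 1)) z v)‖ₑ ≤
      ‖(F₁ + F₂) v‖ₑ := by
    intro v
    have hdec := decay_nonneg (d + 1) v
    have hdd := distDecay_nonneg K (N + P + (d + 1)) hz0 v
    have hF1 : 0 ≤ F₁ v := indicator_nonneg (fun _ _ => norm_nonneg _) v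
    have hF2 : 0 ≤ F₂ v := by simp only [F₂, Pi.smul_apply, smul_eq_mul]; positivity
    rw [enorm_eq_self, ← ofReal_norm, ← ENNReal.ofReal_mul (norm_nonneg _),
      Real.enorm_of_nonneg (by simp only [Pi.add_apply]; positivity)]
    refine ENNReal.ofReal_le_ofReal ?_
    by_cases hv : v ∈ V
    · have : F₁ v = ‖f v‖ := indicator_of_mem (s := (V : Set (E d))) hv _
      rw [Pi.add_apply, this]
      have := mul_le_of_le_one_right (norm_nonneg (f v))
        (distDecay_le_one K (N + P + (d + 1)) hz0 v)
      linarith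
    · have h1 := hN z hz v
      have h2 := hd z hz0 v hv
      have h5 := decay_nonneg (N + P + (d + 1)) v
      have h3 := decay_anti (show d + 1 ≤ N + P + (d + 1) by omega) v
      have h4 : z ^ (N + P + (d + 1)) ≤ z ^ (N + P) :=
        pow_le_pow_of_le_one hz0.le hz.2.le (by omega)
      have : F₁ v = 0 := indicator_of_notMem (s := (V : Set (E d))) hv _
      rw [Pi.add_apply, this, zero_add]
      simp only [F₂, Pi.smul_apply, smul_eq_mul]
      calc ‖f v‖ * distDecay K (N + P + (d + 1)) z v
          ≤ (A * (z ^ N)⁻¹) * (B * z ^ (N + P) * decay (d + 1) v) := by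
            gcongr
            exact h2.trans (by gcongr)
        _ = _ := by rw [pow_add]; field_simp
  refine (eLpNorm_mono_enorm hpt).trans ((eLpNorm_add_le ?_ ?_ hp).trans (add_le_add ?_ ?_))
  · exact hf.norm.aestronglyMeasurable.indicator V.isOpen.measurableSet
  · exact ((continuous_decay _).const_smul _).aestronglyMeasurable
  · rw [eLpNorm_indicator_eq_eLpNorm_restrict V.isOpen.measurableSet, eLpNorm_norm]
  · rw [eLpNorm_const_smul, Real.enorm_of_nonneg (by positivity),
      ENNReal.ofReal_mul (by positivity), Real.rpow_natCast]
    exact le_of_eq (by ring)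

/-- The kernel `m^{-d} (1 + |u| / m)^{-d-1}`. -/
def scaledDecay (m : ℝ) (u : E d) : ℝ≥0∞ :=
  ENNReal.ofReal ((m ^ d)⁻¹ * decay (d + 1) (m⁻¹ • u))

lemma measurable_uncurry_scaledDecay : Measurable (Function.uncurry (scaledDecay (d := d))) := by
  unfold scaledDecay Function.uncurry decay
  fun_prop

lemma lintegral_scaledDecay {m : ℝ} (hm : 0 < m) :
    ∫⁻ u : E d, scaledDecay m u = ENNReal.ofReal (∫ u : E d, decay (d + 1) u) := by
  unfold scaledDecay
  rw [← ofReal_integral_eq_lintegral_ofReal]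
  · congr 1
    rw [integral_const_mul, Measure.integral_comp_inv_smul_of_nonneg _ _ hm.le,
      finrank_euclideanSpace_fin, smul_eq_mul, inv_mul_cancel_left₀ (by positivity)]
  · exact (integrable_decay.comp_smul (inv_ne_zero hm.ne')).const_mul _
  · exact .of_forall fun u => mul_nonneg (by positivity) (decay_nonneg _ _)

lemma scaleGain_nonneg (N L : ℕ) {y z : ℝ} (hy : 0 < y) (hz : 0 < z) : 0 ≤ scaleGain N L y z := by
  unfold scaleGain
  split_ifs <;> positivity

lemma measurable_scaleGain (N L : ℕ) (y : ℝ) : Measurable (scaleGain N L y) := by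
  unfold scaleGain
  exact Measurable.ite measurableSet_Ici (by fun_prop) (by fun_prop)

/-- Verifies the kernel hypothesis of `wNorm_lt_top_of_hardy`: N > r serves for y ≤ z and L > -r for
y > z. -/
lemma rpow_mul_scaleGain_le {N L : ℕ} {r : ℝ} (hN : r < N) (hL : -r < L) {y z : ℝ} (hy : 0 < y)
    (hz : 0 < z) : y ^ (-r) * scaleGain N L y z ≤
      min (y / z) (z / y) ^ (min (N - r) (L + r)) * z ^ (-r) := by
  have h0 : 0 < min (N - r) (L + r) := lt_min (by linarith) (by linarith)
  unfold scaleGain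
  split_ifs with h
  · have h1 : y / z ≤ 1 := (div_le_one hz).2 h
    have h2 : y / z ≤ z / y := h1.trans ((one_le_div hy).2 h)
    rw [min_eq_left h2]
    have h3 : (y / z) ^ ((N : ℝ) - r) ≤ (y / z) ^ (min (N - r) (L + r)) :=
      Real.rpow_le_rpow_of_exponent_ge (by positivity) h1 (min_le_left _ _)
    refine le_trans (le_of_eq ?_) (mul_le_mul_of_nonneg_right h3 (by positivity))
    rw [sub_eq_add_neg, Real.rpow_add (by positivity), Real.rpow_natCast,
      Real.div_rpow hy.le hz.le (-r)]
    have := Real.rpow_pos_of_pos hz (-r)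
    field_simp
  · have h := (not_le.1 h).le
    have h1 : z / y ≤ 1 := (div_le_one hy).2 h
    have h2 : z / y ≤ y / z := h1.trans ((one_le_div hz).2 h)
    rw [min_eq_right h2]
    have h3 : (z / y) ^ ((L : ℝ) + r) ≤ (z / y) ^ (min (N - r) (L + r)) :=
      Real.rpow_le_rpow_of_exponent_ge (by positivity) h1 (min_le_right _ _)
    refine le_trans (le_of_eq ?_) (mul_le_mul_of_nonneg_right h3 (by positivity))
    rw [Real.rpow_add (by positivity), Real.rpow_natCast, Real.div_rpow hz.le hy.le r,
      Real.rpow_neg hy.le, Real.rpow_neg hz.le]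
    have := Real.rpow_pos_of_pos hz r
    field_simp

/-- The regular part `χ · θ(x - ·)` as a Schwartz function. -/
def cutoffReflect {Ω : Opens (E d)} (χ : 𝓓(Ω, ℂ)) (θ : 𝓢(E d, ℂ)) (x : E d) : 𝓢(E d, ℂ) :=
  HasCompactSupport.toSchwartzMap (f := fun w => χ w * θ (x - w)) χ.hasCompactSupport.mul_right
    (contDiff_cutoff_mul χ.contDiff θ x)

/-- Moves χ from the distribution to the test function, so that means of χT come from the
reproducing formula for χ₂T. -/
lemma mulTempered_cutoffReflect {Ω : Opens (E d)} {χ χ₂ : 𝓓(Ω, ℂ)} (T : Distr Ω)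
    (h : ∀ x ∈ tsupport χ, χ₂ x = 1) (θ : 𝓢(E d, ℂ)) (x : E d) :
    mulTempered χ₂ T (cutoffReflect χ θ x) = conv (mulTempered χ T) θ x := by
  rw [conv, mulTempered_apply, mulTempered_apply]
  congr 1
  ext w
  simp only [mulTest, TestFunction.coe_mk, reflectTranslate_apply]
  change χ₂ w * (χ w * θ (x - w)) = _
  by_cases hw : w ∈ tsupport χ
  · rw [h w hw, one_mul]
  · simp [image_eq_zero_of_notMem_tsupport hw]

lemma IsReproducing.enorm_conv_le {ι : Type*} [Fintype ι] {ψ Ψ : ι → 𝓢(E d, ℂ)}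
    {Λ : 𝓢(E d, ℂ)} (hrep : IsReproducing ψ Ψ Λ) {Ω : Opens (E d)} {χ χ₂ : 𝓓(Ω, ℂ)} (T : Distr Ω)
    (h : ∀ x ∈ tsupport χ, χ₂ x = 1) (θ : 𝓢(E d, ℂ)) (y : ℝ) (x : E d) :
    ‖conv (mulTempered χ T) (dilate θ y) x‖ₑ ≤
      ‖∫ v, (χ v * conv (mulTempered χ₂ T) Λ v) * dilate θ y (x - v)‖ₑ +
      ∫⁻ z in Ioo (0 : ℝ) 1, ENNReal.ofReal z⁻¹ * ∑ i, ∫⁻ v,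
        ‖conv (mulTempered χ₂ T) (dilate (ψ i) z) v‖ₑ * ‖kernel χ (Ψ i) θ z y x v‖ₑ := by
  obtain ⟨M, b, hb⟩ := exists_isDensity χ₂ T
  rw [← mulTempered_cutoffReflect T h, hrep.apply_eq hb]
  refine (enorm_add_le _ _).trans (add_le_add (le_of_eq ?_) ?_)
  · congr 1
    refine integral_congr_ae (.of_forall fun v => ?_)
    change _ * (χ v * dilate θ y (x - v)) = _
    ring
  · refine (enorm_integral_le_lintegral_enorm _).trans ?_
    refine setLIntegral_mono' measurableSet_Ioo fun z hz => ?_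
    rw [enorm_mul]
    refine mul_le_mul' (le_of_eq ?_) ((enorm_sum_le _ _).trans
      (Finset.sum_le_sum fun i _ => (enorm_integral_le_lintegral_enorm _).trans
        (lintegral_mono fun v => ?_)))
    · rw [← ofReal_norm, Complex.norm_real, Real.norm_of_nonneg (inv_nonneg.2 hz.1.le)]
    · rw [enorm_mul]
      refine mul_le_mul' le_rfl (le_of_eq (congrArg _ ?_))
      refine integral_congr_ae (.of_forall fun w => ?_)
      change (χ w * dilate θ y (x - w)) * _ = _
      ring

end

section

/-! ### The main estimate for local means -/

lemma measurable_weighted_conv {Ω : Opens (E d)} (χ : 𝓓(Ω, ℂ)) (T : Distr Ω)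
    (ψ : 𝓢(E d, ℂ)) (K : Set (E d)) (M : ℕ) :
    Measurable (indicator (Ioo (0 : ℝ) 1 ×ˢ (univ : Set (E d))) fun a =>
      ‖conv (mulTempered χ T) (dilate ψ a.1) a.2‖ₑ * ENNReal.ofReal (distDecay K M a.1 a.2)) := by
  obtain ⟨N, b, hb⟩ := exists_isDensity χ T
  have hs : MeasurableSet (Ioo (0 : ℝ) 1 ×ˢ (univ : Set (E d))) :=
    measurableSet_Ioo.prod MeasurableSet.univ
  have h1 : Measurable (indicator (Ioo (0 : ℝ) 1 ×ˢ (univ : Set (E d))) fun a : ℝ × E d =>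
      conv (mulTempered χ T) (dilate ψ a.1) a.2) := by
    classical
    rw [← piecewise_eq_indicator]
    exact ((hb.continuousOn_conv ψ).mono
      (prod_mono (fun _ h => h.1) subset_rfl)).measurable_piecewise continuousOn_const hs
  have h2 : Measurable fun a : ℝ × E d => ENNReal.ofReal (distDecay K M a.1 a.2) := by
    have : Measurable fun a : ℝ × E d => Metric.infDist a.2 K :=
      (Metric.continuous_infDist_pt K).measurable.comp measurable_snd
    unfold distDecay
    fun_prop
  convert h1.enorm.mul h2 using 1
  funext a
  by_cases ha : a ∈ Ioo (0 : ℝ) 1 ×ˢ (univ : Set (E d)) <;> simp [ha]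

/-- If the local means of `χ₂T` with respect to a reproducing family are controlled near the support
of `χ`, then so are all the local means of `χT`. -/
theorem wNorm_conv_lt_top {ι : Type*} [Fintype ι] {ψ Ψ : ι → 𝓢(E d, ℂ)} {Λ : 𝓢(E d, ℂ)}
    (hrep : IsReproducing ψ Ψ Λ) {Ω : Opens (E d)} {χ χ₂ : 𝓓(Ω, ℂ)} (T : Distr Ω)
    (hχ : ∀ x ∈ tsupport χ, χ₂ x = 1) {V : Opens (E d)} (hV : tsupport χ ⊆ V) {p q : ℝ≥0∞}
    (hp : 1 ≤ p) (hq : 1 ≤ q) {r : ℝ}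
    (h : ∀ i, wNorm q (-r) (fun z =>
      eLpNorm (conv (mulTempered χ₂ T) (dilate (ψ i) z)) p (volume.restrict V)) < ∞)
    {θ : 𝓢(E d, ℂ)} {N : ℕ} (hθ : VanishingMoments θ N) (hN : r < N) :
    wNorm q (-r) (fun y => eLpNorm (conv (mulTempered χ T) (dilate θ y)) p volume) < ∞ := by
  -- `Metric.infDist` to the empty set is 0, so the distance weights carry no information when χ =
  -- 0.
  rcases (tsupport χ).eq_empty_or_nonempty with hK0 | hKn
  · have h0 : ∀ x, χ x = 0 := fun x =>
      image_eq_zero_of_notMem_tsupport (by rw [hK0]; exact notMem_empty x)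
    refine wNorm_lt_top_of_le_rpow hq (t := 1 + r) (C := 0) (by simp) (by linarith) fun y _ => ?_
    have : conv (mulTempered χ T) (dilate θ y) = 0 := by
      funext x
      rw [conv, mulTempered_apply, Pi.zero_apply, ← map_zero T]
      congr 1
      ext w
      simp [mulTest, h0]
    rw [this, eLpNorm_zero, zero_mul]
  set K := tsupport χ
  -- P > r makes the remainder z^P finite in the weight -r, and L > -r is what the scale estimate
  -- needs.
  obtain ⟨P, hP⟩ := exists_nat_gt r
  obtain ⟨L, hL⟩ := exists_nat_gt (-r)
  choose M C hC hM using fun i => exists_eLpNorm_mul_distDecay_le χ₂ T (ψ i) hp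
    χ.hasCompactSupport hKn hV P
  choose A hA0 hA using fun i => exists_norm_kernel_le χ.contDiff χ.hasCompactSupport
    (hrep.vanishingMoments i L) hθ (d + 1) (M i)
  obtain ⟨B, hB0, hB⟩ := exists_norm_integral_mul_dilate_le
    (F := fun v => χ v * conv (mulTempered χ₂ T) Λ v)
    (χ.contDiff.mul (contDiff_conv_mulTempered χ₂ T Λ)) χ.hasCompactSupport.mul_right hθ (d + 1)
  -- Cutting off to 0 < z < 1 only serves joint measurability.
  let H : ι → ℝ → E d → ℝ≥0∞ := fun i z v => indicator (Ioo (0 : ℝ) 1 ×ˢ (univ : Set (E d)))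
    (fun a => ‖conv (mulTempered χ₂ T) (dilate (ψ i) a.1) a.2‖ₑ *
      ENNReal.ofReal (distDecay K (M i) a.1 a.2)) (z, v)
  have hHm : ∀ i, Measurable fun a : ℝ × E d => H i a.1 a.2 := fun i =>
    measurable_weighted_conv χ₂ T (ψ i) K (M i)
  have hHz : ∀ i z, Measurable (H i z) := fun i z => (hHm i).comp measurable_prodMk_left
  have hHe : ∀ i, ∀ z ∈ Ioo (0 : ℝ) 1, ∀ v, H i z v =
      ‖conv (mulTempered χ₂ T) (dilate (ψ i) z) v‖ₑ * ENNReal.ofReal (distDecay K (M i) z v) :=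
    fun i z hz v => indicator_of_mem (mk_mem_prod hz (mem_univ v)) _
  let D : ℝ≥0∞ := ENNReal.ofReal (∫ u : E d, decay (d + 1) u)
  let c : ι → ℝ → ℝ≥0∞ := fun i z =>
    eLpNorm (conv (mulTempered χ₂ T) (dilate (ψ i) z)) p (volume.restrict V) +
      C i * ENNReal.ofReal (z ^ (P : ℝ))
  let Nz : ℝ → ℝ≥0∞ := fun z => ∑ i, ENNReal.ofReal (A i) * (D * c i z)
  have hcm : ∀ i, AEMeasurable (c i) (volume.restrict (Ioo (0 : ℝ) 1)) := fun i =>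
    (aemeasurable_eLpNorm_conv χ₂ T (ψ i) p V).add (by fun_prop)
  have hNzm : AEMeasurable Nz (volume.restrict (Ioo (0 : ℝ) 1)) :=
    Finset.aemeasurable_fun_sum _ fun i _ => ((hcm i).const_mul _).const_mul _
  have hNz : wNorm q (-r) Nz < ∞ := by
    refine wNorm_sum_lt_top hq _ (fun i _ => ((hcm i).const_mul _).const_mul _) fun i _ => ?_
    refine wNorm_const_mul_lt_top hq ENNReal.ofReal_ne_top
      (wNorm_const_mul_lt_top hq ENNReal.ofReal_ne_top ?_)
    exact wNorm_add_lt_top hq (fun _ _ => le_rfl) (aemeasurable_eLpNorm_conv χ₂ T (ψ i) p V) (h i)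
      (wNorm_lt_top_of_le_rpow hq (t := P) (hC i) (by linarith) fun _ _ => le_rfl)
  let G : ℝ → E d → ℝ → ℝ≥0∞ := fun y x z => ENNReal.ofReal z⁻¹ *
    (ENNReal.ofReal (scaleGain N L y z) * ∑ i, ENNReal.ofReal (A i) *
      ∫⁻ v, scaledDecay (max y z) (x - v) * H i z v)
  have hIm : ∀ i y, Measurable fun a : E d × ℝ =>
      ∫⁻ v, scaledDecay (max y a.2) (a.1 - v) * H i a.2 v := by
    intro i y
    refine Measurable.lintegral_prod_right' (f := fun w : (E d × ℝ) × E d =>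
      scaledDecay (max y w.1.2) (w.1.1 - w.2) * H i w.1.2 w.2) ?_
    have e1 : Measurable fun w : (E d × ℝ) × E d => (max y w.1.2, w.1.1 - w.2) := by fun_prop
    have e2 : Measurable fun w : (E d × ℝ) × E d => (w.1.2, w.2) := by fun_prop
    exact (measurable_uncurry_scaledDecay.comp e1).mul ((hHm i).comp e2)
  have hGm : ∀ y, Measurable (Function.uncurry (G y)) := by
    intro y
    have e1 : Measurable fun a : E d × ℝ => ENNReal.ofReal (scaleGain N L y a.2) :=
      ((measurable_scaleGain N L y).comp measurable_snd).ennreal_ofReal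
    have e2 : Measurable fun a : E d × ℝ => ∑ i, ENNReal.ofReal (A i) *
        ∫⁻ v, scaledDecay (max y a.2) (a.1 - v) * H i a.2 v :=
      Finset.measurable_fun_sum _ fun i _ => (hIm i y).const_mul _
    have e3 : Measurable fun a : E d × ℝ => ENNReal.ofReal a.2⁻¹ := by fun_prop
    exact e3.mul (e1.mul e2)
  -- Young's inequality at fixed scales: the L¹ norm of `scaledDecay` does not depend on the scale.
  have hGp : ∀ y ∈ Ioo (0 : ℝ) 1, ∀ z ∈ Ioo (0 : ℝ) 1,
      eLpNorm (fun x => G y x z) p volume ≤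
        ENNReal.ofReal z⁻¹ * (ENNReal.ofReal (scaleGain N L y z) * Nz z) := by
    intro y hy z hz
    refine (eLpNorm_const_mul_le p ENNReal.ofReal_ne_top _).trans (mul_le_mul' le_rfl ?_)
    refine (eLpNorm_const_mul_le p ENNReal.ofReal_ne_top _).trans (mul_le_mul' le_rfl ?_)
    have hm : ∀ i, Measurable fun x : E d =>
        ∫⁻ v, scaledDecay (max y z) (x - v) * H i z v := fun i =>
      (hIm i y).comp measurable_prodMk_right
    have e : (fun x : E d => ∑ i, ENNReal.ofReal (A i) *
        ∫⁻ v, scaledDecay (max y z) (x - v) * H i z v) = ∑ i, fun x => ENNReal.ofReal (A i) *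
        ∫⁻ v, scaledDecay (max y z) (x - v) * H i z v := by
      funext x; rw [Finset.sum_apply]
    rw [e]
    refine (eLpNorm_sum_le (fun i _ => ((hm i).const_mul _).aestronglyMeasurable) hp).trans
      (Finset.sum_le_sum fun i _ => ?_)
    refine (eLpNorm_const_mul_le p ENNReal.ofReal_ne_top _).trans (mul_le_mul' le_rfl ?_)
    refine (eLpNorm_convolution_le hp (measurable_uncurry_scaledDecay.comp measurable_prodMk_left)
      (fun u => ENNReal.ofReal_ne_top) (hHz i z)).trans ?_
    have hmax : 0 < max y z := lt_max_of_lt_left hy.1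
    refine mul_le_mul' (lintegral_scaledDecay hmax).le ?_
    have : H i z = fun v => ‖conv (mulTempered χ₂ T) (dilate (ψ i) z) v‖ₑ *
        ENNReal.ofReal (distDecay K (M i) z v) := funext fun v => hHe i z hz v
    rw [this]
    exact hM i z hz
  -- The low-frequency part is a fixed test function, so the moments of θ alone make its
  -- contribution O(y^N).
  have hpt : ∀ y ∈ Ioo (0 : ℝ) 1, ∀ x, ‖conv (mulTempered χ T) (dilate θ y) x‖ₑ ≤
      ENNReal.ofReal (y ^ (N : ℝ)) * ENNReal.ofReal (B * decay (d + 1) x) +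
        ∫⁻ z in Ioo (0 : ℝ) 1, G y x z := by
    intro y hy x
    have hy0 := hy.1
    refine (hrep.enorm_conv_le T hχ θ y x).trans (add_le_add ?_ ?_)
    · rw [← ofReal_norm, ← ENNReal.ofReal_mul (by positivity), Real.rpow_natCast]
      exact ENNReal.ofReal_le_ofReal ((hB y hy x).trans_eq (by ring))
    · refine setLIntegral_mono' measurableSet_Ioo fun z hz => mul_le_mul' le_rfl ?_
      rw [Finset.mul_sum]
      refine Finset.sum_le_sum fun i _ => ?_
      rw [← lintegral_const_mul' _ _ ENNReal.ofReal_ne_top,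
        ← lintegral_const_mul' _ _ ENNReal.ofReal_ne_top]
      refine lintegral_mono fun v => ?_
      have hz0 := hz.1
      have hg := scaleGain_nonneg N L hy0 hz0
      have hmax : 0 < max y z := lt_max_of_lt_left hy0
      have hk : ‖kernel χ (Ψ i) θ z y x v‖ₑ ≤ ENNReal.ofReal (A i) *
          (ENNReal.ofReal (scaleGain N L y z) * scaledDecay (max y z) (x - v) *
            ENNReal.ofReal (distDecay K (M i) z v)) := by
        have hsd : 0 ≤ (max y z ^ d)⁻¹ * decay (d + 1) ((max y z)⁻¹ • (x - v)) :=
          mul_nonneg (by positivity) (decay_nonneg _ _)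
        rw [← ofReal_norm, scaledDecay, ← ENNReal.ofReal_mul hg,
          ← ENNReal.ofReal_mul (mul_nonneg hg hsd), ← ENNReal.ofReal_mul (hA0 i)]
        exact ENNReal.ofReal_le_ofReal (hA i y hy z hz x v)
      rw [hHe i z hz v]
      calc _ ≤ ‖conv (mulTempered χ₂ T) (dilate (ψ i) z) v‖ₑ * (ENNReal.ofReal (A i) *
          (ENNReal.ofReal (scaleGain N L y z) * scaledDecay (max y z) (x - v) *
            ENNReal.ofReal (distDecay K (M i) z v))) := by gcongr
        _ = _ := by ring
  have hGl : ∀ y, Measurable fun x => ∫⁻ z in Ioo (0 : ℝ) 1, G y x z := fun y =>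
    (hGm y).lintegral_prod_right'
  have hDec : Measurable fun x : E d => ENNReal.ofReal (B * decay (d + 1) x) :=
    ((continuous_decay _).measurable.const_mul _).ennreal_ofReal
  set Q : ℝ≥0∞ := eLpNorm (fun x : E d => ENNReal.ofReal (B * decay (d + 1) x)) p volume
  have hQ : Q ≠ ∞ := by
    have : Q ≤ eLpNorm (fun x : E d => B * decay (d + 1) x) p volume :=
      eLpNorm_mono_enorm fun x => by
        rw [enorm_eq_self, Real.enorm_of_nonneg (mul_nonneg hB0 (decay_nonneg _ _))]
    exact (this.trans_lt ((memLp_decay hp).const_mul B).2).ne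
  have hmain : ∀ y ∈ Ioo (0 : ℝ) 1,
      eLpNorm (conv (mulTempered χ T) (dilate θ y)) p volume ≤
        Q * ENNReal.ofReal (y ^ (N : ℝ)) + ∫⁻ z in Ioo (0 : ℝ) 1,
          ENNReal.ofReal z⁻¹ * (ENNReal.ofReal (scaleGain N L y z) * Nz z) := by
    intro y hy
    refine (eLpNorm_mono_enorm (g := (fun x => ENNReal.ofReal (y ^ (N : ℝ)) *
      ENNReal.ofReal (B * decay (d + 1) x)) + fun x => ∫⁻ z in Ioo (0 : ℝ) 1, G y x z)
      (hpt y hy)).trans ?_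
    refine (eLpNorm_add_le (hDec.const_mul _).aestronglyMeasurable
      (hGl y).aestronglyMeasurable hp).trans (add_le_add ?_ ?_)
    · rw [mul_comm]
      exact eLpNorm_const_mul_le p ENNReal.ofReal_ne_top _
    · refine eLpNorm_lintegral_le hp (hGm y) ?_
        ((ae_restrict_iff' measurableSet_Ioo).2 (.of_forall fun z hz => hGp y hy z hz))
      exact AEMeasurable.mul (by fun_prop)
        (((measurable_scaleGain N L y).ennreal_ofReal.aemeasurable).mul hNzm)
  refine wNorm_add_lt_top hq hmain (by fun_prop) ?_ ?_
  · exact wNorm_lt_top_of_le_rpow hq (t := N) hQ (by linarith) fun _ _ => le_rfl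
  · exact wNorm_lt_top_of_hardy hq (lt_min (by linarith) (by linarith)) hNzm
      (fun y hy z hz => rpow_mul_scaleGain_le hN hL hy.1 hz.1) (fun _ _ => le_rfl) hNz

end

section

/-! ### Regularity of regularizations -/

/-- The partial derivative `∂_{j₁} ⋯ ∂_{j_m} ψ` of a Schwartz function, as a Schwartz function. -/
def schwartzPartial {m : ℕ} (j : Fin m → Fin d) (ψ : 𝓢(E d, ℂ)) : 𝓢(E d, ℂ) :=
  LineDeriv.iteratedLineDerivOp (fun i => (EuclideanSpace.single (j i) 1 : E d)) ψ

/-- The mean at a fixed scale decays like (1 + |x|)^{-d-1}, the support of χ being bounded. So the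
low-frequency term of the Besov norm is always finite here. -/
lemma eLpNorm_conv_lt_top {Ω : Opens (E d)} (χ : 𝓓(Ω, ℂ)) (T : Distr Ω) (ψ : 𝓢(E d, ℂ))
    {p : ℝ≥0∞} (hp : 1 ≤ p) : eLpNorm (conv (mulTempered χ T) ψ) p volume < ∞ := by
  obtain ⟨C, N, hC, h⟩ := exists_norm_mulTempered_le χ T
  choose B hB0 hB using fun j => exists_norm_iteratedFDeriv_le_decay ψ j (d + 1)
  obtain ⟨R, hR⟩ := (χ.hasCompactSupport : IsCompact (tsupport χ)).isBounded.exists_norm_le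
  have hS : 0 ≤ ∑ j ∈ Finset.range (N + 1), B j := Finset.sum_nonneg fun j _ => hB0 j
  refine ((memLp_decay hp).const_mul (C * ((∑ j ∈ Finset.range (N + 1), B j) *
    (1 + |R|) ^ (d + 1)))).of_le (contDiff_conv_mulTempered χ T ψ).continuous.aestronglyMeasurable
    (.of_forall fun x => ?_) |>.eLpNorm_lt_top
  refine (h (reflectTranslate ψ x) ((∑ j ∈ Finset.range (N + 1), B j) *
    (decay (d + 1) x * (1 + |R|) ^ (d + 1))) (by have := decay_nonneg (d + 1) x; positivity)
    fun j hj w hw => ?_).trans ((le_of_eq (by ring)).trans (Real.le_norm_self _))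
  rw [norm_iteratedFDeriv_reflectTranslate]
  refine (hB j _).trans (mul_le_mul
    (Finset.single_le_sum (fun j _ => hB0 j) (Finset.mem_range.2 (by omega)))
    ((decay_sub_le _ _ _).trans ?_) (decay_nonneg _ _) hS)
  have := decay_nonneg (d + 1) x
  gcongr
  exact (hR w hw).trans (le_abs_self R)

lemma eLpNorm_partialDeriv_mollify {Ω : Opens (E d)} (χ : 𝓓(Ω, ℂ)) (T : Distr Ω)
    (φ : 𝓢(E d, ℂ)) {m : ℕ} (j : Fin m → Fin d) {ε : ℝ} (hε : 0 < ε) (p : ℝ≥0∞)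
    (ω : Opens (E d)) :
    eLpNorm (partialDeriv j (mollify φ (mulTempered χ T) ε)) p (volume.restrict ω) =
      ENNReal.ofReal (ε ^ (-m : ℝ)) *
        eLpNorm (conv (mulTempered χ T) (dilate (schwartzPartial j φ) ε)) p
          (volume.restrict ω) := by
  have h1 : partialDeriv j (mollify φ (mulTempered χ T) ε) =
      (ε ^ (-m : ℝ)) • conv (mulTempered χ T) (dilate (schwartzPartial j φ) ε) := by
    funext x
    rw [Pi.smul_apply, Complex.real_smul, Real.rpow_neg hε.le, Real.rpow_natCast]
    exact partialDeriv_conv_dilate χ T φ j hε x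
  rw [h1, eLpNorm_const_smul, Real.enorm_of_nonneg (Real.rpow_nonneg hε.le _)]

/-- The weighted Sobolev norm of a mollified distribution is finite as soon as its local means with
respect to the partial derivatives of the mollifier are controlled. -/
lemma netNorm_mollify_lt_top {Ω : Opens (E d)} (χ : 𝓓(Ω, ℂ)) (T : Distr Ω) (φ : 𝓢(E d, ℂ))
    {p q : ℝ≥0∞} (hq : 1 ≤ q) {s : ℝ} {k : ℕ} {ω : Opens (E d)}
    (h : ∀ m ≤ k, ∀ j : Fin m → Fin d, wNorm q (s - m) (fun ε =>
      eLpNorm (conv (mulTempered χ T) (dilate (schwartzPartial j φ) ε)) p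
        (volume.restrict ω)) < ∞) :
    netNorm q p s k ω (mollify φ (mulTempered χ T)) < ∞ := by
  let F : (Σ m : Fin (k + 1), Fin m → Fin d) → ℝ → ℝ≥0∞ := fun i ε =>
    eLpNorm (partialDeriv i.2 (mollify φ (mulTempered χ T) ε)) p (volume.restrict ω)
  refine (wNorm_mono_fun (N' := fun ε => ∑ i, F i ε) fun ε _ => ?_).trans_lt
    (wNorm_sum_lt_top hq Finset.univ (fun i _ => aemeasurable_eLpNorm
      ((isSmoothNet_mollify χ T φ ω).continuousOn_partialDeriv i.2)) fun i _ => ?_)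
  · refine iSup_le fun m => iSup_le fun hm => iSup_le fun j => ?_
    let i : (Σ m : Fin (k + 1), Fin m → Fin d) := ⟨⟨m, by omega⟩, j⟩
    have : F i ε ≤ ∑ i, F i ε :=
      Finset.single_le_sum (f := fun i => F i ε) (fun _ _ => zero_le) (Finset.mem_univ i)
    exact this
  · rw [wNorm_congr_fun fun ε hε => eLpNorm_partialDeriv_mollify χ T φ i.2 hε.1 p ω,
      wNorm_rpow_mul, ← sub_eq_add_neg]
    exact h i.1 (by omega) i.2

/-- Only the derivatives of order exactly k are retained: their factor ε^{-k} turns the weight s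
into s - k, that of the Besov norm. -/
lemma wNorm_conv_schwartzPartial_lt_top {Ω : Opens (E d)} {χ : 𝓓(Ω, ℂ)} {T : Distr Ω}
    {φ : 𝓢(E d, ℂ)} {p q : ℝ≥0∞} {s : ℝ} {k : ℕ} {ω : Opens (E d)}
    (h : netNorm q p s k ω (mollify φ (mulTempered χ T)) < ∞) (j : Fin k → Fin d) :
    wNorm q (s - k) (fun ε => eLpNorm (conv (mulTempered χ T)
      (dilate (schwartzPartial j φ) ε)) p (volume.restrict ω)) < ∞ := by
  rw [sub_eq_add_neg, ← wNorm_rpow_mul]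
  refine (wNorm_mono_fun fun ε hε => ?_).trans_lt h
  rw [← eLpNorm_partialDeriv_mollify χ T φ j hε.1]
  exact le_iSup_of_le k (le_iSup_of_le le_rfl (le_iSup_of_le j le_rfl))

/-- Near 0 the transform 𝓕 φ is nonzero, as 𝓕 φ 0 = 1. For ξ ≠ 0 some coordinate ξ_l is nonzero, and
𝓕(∂_l^k φ) is a nonzero multiple of ξ_l^k 𝓕 φ. -/
lemma exists_isReproducing_schwartzPartial {φ : 𝓢(E d, ℂ)} (hφ : ∫ x, φ x = 1) (k : ℕ) :
    ∃ (Ψ : (Fin k → Fin d) → 𝓢(E d, ℂ)) (Λ : 𝓢(E d, ℂ)),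
      IsReproducing (fun j => schwartzPartial j φ) Ψ Λ := by
  have h0 : 𝓕 φ 0 ≠ 0 := by
    rw [SchwartzMap.fourier_coe, Real.fourier_eq]
    simp [hφ]
  obtain ⟨σ, hσ, hb⟩ := Metric.eventually_nhds_iff.1
    ((𝓕 φ).continuous.continuousAt.eventually_ne h0)
  refine exists_isReproducing _ (σ := σ / 2) (η := 1 / 2) (by positivity) (by norm_num)
    fun ξ h1 h2 => ?_
  have hξ : ξ ≠ 0 := by
    rintro rfl
    rw [norm_zero] at h1
    linarith
  obtain ⟨l, hl⟩ : ∃ l, ξ l ≠ 0 := by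
    by_contra! h
    exact hξ (by ext l; simp [h l])
  refine ⟨fun _ => l, ?_⟩
  have hξσ : 𝓕 φ ξ ≠ 0 := hb (by rw [dist_zero_right]; linarith)
  rw [schwartzPartial, fourier_iteratedLineDerivOp]
  simp [hξσ, hl, EuclideanSpace.inner_single_right, Real.pi_ne_zero]

variable {p q : ℝ≥0∞} [Fact (1 ≤ p)] [Fact (1 ≤ q)]

lemma IsRep.netNorm_lt_top_iff {φ : 𝓢(E d, ℂ)} {Ω : Opens (E d)} {T : Distr Ω} {f : Net d}
    (hf : IsRep q p φ T f) {χ : 𝓓(Ω, ℂ)} {U ω : Opens (E d)} (hχ : ∀ x ∈ U, χ x = 1)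
    (hU : U ≤ Ω) (hω : CompactlyIn ω U) {s : ℝ} {k : ℕ} :
    netNorm q p s k ω f < ∞ ↔ netNorm q p s k ω (mollify φ (mulTempered χ T)) < ∞ := by
  have hn := hf χ U hχ
  have hsm := (isSmoothNet_mollify χ T φ ω)
  have hfs : IsSmoothNet ω f := hf.mem_moderate.1.mono (hω.le.trans hU)
  have h1 := hn.2 k ω hω s
  have hds : IsSmoothNet ω (f - mollify φ (mulTempered χ T)) := hn.1.mono hω.le
  constructor
  · intro h
    have := hfs.netNorm_add_lt_top (hds.smul (-1)) Fact.out Fact.out h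
      (hds.netNorm_smul_lt_top (-1) h1)
    simpa using this
  · intro h
    have := hds.netNorm_add_lt_top hsm Fact.out Fact.out h1 h
    simpa using this

/-- Local Besov regularity of `T` gives the corresponding growth of its regularizations. -/
theorem embed_mem_regGenFun {φ φ₀ ψ₀ : 𝓢(E d, ℂ)} {Ω : Opens (E d)} {k : ℕ} {s : ℝ} (hs : 0 < s)
    (hLP : IsLPPair φ₀ ψ₀ (k - s)) {T : Distr Ω} (hT : T ∈ besovLoc φ₀ ψ₀ (k - s) p q Ω) :
    embed q p φ Ω T ∈ regGenFun q p k s Ω := by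
  refine ⟨rep q p φ Ω T, (isRep_rep φ T).mem_moderate, fun ω hω => ?_, embed_apply φ T⟩
  obtain ⟨χ, U, hωU, hUΩ, hχ⟩ := exists_cutoff hω.1 hω.2
  rw [(isRep_rep φ T).netNorm_lt_top_iff hχ hUΩ ⟨hω.1, hωU⟩]
  obtain ⟨χ₂, U₂, hχU₂, -, hχ₂⟩ := exists_cutoff (K := tsupport χ) χ.hasCompactSupport
    χ.tsupport_subset
  obtain ⟨σ, hσ, η, hη, -, hψ⟩ := hLP.fourier_ne_zero
  obtain ⟨Ψ, Λ, hrep⟩ := exists_isReproducing (fun _ : Unit => ψ₀) hσ hη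
    fun ξ h1 h2 => ⟨(), hψ ξ h1 h2⟩
  refine netNorm_mollify_lt_top χ T φ Fact.out fun m hm j => ?_
  have hmk : (m : ℝ) ≤ k := by exact_mod_cast hm
  have hB := (ENNReal.add_lt_top.1 (hT χ₂)).2
  -- The Besov bound is global, hence V = ⊤. As m ≤ k and ε < 1, order k - s controls order m - s;
  -- the m vanishing moments of ∂^j φ exceed m - s because s > 0.
  have := wNorm_conv_lt_top hrep T (fun x hx => hχ₂ x (hχU₂ hx)) (V := ⊤) (subset_univ _)
    (p := p) (q := q) Fact.out Fact.out (r := m - s)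
    (fun _ => by
      simp only [Opens.coe_top, Measure.restrict_univ]
      exact (wNorm_mono (by linarith) _).trans_lt hB)
    (vanishingMoments_iteratedLineDerivOp
      (fun i => (EuclideanSpace.single (j i) 1 : E d)) φ) (by linarith)
  rw [neg_sub] at this
  exact (wNorm_mono_fun fun ε _ => eLpNorm_mono_measure _ Measure.restrict_le_self).trans_lt this

/-- The growth of the regularizations of `T` gives the corresponding local Besov regularity. -/
theorem mem_besovLoc_of_embed_mem {φ φ₀ ψ₀ : 𝓢(E d, ℂ)} (hφ : ∫ x, φ x = 1) {Ω : Opens (E d)}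
    {k : ℕ} {s : ℝ} (hLP : IsLPPair φ₀ ψ₀ (k - s)) {T : Distr Ω}
    (hT : embed q p φ Ω T ∈ regGenFun q p k s Ω) : T ∈ besovLoc φ₀ ψ₀ (k - s) p q Ω := by
  obtain ⟨f, hf, hfr, hTf⟩ := hT
  rw [embed_eq_mk_iff] at hTf
  intro χ
  -- The growth hypothesis controls the net only on sets relatively compact in Ω; V is such a
  -- neighbourhood of the support of χ, and χ₂ is 1 near its closure.
  obtain ⟨V, hVo, hχV, hVΩ, hVc⟩ := exists_open_between_and_isCompact_closure
    (χ.hasCompactSupport : IsCompact (tsupport χ)) Ω.isOpen χ.tsupport_subset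
  obtain ⟨χ₂, U, hVU, hUΩ, hχ₂⟩ := exists_cutoff hVc hVΩ
  let ω : Opens (E d) := ⟨V, hVo⟩
  have hω : CompactlyIn ω Ω := ⟨hVc, hVΩ⟩
  have hn := (hTf.netNorm_lt_top_iff hχ₂ hUΩ (ω := ω) ⟨hVc, hVU⟩).1 (hfr ω hω)
  obtain ⟨Ψ, Λ, hrep⟩ := exists_isReproducing_schwartzPartial hφ k
  refine ENNReal.add_lt_top.2 ⟨eLpNorm_conv_lt_top χ T φ₀ Fact.out, ?_⟩
  refine wNorm_conv_lt_top hrep T (fun x hx => hχ₂ x (hVU (subset_closure (hχV hx))))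
    (V := ω) hχV Fact.out Fact.out (fun j => ?_) hLP.vanishingMoments ?_
  · rw [neg_sub]
    exact wNorm_conv_schwartzPartial_lt_top hn j
  -- The number of vanishing moments of ψ₀ exceeds r = k - s because r < ⌊r⌋ + 1.
  · have h1 : ((⌊(k : ℝ) - s⌋ + 1 : ℤ) : ℝ) ≤ ((⌊(k : ℝ) - s⌋ + 1).toNat : ℝ) := by
      exact_mod_cast Int.self_le_toNat _
    have h2 := Int.lt_floor_add_one ((k : ℝ) - s)
    push_cast at h1
    linarith

end

end BesovGF

end

/-! ### Existence, uniqueness and the characterization of local Besov regularity -/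

theorem mainTheorem1 (d : ℕ) (p q : ℝ≥0∞) [Fact (1 ≤ p)] [Fact (1 ≤ q)]
    (φ : 𝓢(BesovGF.E d, ℂ)) (hφ : BesovGF.IsMollifier φ) :
    ∃ ι : ∀ Ω : Opens (BesovGF.E d), BesovGF.Distr Ω →ₗ[ℂ] BesovGF.GenFun q p Ω,
      BesovGF.IsCanonicalEmbedding φ ι ∧
      (∀ ι' : ∀ Ω : Opens (BesovGF.E d), BesovGF.Distr Ω →ₗ[ℂ] BesovGF.GenFun q p Ω,
        BesovGF.IsCanonicalEmbedding φ ι' → ι' = ι) ∧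
      ∀ (Ω : Opens (BesovGF.E d)) (k : ℕ) (s : ℝ), 0 < s →
        ∀ φ₀ ψ₀ : 𝓢(BesovGF.E d, ℂ), BesovGF.IsLPPair φ₀ ψ₀ (k - s) →
          BesovGF.regGenFun q p k s Ω ∩ Set.range (ι Ω) =
            ι Ω '' BesovGF.besovLoc φ₀ ψ₀ (k - s) p q Ω := by
  refine ⟨BesovGF.embed q p φ, BesovGF.isCanonicalEmbedding_embed hφ.integral_eq_one,
    fun ι' hι' => hι'.eq_embed, fun Ω k s hs φ₀ ψ₀ hLP => Set.Subset.antisymm ?_ ?_⟩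
  · rintro _ ⟨hreg, T, rfl⟩
    exact ⟨T, BesovGF.mem_besovLoc_of_embed_mem hφ.integral_eq_one hLP hreg, rfl⟩
  · rintro _ ⟨T, hT, rfl⟩
    exact ⟨BesovGF.embed_mem_regGenFun hs hLP hT, T, rfl⟩
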